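/- Let $n,d\ge 0$, let $\lambda=(\lambda_1\ge\dots\ge\lambda_n\ge 0)$ be a partition of $d$ and $\mu=(\mu_1,\dots,\mu_n)$ a composition of $d$ with parts $\mu_i\ge 0$; let $\mu^+$ be its weakly decreasing rearrangement, let $\ge$ denote the dominance order, and put $d_\mu=\frac12\sum_i\mu_i(\mu_i-1)$ (and likewise $d_\lambda$). Let $f_1,\dots,f_d$ be the basis of $\mathbb C^d$ indexed by the boxes of the Young diagram of $\lambda$ (English convention), read along rows from the top, and let $x^\lambda$ be the nilpotent endomorphism sending each basis vector to the one immediately below it, or to $0$ at the bottom of a column. Let $X_\mu$ be the variety of flags $0=V_0\le V_1\le\dots\le V_n=\mathbb C^d$ with $\dim V_i/V_{i-1}=\mu_i$, with its Zariski topology, and $$X^\lambda_\mu=\{(V_0,\dots,V_n)\in X_\mu : x^\lambda V_i\subseteq V_{i-1}\text{ for } i=1,\dots,n\}.$$ Let $\mathrm{Std}^\lambda_\mu$ be the set of semistandard $\lambda$-tableaux with exactly $\mu_i$ entries equal to $i$ for $i=1,\dots,n$. For $S\in\mathrm{Std}^\lambda_\mu$ let $J^{-1}(S)\subseteq X^\lambda_\mu$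 be the set of flags such that, for every $j=0,\dots,n$, the restriction of $x^\lambda$ to $V_j$ has Jordan type the transpose of the shape formed by the boxes of $S$ with entry $\le j$. The subset $Y^\circ_S\subseteq X^\lambda_\mu$ is defined by recursion on $n$. If $n=0$ it is $X^\lambda_\mu$ (a point). If $n\ge1$, let $k=\mu_n$, let $c_1<\dots<c_k$ be the columns of $S$ containing the entry $n$, let $\overline S$, of shape $\overline\lambda$ and content $\overline\mu=(\mu_1,\dots,\mu_{n-1})$, be obtained from $S$ by removing the entries $n$, let $\perp$ refer to the symmetric bilinear form with $(f_i,f_j)=\delta_{ij}$, and choose a linear isomorphism $\theta:\langle f_{c_1},\dots,f_{c_k}\rangle^\perp\to\mathbb C^{d-k}$ with $\theta\circ x^\lambda=x^{\overline\lambda}\circ\theta$. Let $Y^\circ$ be the Schubert cell of $k$-dimensional subspaces $U$ of the form $$U=\Big\langle f_{c_i}+\sum_{j\le c_i,\ j\ne c_1,\dots,c_i}a_{i,j}f_j \;:\; i=1,\dots,k\Big\rangle,$$ and for such $U$ let $g(U)\in GL_d(\mathbb C)$ be the unique matrix that maps $f_{c_i}$ to the $i$-th displayed vector, fixes the $f_j$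 with $j\le\lambda_1$ and $j\ne c_1,\dots,c_k$, and satisfies $g(U)x^\lambda f_j=x^\lambda g(U)f_j$ whenever $x^\lambda f_j\ne0$. Then $Y^\circ_S$ is the set of $(V_0,\dots,V_n)\in X^\lambda_\mu$ such that $U:=V_{n-1}^\perp\in Y^\circ$ and $\big(\theta(g(U)^TV_0),\dots,\theta(g(U)^TV_{n-1})\big)\in Y^\circ_{\overline S}$. **Theorem (Spaltenstein).** Assume $\lambda\ge\mu^+$. Then $d_\mu\le d_\lambda$, and $X^\lambda_\mu$ is non-empty and equidimensional of dimension $d_\lambda-d_\mu$. For every $S\in\mathrm{Std}^\lambda_\mu$ isomorphisms $\theta$ as above exist at each step, so that $Y_S^\circ$ is defined; and, whatever choices are made, with Zariski closures taken in $X^\lambda_\mu$, $$Y_S:=\overline{Y_S^\circ}=\overline{J^{-1}(S)}\qquad(S\in\mathrm{Std}^\lambda_\mu)$$ are pairwise distinct and are exactly the irreducible components of $X^\lambda_\mu$. -/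

import Mathlib

noncomputable section

namespace SpaltensteinVariety

/-! ### Zariski topology, flags, dimension -/

/-- The Zariski topology on the affine space `ℂ^σ`: the closed sets are the common zero sets of
sets of polynomials. -/
@[reducible] def zariski (σ : Type) : TopologicalSpace (σ → ℂ) :=
  TopologicalSpace.ofClosed
    {Z | ∃ P : Set (MvPolynomial σ ℂ), Z = {x | ∀ p ∈ P, MvPolynomial.eval x p = 0}}
    ⟨{1}, by ext x; simp⟩
    (by
      intro A hA
      refine ⟨{p | ∃ Z ∈ A, ∀ x ∈ Z, MvPolynomial.eval x p = 0}, ?_⟩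
      ext x
      constructor
      · rintro hx p ⟨Z, hZ, hp⟩
        exact hp x (hx Z hZ)
      · intro hx Z hZ
        obtain ⟨P, rfl⟩ := hA hZ
        exact fun p hp => hx p ⟨_, hZ, fun y hy => hy p hp⟩)
    (by
      rintro _ ⟨P, rfl⟩ _ ⟨Q, rfl⟩
      refine ⟨{r | ∃ p ∈ P, ∃ q ∈ Q, r = p * q}, ?_⟩
      ext x
      constructor
      · rintro (h | h) r ⟨p, hp, q, hq, rfl⟩
        · simp [h p hp]
        · simp [h q hq]
      · intro h
        by_contra hcon
        simp only [Set.mem_union, Set.mem_ofPred_eq, not_or, not_forall] at hcon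
        obtain ⟨⟨p, hp, hp0⟩, ⟨q, hq, hq0⟩⟩ := hcon
        have := h (p * q) ⟨p, hp, q, hq, rfl⟩
        rw [map_mul] at this
        exact (mul_ne_zero hp0 hq0) this)

/-- Partial flags `(V_0, …, V_n)` of type `μ` in `ℂ^ι`:
`0 = V_0 ≤ V_1 ≤ ⋯ ≤ V_n = ℂ^ι` with `dim V_i / V_{i-1} = μ_i`. -/
@[ext]
structure PartialFlag (ι : Type) {n : ℕ} (μ : Fin n → ℕ) where
  V : Fin (n + 1) → Submodule ℂ (ι → ℂ)
  zero : V 0 = ⊥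
  last : V (Fin.last n) = ⊤
  le : ∀ i : Fin n, V i.castSucc ≤ V i.succ
  dim : ∀ i : Fin n,
    Module.finrank ℂ (V i.succ) = Module.finrank ℂ (V i.castSucc) + μ i

/-- A basis `b` of `ℂ^ι` together with the flag of type `μ` to which it is adapted:
`V_j` is spanned by the first `μ_1 + ⋯ + μ_j` members of `b`. -/
def AdaptedBasis (ι : Type) {n : ℕ} (μ : Fin n → ℕ) : Type :=
  {p : Module.Basis (Fin (∑ i, μ i)) ℂ (ι → ℂ) × PartialFlag ι μ //
    ∀ j : Fin (n + 1), p.2.V j =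
      Submodule.span ℂ (p.1 '' {a | a.val < ∑ i : Fin n with i.val < j.val, μ i})}

/-- The Zariski topology on the partial flag variety `X_μ = GL_d / P_μ`: the quotient topology
along the map `GL_d → X_μ` which sends a basis (an invertible matrix, with the Zariski topology
in its `d × d` coordinates) to the flag to which it is adapted. -/
instance (ι : Type) {n : ℕ} (μ : Fin n → ℕ) : TopologicalSpace (PartialFlag ι μ) :=
  TopologicalSpace.coinduced (fun p : AdaptedBasis ι μ => p.1.2)
    (TopologicalSpace.induced
      (fun (p : AdaptedBasis ι μ) (x : Fin (∑ i, μ i) × ι) => p.1.1 x.1 x.2)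
      (zariski (Fin (∑ i, μ i) × ι)))

/-- A nonempty space all of whose irreducible components have Krull dimension `N`. -/
def IsEquidimensional (X : Type) [TopologicalSpace X] (N : ℕ) : Prop :=
  Nonempty X ∧ ∀ Z ∈ irreducibleComponents X, topologicalKrullDim Z = (N : WithBot ℕ∞)

/-! ### Boxes, the nilpotent matrix, Spaltenstein varieties -/

/-- The boxes `(i, j)` (row, column; counted from `0`) of a Young diagram, ordered by reading
along rows starting from the top row. The space `ℂ^d` is `Box lam → ℂ`; the basis
`f_1, …, f_d` is the standard basis in this order. -/
abbrev Box (lam : YoungDiagram) : Type := {b : ℕ ×ₗ ℕ // ofLex b ∈ lam}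

instance (lam : YoungDiagram) : Fintype (Box lam) :=
  Fintype.subtype (lam.cells.map toLex.toEmbedding) (by
    intro b
    simp only [Finset.mem_map_equiv, YoungDiagram.mem_cells]
    rfl)

def Box.row {lam : YoungDiagram} (b : Box lam) : ℕ := (ofLex b.1).1

def Box.col {lam : YoungDiagram} (b : Box lam) : ℕ := (ofLex b.1).2

/-- The basis vector belonging to an index. -/
def stdVec {ι : Type} [DecidableEq ι] (b : ι) : ι → ℂ := Pi.single b 1

/-- The nilpotent endomorphism `x^λ`, of Jordan type `λ^T`: it sends a basis vector to the one
immediately below it in the diagram, or to zero if it is at the bottom of its column. -/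
def nilp (lam : YoungDiagram) : (Box lam → ℂ) →ₗ[ℂ] (Box lam → ℂ) :=
  (Pi.basisFun ℂ (Box lam)).constr ℂ fun b =>
    if h : (b.row + 1, b.col) ∈ lam then stdVec (⟨toLex (b.row + 1, b.col), h⟩ : Box lam) else 0

/-- The Spaltenstein variety `X^λ_μ`, with the topology induced from `X_μ`. -/
abbrev Spaltenstein (lam : YoungDiagram) {n : ℕ} (μ : Fin n → ℕ) : Type :=
  {F : PartialFlag (Box lam) μ // ∀ i : Fin n, (F.V i.succ).map (nilp lam) ≤ F.V i.castSucc}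

/-! ### Combinatorics -/

/-- `μ^+`: the parts of `μ` in weakly decreasing order. -/
def sortDesc {n : ℕ} (μ : Fin n → ℕ) : Fin n → ℕ :=
  μ ∘ Tuple.sort (fun i => OrderDual.toDual (μ i))

/-- Dominance order `ν ≤ λ`, for a partition `ν` with `n` parts. -/
def Dominates (lam : YoungDiagram) {n : ℕ} (ν : Fin n → ℕ) : Prop :=
  ∀ m : ℕ, ∑ i : Fin n with i.val < m, ν i ≤ ∑ i ∈ Finset.range m, lam.rowLen i

/-- `d_μ = ½ ∑ μ_i (μ_i - 1)`. -/
def dNum {n : ℕ} (μ : Fin n → ℕ) : ℕ := ∑ i, (μ i).choose 2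

/-- `Std^λ_μ`: semistandard `λ`-tableaux with exactly `μ_i` entries equal to `i`, for
`i = 1, …, n`. -/
abbrev Std (lam : YoungDiagram) {n : ℕ} (μ : Fin n → ℕ) : Type :=
  {S : SemistandardYoungTableau lam //
    ∀ i : Fin n, (lam.cells.filter fun c => S c.1 c.2 = i.val + 1).card = μ i}

/-- The diagram of the boxes with entry at most `m`. -/
def sublevel {lam : YoungDiagram} (S : SemistandardYoungTableau lam) (m : ℕ) : YoungDiagram where
  cells := lam.cells.filter fun c => S c.1 c.2 ≤ m
  isLowerSet := by
    rintro ⟨i, j⟩ ⟨i', j'⟩ ⟨hi, hj⟩ h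
    simp only [Finset.coe_filter, YoungDiagram.mem_cells, Set.mem_ofPred_eq] at h ⊢
    have h1 : (i', j) ∈ lam := lam.up_left_mem hi le_rfl h.1
    exact ⟨lam.up_left_mem le_rfl hj h1,
      (S.row_weak_of_le hj h1).trans ((S.col_weak hi h.1).trans h.2)⟩

theorem mem_sublevel {lam : YoungDiagram} (S : SemistandardYoungTableau lam) (m : ℕ)
    {i j : ℕ} : (i, j) ∈ sublevel S m ↔ (i, j) ∈ lam ∧ S i j ≤ m := by
  rw [← YoungDiagram.mem_cells, sublevel, Finset.mem_filter, YoungDiagram.mem_cells]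

/-- The tableau obtained by removing all entries greater than `m`. -/
def restrict {lam : YoungDiagram} (S : SemistandardYoungTableau lam) (m : ℕ) :
    SemistandardYoungTableau (sublevel S m) where
  entry i j := if (i, j) ∈ sublevel S m then S i j else 0
  row_weak' := by
    intro i j1 j2 hj h
    rw [if_pos h, if_pos ((sublevel S m).up_left_mem le_rfl hj.le h)]
    exact S.row_weak hj ((mem_sublevel S m).1 h).1
  col_strict' := by
    intro i1 i2 j hi h
    rw [if_pos h, if_pos ((sublevel S m).up_left_mem hi.le le_rfl h)]
    exact S.col_strict hi ((mem_sublevel S m).1 h).1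
  zeros' := fun h => if_neg h

/-! ### Jordan types and the map `J` -/

/-- `θ : E ≃ ℂ^{d'}` satisfies `θ ∘ x^λ = x^τ ∘ θ` on the `x^λ`-stable subspace `E`. -/
def Intertwines {lam tau : YoungDiagram} {E : Submodule ℂ (Box lam → ℂ)}
    (θ : E ≃ₗ[ℂ] (Box tau → ℂ)) : Prop :=
  ∃ h : ∀ v ∈ E, nilp lam v ∈ E, ∀ v : E, θ ((nilp lam).restrict h v) = nilp tau (θ v)

/-- `E` is `x^λ`-stable and the restriction of `x^λ` to `E` is of Jordan type `τ^T`. -/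
def HasJordanType {lam : YoungDiagram} (E : Submodule ℂ (Box lam → ℂ)) (tau : YoungDiagram) :
    Prop :=
  ∃ θ : E ≃ₗ[ℂ] (Box tau → ℂ), Intertwines θ

/-- The fibre `J⁻¹(S)`: the flags `(V_0, …, V_n)` in `X^λ_μ` such that, for each `j`, the
restriction of `x^λ` to `V_j` has Jordan type the transpose of the shape formed by the boxes
of `S` with entry at most `j`. -/
def fibreJ {lam : YoungDiagram} {n : ℕ} (μ : Fin n → ℕ) (S : SemistandardYoungTableau lam) :
    Set (Spaltenstein lam μ) :=
  {F | ∀ j : Fin (n + 1), HasJordanType (F.1.V j) (sublevel S j.val)}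

/-! ### Schubert cells -/

section Schubert

variable {ι : Type} [Fintype ι] [LinearOrder ι]

/-- The orthogonal complement for the bilinear form with `(f_i, f_j) = δ_{ij}`. -/
def perp (U : Submodule ℂ (ι → ℂ)) : Submodule ℂ (ι → ℂ) where
  carrier := {v | ∀ u ∈ U, u ⬝ᵥ v = 0}
  add_mem' := by
    intro v w hv hw u hu
    rw [dotProduct_add, hv u hu, hw u hu, add_zero]
  zero_mem' := fun u _ => dotProduct_zero u
  smul_mem' := by
    intro a v hv u hu
    rw [dotProduct_smul, hv u hu, smul_zero]

/-- The Schubert variety `Y_γ`, where `c = (c_1 < ⋯ < c_k)` is the column sequence of `γ`. -/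
def schubertVariety {k : ℕ} (c : Fin k ↪o ι) : Set (Submodule ℂ (ι → ℂ)) :=
  {U | Module.finrank ℂ U = k ∧ ∀ i : Fin k, i.val + 1 ≤
    Module.finrank ℂ (U ⊓ Submodule.span ℂ (stdVec '' Set.Iic (c i)) : Submodule ℂ (ι → ℂ))}

/-- The Schubert cell `Y_γ°`: the complement in `Y_γ` of all `Y_γ'` with `γ' ⊊ γ`; in terms of
column sequences, `γ' ⊆ γ` means `c'_i ≤ c_i` for all `i`. -/
def schubertCell {k : ℕ} (c : Fin k ↪o ι) : Set (Submodule ℂ (ι → ℂ)) :=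
  {U | U ∈ schubertVariety c ∧
    ∀ c' : Fin k ↪o ι, (∀ i, c' i ≤ c i) → c' ≠ c → U ∉ schubertVariety c'}

/-- The vector `f_{c_i} + ∑ a_{i,j} f_j`, the sum being over `j ≤ c_i` with
`j ≠ c_1, …, c_i`. -/
def cellVec {k : ℕ} (c : Fin k ↪o ι) (a : Fin k → ι → ℂ) (i : Fin k) : ι → ℂ :=
  stdVec (c i) + ∑ j with j ≤ c i ∧ ∀ l ≤ i, j ≠ c l, a i j • stdVec j

end Schubert

/-! ### The cells `Y_S°` -/

/-- The matrix `g = g(U)` attached to the coordinates `a` of a point `U` of the Schubert cell with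
column sequence `c` (which lies in the top row). -/
def IsTransport {lam : YoungDiagram} {k : ℕ} (c : Fin k ↪o Box lam) (a : Fin k → Box lam → ℂ)
    (g : GL (Box lam) ℂ) : Prop :=
  (∀ i, g.1.mulVec (stdVec (c i)) = cellVec c a i) ∧
  (∀ b : Box lam, b.row = 0 → b ∉ Set.range c → g.1.mulVec (stdVec b) = stdVec b) ∧
  (∀ b : Box lam, nilp lam (stdVec b) ≠ 0 →
    g.1.mulVec (nilp lam (stdVec b)) = nilp lam (g.1.mulVec (stdVec b)))

/-- The boxes in the top row of those columns of `S` that contain the entry `m`. -/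
def columnsWith {lam : YoungDiagram} (S : SemistandardYoungTableau lam) (m : ℕ) :
    Finset (Box lam) :=
  Finset.univ.filter fun b => b.row = 0 ∧ ∃ p ∈ lam.cells, p.2 = b.col ∧ S p.1 p.2 = m

/-- The column sequence `(c_1, …, c_k)` of the columns of `S` that contain the entry `m`. -/
def colSeq {lam : YoungDiagram} (S : SemistandardYoungTableau lam) (m : ℕ) :
    Fin (columnsWith S m).card ↪o Box lam :=
  (columnsWith S m).orderEmbOfFin rfl

/-- The subspace `⟨f_{c_1}, …, f_{c_k}⟩^⊥` for the columns of `S` that contain the entry `m`. -/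
def basePerp {lam : YoungDiagram} (S : SemistandardYoungTableau lam) (m : ℕ) :
    Submodule ℂ (Box lam → ℂ) :=
  perp (Submodule.span ℂ (Set.range fun i => stdVec (colSeq S m i)))

/-- For a flag `F` in `X^λ_μ` (with `n + 1` parts) and a flag `F'` in `X^{λ̄}_{μ̄}` the relation
`f_γ(F) = (U, F')` with `U = V_n^⊥` in the Schubert cell `Y_γ°`; here `γ` has as column sequence
the columns of `S` containing `n + 1`, the shape `λ̄` is the one obtained from `S` by removing the
entries `n + 1`, and the isomorphism `f_γ` is formed with the intertwining isomorphism
`θ : ⟨f_{c_1}, …, f_{c_k}⟩^⊥ ≃ ℂ^{d - k}`. Thus `F'_i = θ (g(U)^T V_i)` for `i = 0, …, n`. -/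
def CellRel {lam : YoungDiagram} {n : ℕ} {μ : Fin (n + 1) → ℕ}
    (S : SemistandardYoungTableau lam)
    (θ : basePerp S (n + 1) ≃ₗ[ℂ] (Box (sublevel S n) → ℂ))
    (F : Spaltenstein lam μ) (F' : Spaltenstein (sublevel S n) (fun i : Fin n => μ i.castSucc)) :
    Prop :=
  perp (F.1.V (Fin.last n).castSucc) ∈ schubertCell (colSeq S (n + 1)) ∧
  ∃ (a : Fin (columnsWith S (n + 1)).card → Box lam → ℂ) (g : GL (Box lam) ℂ),
    perp (F.1.V (Fin.last n).castSucc) =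
      Submodule.span ℂ (Set.range (cellVec (colSeq S (n + 1)) a)) ∧
    IsTransport (colSeq S (n + 1)) a g ∧
    ∀ i : Fin (n + 1), F'.1.V i =
      (((F.1.V i.castSucc).map (g.1.transpose).mulVecLin).submoduleOf
        (basePerp S (n + 1))).map θ.toLinearMap

/-- `IsCell n μ S Y` says that `Y ⊆ X^λ_μ` is the set `Y_S°`, for one of the possible choices of
the intertwining isomorphisms `θ` at each step of the recursion
`Y_S° = f_γ⁻¹(Y_γ° × Y_{S̄}°)`. -/
def IsCell : (n : ℕ) → (μ : Fin n → ℕ) → {lam : YoungDiagram} →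
    (S : SemistandardYoungTableau lam) → Set (Spaltenstein lam μ) → Prop
  | 0, _, _, _, Y => Y = Set.univ
  | n + 1, μ, _, S, Y =>
    ∃ θ : basePerp S (n + 1) ≃ₗ[ℂ] (Box (sublevel S n) → ℂ), Intertwines θ ∧
    ∃ Y' : Set (Spaltenstein (sublevel S n) (fun i : Fin n => μ i.castSucc)),
      IsCell n (fun i : Fin n => μ i.castSucc) (restrict S n) Y' ∧
      Y = {F | ∃ F' ∈ Y', CellRel S θ F F'}

end SpaltensteinVariety

end

open SpaltensteinVariety

/-!
The proof is by induction on `n`: the Spaltenstein variety is an iterated fibration, whose layers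
are spaces of subspaces of `ℂ^λ` containing the image of `x = x^λ`.

*One step.* If `(V_0, …, V_n)` lies in `X^λ_μ`, then `V_{n-1}` contains the image of `x`, so it is
cut out by linear conditions on the top row of boxes. Echelon reduction of these conditions, and a
permutation of columns of equal length, produce an automorphism commuting with `x` which carries
the space of vectors vanishing at the tops of the columns of a horizontal strip `λ/τ` to `V_{n-1}`
(`exists_range_eq`, `exists_perm_stripCols`); on that space `x` is a copy of `x^τ`
(`IsStrip.hasJordanType`). So every point of `X^λ_μ` arises from a point of a smaller Spaltenstein
variety by extension along an embedding `ℂ^τ → ℂ^λ` (`IsSpaltenstein.exists_extends`). In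
particular the Jordan types of the `V_j` form a chain of horizontal strips, that is, a semistandard
tableau, and the sets `J⁻¹(S)` cover `X^λ_μ`. Conversely, if `λ` dominates `μ^+`, a strip of size
`μ_n` can be removed so that dominance persists (`SubsetDominates.exists_strip`), whence `X^λ_μ` is
not empty.

*Upper bound for the dimension.* The automorphisms used in one step are shears with one free
coefficient for each coordinate of a Schubert cell. Hence `X^λ_μ` is covered by finitely many sets
which are images of affine spaces of dimension at most `d_λ - d_μ` under polynomial families of
bases (`exists_cover`). The preimage in `GL_d` of such a set is parametrized by the product of the
affine space and the parabolic subgroup `P_μ`; Noether normalization bounds its dimension, and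
`GL_d → X_μ` is open with fibres `P_μ`, so the closure of the set has dimension at most the number
of parameters (`IsParam.topologicalKrullDim_closure_le`).

*Irreducibility of `J⁻¹(S)`.* In one step any automorphism commuting with `x` may be used. These
form a principal open subset of a linear space, so `J⁻¹(S)` is the image of a principal open subset
of an affine space (`ShapeChain.exists_isParam`, `isIrreducible_fibreJ`). As there are finitely many
tableaux, every component is the closure of some `J⁻¹(S)` (`exists_eq_closure_fibreJ`).

*Lower bound.* The transpose of the matrix `g(U)` is a shear, so the relation between a cell and
the preceding one is an extension along an embedding followed by an arbitrary shear (`cellRel_iff`).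
It follows that the cell of `S` lies in `J⁻¹(S)` (`IsCell.subset_fibreJ`) and, freeing the
coefficients of the shears one by one, that it contains a chain of `d_λ - d_μ + 1` irreducible
sets, each separated from the next by a closed condition on the dimension of `V_j ∩ E` for a fixed
subspace `E` (`IsCell.exists_isTower`). By the upper bound, the last of these sets is dense in any
closed irreducible subset of `X^λ_μ` that contains the cell, and such a subset has dimension exactly
`d_λ - d_μ` (`IsCell.eq_closure`). Applied to the closure of `J⁻¹(S)` and to a component containing
it, this shows that the closures of the cell and of `J⁻¹(S)` agree and are components.

*Distinctness.* The dimensions of `V_j ∩ ker x^i` can only jump up on closed sets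
(`isClosed_setOf_le_finrank_inf`) and determine the Jordan type, so different tableaux give
different closures (`closure_fibreJ_injective`).
-/

noncomputable section

namespace SpaltensteinVariety

/-! ### Zariski topology and Krull dimension -/

/-- The affine space `ℂ^σ` carrying the Zariski topology. It is a type of its own because
`σ → ℂ` has the product topology as its default topology. -/
@[ext]
structure ZAff (σ : Type) where
  coord : σ → ℂ

instance (σ : Type) : TopologicalSpace (ZAff σ) :=
  TopologicalSpace.induced ZAff.coord (zariski σ)

theorem ZAff.isClosed_iff {σ : Type} {Z : Set (ZAff σ)} :
    IsClosed Z ↔ ∃ P : Set (MvPolynomial σ ℂ),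
      Z = {x : ZAff σ | ∀ p ∈ P, MvPolynomial.eval x.coord p = 0} := by
  let _ := zariski σ
  have hz : ∀ T : Set (σ → ℂ), @IsClosed _ (zariski σ) T ↔ ∃ P : Set (MvPolynomial σ ℂ),
      T = {x | ∀ p ∈ P, MvPolynomial.eval x p = 0} := by
    intro T
    rw [← isOpen_compl_iff]
    change Tᶜᶜ ∈ _ ↔ _
    rw [compl_compl]
    rfl
  rw [@isClosed_induced_iff _ _ (zariski σ)]
  constructor
  · rintro ⟨T, hT, rfl⟩
    obtain ⟨P, rfl⟩ := (hz T).1 hT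
    exact ⟨P, rfl⟩
  · rintro ⟨P, rfl⟩
    exact ⟨_, (hz _).2 ⟨P, rfl⟩, rfl⟩

theorem ZAff.isClosed_zeroLocus {σ : Type} (p : MvPolynomial σ ℂ) :
    IsClosed {x : ZAff σ | MvPolynomial.eval x.coord p = 0} :=
  ZAff.isClosed_iff.2 ⟨{p}, by simp⟩

theorem ZAff.exists_of_mem_open {σ : Type} {U : Set (ZAff σ)} (hU : IsOpen U) {x : ZAff σ}
    (hx : x ∈ U) : ∃ p : MvPolynomial σ ℂ, MvPolynomial.eval x.coord p ≠ 0 ∧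
      ∀ y : ZAff σ, MvPolynomial.eval y.coord p ≠ 0 → y ∈ U := by
  obtain ⟨P, hP⟩ := ZAff.isClosed_iff.1 hU.isClosed_compl
  have h1 : x ∉ Uᶜ := fun h => h hx
  rw [hP] at h1
  simp only [Set.mem_ofPred_eq, not_forall] at h1
  obtain ⟨p, hp, hpx⟩ := h1
  refine ⟨p, hpx, fun y hy => ?_⟩
  by_contra hyU
  have h2 : y ∈ Uᶜ := hyU
  rw [hP] at h2
  exact hy (h2 p hp)

theorem eval_aeval {σ τ : Type} (x : σ → ℂ) (f : τ → MvPolynomial σ ℂ) (p : MvPolynomial τ ℂ) :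
    MvPolynomial.eval x (MvPolynomial.aeval f p) =
      MvPolynomial.eval (fun i => MvPolynomial.eval x (f i)) p := by
  induction p using MvPolynomial.induction_on with
  | C a => simp
  | add p q hp hq => simp only [map_add, hp, hq]
  | mul_X p i hp => simp only [map_mul, hp, MvPolynomial.aeval_X, MvPolynomial.eval_X]

theorem ZAff.continuous_of_polynomial {σ τ : Type} (f : τ → MvPolynomial σ ℂ) :
    Continuous (fun x : ZAff σ => ZAff.mk fun i => MvPolynomial.eval x.coord (f i)) := by
  refine continuous_iff_isClosed.2 fun Z hZ => ?_
  obtain ⟨P, rfl⟩ := ZAff.isClosed_iff.1 hZ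
  refine ZAff.isClosed_iff.2 ⟨(MvPolynomial.aeval f) '' P, ?_⟩
  ext x
  simp only [Set.mem_preimage, Set.mem_ofPred_eq, Set.forall_mem_image]
  refine forall₂_congr fun p _ => ?_
  rw [eval_aeval]

theorem ZAff.exists_eval_ne_zero {σ : Type} {q : MvPolynomial σ ℂ} (hq : q ≠ 0) :
    ∃ x : σ → ℂ, MvPolynomial.eval x q ≠ 0 := by
  by_contra! h
  exact hq (MvPolynomial.funext fun x => by simpa using h x)

theorem ZAff.isIrreducible_basicOpen {σ : Type} {q : MvPolynomial σ ℂ} (hq : q ≠ 0) :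
    IsIrreducible {x : ZAff σ | MvPolynomial.eval x.coord q ≠ 0} := by
  refine ⟨(ZAff.exists_eval_ne_zero hq).imp' ZAff.mk fun _ h => h, ?_⟩
  rintro U V hU hV ⟨x, -, hxU⟩ ⟨y, -, hyV⟩
  obtain ⟨p, hp, hpU⟩ := ZAff.exists_of_mem_open hU hxU
  obtain ⟨r, hr, hrV⟩ := ZAff.exists_of_mem_open hV hyV
  have hp0 : p ≠ 0 := by rintro rfl; simp at hp
  have hr0 : r ≠ 0 := by rintro rfl; simp at hr
  obtain ⟨z, hz⟩ := ZAff.exists_eval_ne_zero (mul_ne_zero (mul_ne_zero hq hp0) hr0)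
  simp only [map_mul, mul_ne_zero_iff] at hz
  exact ⟨⟨z⟩, hz.1.1, hpU ⟨z⟩ hz.1.2, hrV ⟨z⟩ hz.2⟩

open Algebra in
/-- By Noether normalization, a subalgebra generated by finitely many polynomials in `N` variables
has Krull dimension at most `N`. -/
theorem ringKrullDim_range_aeval_le {σ r : Type} [Fintype σ] [Finite r]
    (f : r → MvPolynomial σ ℂ) :
    ringKrullDim (MvPolynomial.aeval (R := ℂ) f).range ≤ (Fintype.card σ : ℕ) := by
  set A := (MvPolynomial.aeval (R := ℂ) f).range
  have hft : Algebra.FiniteType ℂ A :=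
    Algebra.FiniteType.of_surjective (MvPolynomial.aeval (R := ℂ) f).rangeRestrict
      (AlgHom.rangeRestrict_surjective _)
  obtain ⟨s, g, hg, hint⟩ := exists_integral_inj_algHom_of_fg ℂ A
  have hs : s ≤ Fintype.card σ := by
    have h := lift_trdeg_le_of_injective (A.val.comp g)
      (Subtype.val_injective.comp hg)
    rw [MvPolynomial.trdeg_of_isDomain, MvPolynomial.trdeg_of_isDomain] at h
    simpa using h
  have hle : ringKrullDim A ≤ ringKrullDim (MvPolynomial (Fin s) ℂ) := by
    let _ := g.toRingHom.toAlgebra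
    have : Algebra.IsIntegral (MvPolynomial (Fin s) ℂ) A := ⟨hint⟩
    exact Order.krullDim_le_of_strictMono (PrimeSpectrum.comap (algebraMap _ A))
      fun I J hIJ => Ideal.IsIntegral.comap_lt_comap hIJ
  refine hle.trans ?_
  rw [MvPolynomial.ringKrullDim_of_isNoetherianRing]
  simp only [ringKrullDim_eq_zero_of_field, zero_add, Nat.card_eq_fintype_card, Fintype.card_fin]
  exact_mod_cast hs

/-- If a space embeds in an affine space and its coordinates satisfy all the polynomial relations
that hold between the polynomials `f i` in `N` variables, then its dimension is at most `N`. -/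
theorem topologicalKrullDim_le_card {σ r : Type} [Fintype σ] [Finite r]
    (f : r → MvPolynomial σ ℂ) {X : Type*} [TopologicalSpace X] {c : X → ZAff r}
    (hc : Topology.IsInducing c)
    (hf : ∀ p : MvPolynomial r ℂ, MvPolynomial.aeval f p = 0 →
      ∀ x, MvPolynomial.eval (c x).coord p = 0) :
    topologicalKrullDim X ≤ (Fintype.card σ : ℕ) := by
  set φ := (MvPolynomial.aeval (R := ℂ) f).rangeRestrict with hφ
  have hsurj : Function.Surjective φ := AlgHom.rangeRestrict_surjective _
  have hker : ∀ p, φ p = 0 → ∀ x, MvPolynomial.eval (c x).coord p = 0 := fun p hp =>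
    hf p (congrArg Subtype.val hp)
  -- the vanishing ideal of a subset
  let I : Set X → Ideal (MvPolynomial r ℂ) := fun Z =>
    MvPolynomial.vanishingIdeal ℂ ((fun x => (c x).coord) '' Z)
  have hI : ∀ Z p, p ∈ I Z ↔ ∀ x ∈ Z, MvPolynomial.eval (c x).coord p = 0 := by
    intro Z p
    simp only [I, MvPolynomial.mem_vanishingIdeal_iff, MvPolynomial.aeval_eq_eval]
    exact Set.forall_mem_image
  have hkerI : ∀ Z, RingHom.ker φ ≤ I Z := fun Z p hp => (hI Z p).2 fun x _ => hker p hp x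
  have hclosed : ∀ p : MvPolynomial r ℂ,
      IsClosed {x : X | MvPolynomial.eval (c x).coord p = 0} := fun p =>
    (ZAff.isClosed_zeroLocus p).preimage hc.continuous
  have hprime : ∀ Z : TopologicalSpace.IrreducibleCloseds X, (I Z).IsPrime := by
    intro Z
    refine ⟨fun h => ?_, fun {p q} hpq => ?_⟩
    · obtain ⟨x, hx⟩ := Z.isIrreducible.nonempty
      simpa using (hI Z 1).1 (h ▸ Submodule.mem_top) x hx
    · have h := isPreirreducible_iff_isClosed_union_isClosed.1 Z.isIrreducible.2 _ _
        (hclosed p) (hclosed q) (fun x hx => by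
          have := (hI Z _).1 hpq x hx
          rw [map_mul] at this
          exact mul_eq_zero.1 this)
      exact h.imp (fun h => (hI _ _).2 h) (fun h => (hI _ _).2 h)
  have hlt : ∀ Z Z' : TopologicalSpace.IrreducibleCloseds X, Z < Z' → ¬ I Z ≤ I Z' := by
    intro Z Z' hZ h
    refine hZ.not_ge fun x hx => ?_
    obtain ⟨T, hT, hTZ⟩ := hc.isClosed_iff.1 Z.isClosed
    obtain ⟨P, rfl⟩ := ZAff.isClosed_iff.1 hT
    have hmem : ∀ y, y ∈ Z ↔ ∀ p ∈ P, MvPolynomial.eval (c y).coord p = 0 := fun y => by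
      rw [← SetLike.mem_coe, ← hTZ]; rfl
    exact (hmem x).2 fun p hp => (hI _ _).1 (h ((hI Z p).2 fun y hy => (hmem y).1 hy p hp)) x hx
  let Ψ : TopologicalSpace.IrreducibleCloseds X →
      (PrimeSpectrum (MvPolynomial.aeval (R := ℂ) f).range)ᵒᵈ := fun Z =>
    OrderDual.toDual ⟨(I Z).map φ,
      have := hprime Z
      Ideal.map_isPrime_of_surjective hsurj (hkerI Z)⟩
  have hcomap : ∀ Z, Ideal.comap φ ((I Z).map φ) = I Z := fun Z => by
    rw [Ideal.comap_map_of_surjective _ hsurj]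
    exact sup_eq_left.2 (hkerI Z)
  have hΨ : StrictMono Ψ := by
    intro Z Z' hZ
    refine lt_of_le_not_ge ?_ fun h => hlt Z Z' hZ ?_
    · change (I Z').map φ ≤ (I Z).map φ
      exact Ideal.map_mono fun p hp => (hI _ _).2 fun x hx => (hI _ _).1 hp x (hZ.le hx)
    · have := Ideal.comap_mono (f := φ) (show (I Z).map φ ≤ (I Z').map φ from h)
      rwa [hcomap, hcomap] at this
  calc topologicalKrullDim X ≤ Order.krullDim _ := Order.krullDim_le_of_strictMono Ψ hΨ
    _ = ringKrullDim _ := Order.krullDim_orderDual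
    _ ≤ _ := ringKrullDim_range_aeval_le f

/-! ### Flags and adapted bases -/

section Flags

variable {ι : Type} {n : ℕ} {μ : Fin n → ℕ}

/-- The partial sum `μ_1 + ⋯ + μ_j`. -/
def psum (μ : Fin n → ℕ) (j : ℕ) : ℕ := ∑ i : Fin n with i.val < j, μ i

theorem psum_mono (μ : Fin n → ℕ) : Monotone (psum μ) := fun _ _ h =>
  Finset.sum_le_sum_of_subset fun i hi => by
    simp only [Finset.mem_filter, Finset.mem_univ, true_and] at hi ⊢
    omega

theorem psum_zero (μ : Fin n → ℕ) : psum μ 0 = 0 := by simp [psum]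

theorem psum_last (μ : Fin n → ℕ) : psum μ n = ∑ i, μ i := by simp [psum]

theorem psum_le_sum (μ : Fin n → ℕ) (j : ℕ) : psum μ j ≤ ∑ i, μ i :=
  Finset.sum_le_sum_of_subset (Finset.filter_subset _ _)

theorem psum_succ (μ : Fin n → ℕ) (i : Fin n) : psum μ (i.val + 1) = psum μ i.val + μ i := by
  have h : (Finset.univ.filter fun l : Fin n => l.val < i.val + 1) =
      insert i (Finset.univ.filter fun l : Fin n => l.val < i.val) := by
    ext l
    simp only [Finset.mem_filter, Finset.mem_univ, true_and, Finset.mem_insert, Fin.ext_iff]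
    omega
  rw [psum, h, Finset.sum_insert (by simp), add_comm]
  rfl

theorem psum_castSucc {μ : Fin (n + 1) → ℕ} {j : ℕ} (hj : j ≤ n) :
    psum μ j = psum (fun i : Fin n => μ i.castSucc) j := by
  rw [psum, psum, Finset.sum_filter, Finset.sum_filter, Fin.sum_univ_castSucc]
  simp [hj]

theorem PartialFlag.finrank_V (F : PartialFlag ι μ) (j : Fin (n + 1)) :
    Module.finrank ℂ (F.V j) = psum μ j.val := by
  induction j using Fin.induction with
  | zero => rw [F.zero, finrank_bot]; exact (psum_zero μ).symm
  | succ i ih => rw [F.dim, ih]; exact (psum_succ μ i).symm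

theorem PartialFlag.monotone_V (F : PartialFlag ι μ) : Monotone F.V :=
  Fin.monotone_iff_le_succ.2 F.le

theorem PartialFlag.card_eq [Fintype ι] (F : PartialFlag ι μ) :
    ∑ i, μ i = Fintype.card ι := by
  have h := F.finrank_V (Fin.last n)
  rw [F.last, finrank_top, Module.finrank_fintype_fun_eq_card] at h
  rw [h]
  exact (psum_last μ).symm

/-- The indices of the first `μ_1 + ⋯ + μ_j` members of a basis. -/
def lowSet (μ : Fin n → ℕ) (j : ℕ) : Set (Fin (∑ i, μ i)) := {a | a.val < psum μ j}

theorem lowSet_mono (μ : Fin n → ℕ) : Monotone (lowSet μ) := fun _ _ h _ ha =>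
  lt_of_lt_of_le ha (psum_mono μ h)

theorem finrank_span_lowSet {M : Type*} [AddCommGroup M] [Module ℂ M]
    {v : Fin (∑ i, μ i) → M} (hv : LinearIndependent ℂ v) (j : ℕ) :
    Module.finrank ℂ (Submodule.span ℂ (v '' lowSet μ j)) = psum μ j := by
  have h : v '' lowSet μ j = Set.range (v ∘ Fin.castLE (psum_le_sum μ j)) := by
    rw [Set.range_comp]
    congr 1
    ext a
    simp only [lowSet, Set.mem_ofPred_eq, Set.mem_range]
    exact ⟨fun ha => ⟨⟨a.val, ha⟩, rfl⟩, by rintro ⟨b, rfl⟩; exact b.2⟩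
  rw [h, finrank_span_eq_card (hv.comp _ (Fin.castLE_injective _)), Fintype.card_fin]

/-- The flag spanned by the initial segments of a basis. -/
def flagOfBasis (b : Module.Basis (Fin (∑ i, μ i)) ℂ (ι → ℂ)) : PartialFlag ι μ where
  V j := Submodule.span ℂ (b '' lowSet μ j.val)
  zero := by simp [lowSet, psum_zero]
  last := by
    have : lowSet μ (Fin.last n).val = Set.univ := by
      ext a
      simp [lowSet, psum_last]
    rw [this, Set.image_univ, b.span_eq]
  le i := Submodule.span_mono (Set.image_mono (lowSet_mono μ (by simp)))
  dim i := by
    rw [finrank_span_lowSet b.linearIndependent, finrank_span_lowSet b.linearIndependent]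
    exact psum_succ μ i

/-- A basis, as a basis adapted to its flag. -/
def AdaptedBasis.ofBasis (b : Module.Basis (Fin (∑ i, μ i)) ℂ (ι → ℂ)) : AdaptedBasis ι μ :=
  ⟨(b, flagOfBasis b), fun _ => rfl⟩

theorem AdaptedBasis.flag_eq (p : AdaptedBasis ι μ) : p.1.2 = flagOfBasis p.1.1 :=
  PartialFlag.ext (funext p.2)

instance : TopologicalSpace (AdaptedBasis ι μ) :=
  TopologicalSpace.induced
    (fun (p : AdaptedBasis ι μ) (x : Fin (∑ i, μ i) × ι) => p.1.1 x.1 x.2)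
    (zariski (Fin (∑ i, μ i) × ι))

/-- The coordinates of an adapted basis. -/
def AdaptedBasis.coords (p : AdaptedBasis ι μ) : ZAff (Fin (∑ i, μ i) × ι) :=
  ZAff.mk fun x => p.1.1 x.1 x.2

theorem AdaptedBasis.isInducing_coords :
    Topology.IsInducing (AdaptedBasis.coords : AdaptedBasis ι μ → _) :=
  ⟨(@induced_compose _ _ _ (zariski _) AdaptedBasis.coords ZAff.coord).symm⟩

/-- The projection `GL_d → X_μ`. -/
def AdaptedBasis.flag (p : AdaptedBasis ι μ) : PartialFlag ι μ := p.1.2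

theorem AdaptedBasis.continuous_flag :
    Continuous (AdaptedBasis.flag : AdaptedBasis ι μ → PartialFlag ι μ) :=
  continuous_coinduced_rng

theorem AdaptedBasis.V_flag (p : AdaptedBasis ι μ) (j : Fin (n + 1)) :
    p.flag.V j = Submodule.span ℂ (p.1.1 '' lowSet μ j.val) := p.2 j

theorem finSigmaFinEquiv_lt_psum (k : (i : Fin n) × Fin (μ i)) (j : ℕ) :
    (finSigmaFinEquiv k : ℕ) < psum μ j ↔ k.1.val < j := by
  have h : (finSigmaFinEquiv k : ℕ) = psum μ k.1.val + k.2.val := by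
    rw [finSigmaFinEquiv_apply, psum]
    congr 1
    refine Finset.sum_bij (fun i _ => Fin.castLE k.1.2.le i)
      (fun a _ => Finset.mem_filter.2 ⟨Finset.mem_univ _, a.2⟩) ?_ ?_ (by simp)
    · intro a _ b _ hab
      exact Fin.castLE_injective _ hab
    · intro b hb
      exact ⟨⟨b.val, by simpa using hb⟩, by simp, rfl⟩
  rw [h]
  constructor
  · intro h1
    by_contra h2
    have := psum_mono μ (not_lt.1 h2)
    omega
  · intro h1
    have := psum_mono μ (Nat.succ_le_of_lt h1)
    rw [Nat.succ_eq_add_one, psum_succ] at this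
    have := k.2.2
    omega

/-- Every flag has an adapted basis: choose bases of complements of each step in the next one. -/
theorem AdaptedBasis.surjective_flag [Fintype ι] :
    Function.Surjective (AdaptedBasis.flag : AdaptedBasis ι μ → PartialFlag ι μ) := by
  intro F
  have hC : ∀ i : Fin n, ∃ v : Fin (μ i) → ι → ℂ,
      F.V i.castSucc ⊔ Submodule.span ℂ (Set.range v) = F.V i.succ := by
    intro i
    obtain ⟨C, hC⟩ := (F.V i.castSucc).exists_isCompl
    have h1 : F.V i.castSucc ⊔ (C ⊓ F.V i.succ) = F.V i.succ := by
      rw [← sup_inf_assoc_of_le _ (F.le i), hC.sup_eq_top, top_inf_eq]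
    have h2 : F.V i.castSucc ⊓ (C ⊓ F.V i.succ) = ⊥ := by
      rw [← inf_assoc, hC.inf_eq_bot, bot_inf_eq]
    have h3 := Submodule.finrank_sup_add_finrank_inf_eq (F.V i.castSucc) (C ⊓ F.V i.succ)
    rw [h1, h2, finrank_bot, F.dim] at h3
    let b := Module.finBasisOfFinrankEq ℂ (C ⊓ F.V i.succ : Submodule ℂ (ι → ℂ))
      (show Module.finrank ℂ _ = μ i by omega)
    refine ⟨fun l => b l, ?_⟩
    have h4 : Submodule.span ℂ (Set.range fun l => (b l : ι → ℂ)) = C ⊓ F.V i.succ := by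
      rw [show (Set.range fun l => (b l : ι → ℂ)) =
        (C ⊓ F.V i.succ).subtype '' Set.range b by rw [← Set.range_comp]; rfl,
        Submodule.span_image, b.span_eq, Submodule.map_subtype_top]
    rw [h4, h1]
  choose v hv using hC
  let w : ((i : Fin n) × Fin (μ i)) → ι → ℂ := fun k => v k.1 k.2
  have hw : ∀ j : Fin (n + 1),
      Submodule.span ℂ (w '' {k | k.1.val < j.val}) = F.V j := by
    intro j
    induction j using Fin.induction with
    | zero => simp [F.zero]
    | succ i ih =>
      rw [← hv i, ← ih, ← Submodule.span_union]
      congr 1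
      ext x
      simp only [Set.mem_image, Set.mem_ofPred_eq, Set.mem_union, Set.mem_range, Fin.val_succ,
        Fin.val_castSucc]
      constructor
      · rintro ⟨⟨l, a⟩, hl, rfl⟩
        rcases Nat.lt_succ_iff_lt_or_eq.1 hl with h | h
        · exact Or.inl ⟨⟨l, a⟩, h, rfl⟩
        · obtain rfl : l = i := Fin.ext h
          exact Or.inr ⟨a, rfl⟩
      · rintro (⟨k, hk, rfl⟩ | ⟨a, rfl⟩)
        · exact ⟨k, by omega, rfl⟩
        · exact ⟨⟨i, a⟩, by simp, rfl⟩
  let u : Fin (∑ i, μ i) → ι → ℂ := w ∘ finSigmaFinEquiv.symm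
  have hu : ∀ j : Fin (n + 1), Submodule.span ℂ (u '' lowSet μ j.val) = F.V j := by
    intro j
    rw [← hw j, Set.image_comp]
    congr 2
    ext k
    rw [Equiv.image_eq_preimage_symm]
    exact finSigmaFinEquiv_lt_psum k j.val
  have htop : ⊤ ≤ Submodule.span ℂ (Set.range u) := by
    rw [← F.last, ← hu]
    exact Submodule.span_mono (Set.image_subset_range _ _)
  let b := basisOfTopLeSpanOfCardEqFinrank u htop (by
    rw [Fintype.card_fin, F.card_eq, Module.finrank_fintype_fun_eq_card])
  have hb : ⇑b = u := coe_basisOfTopLeSpanOfCardEqFinrank _ _ _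
  refine ⟨⟨(b, F), fun j => ?_⟩, rfl⟩
  change F.V j = Submodule.span ℂ (b '' lowSet μ j.val)
  rw [hb, hu]

end Flags

/-! ### Dimension of fibrations and of principal open sets -/

/-- If `π : Y → X` is open and surjective with irreducible fibres of dimension at least `e`, then
`dim Y ≥ dim X + e`: preimages of a chain in `X` continue a chain in a fibre. -/
theorem le_topologicalKrullDim_of_fibers {X Y : Type*} [TopologicalSpace X] [TopologicalSpace Y]
    {π : Y → X} (hc : Continuous π) (ho : IsOpenMap π) (hs : Function.Surjective π)
    (hirr : ∀ x, IsPreirreducible (π ⁻¹' {x})) {e : ℕ}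
    (hdim : ∀ x, (e : WithBot ℕ∞) ≤ topologicalKrullDim (π ⁻¹' {x})) {m : ℕ}
    (hm : (m : WithBot ℕ∞) ≤ topologicalKrullDim X) :
    ((e + m : ℕ) : WithBot ℕ∞) ≤ topologicalKrullDim Y := by
  obtain ⟨l, rfl⟩ := Order.le_krullDim_iff.1 hm
  let pre : TopologicalSpace.IrreducibleCloseds X → TopologicalSpace.IrreducibleCloseds Y :=
    fun Z => ⟨π ⁻¹' Z, ⟨by
      obtain ⟨x, hx⟩ := Z.isIrreducible.nonempty
      obtain ⟨y, rfl⟩ := hs x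
      exact ⟨y, hx⟩,
      Z.isIrreducible.2.preimage_of_isPreirreducible_fiber π ho hirr⟩, Z.isClosed.preimage hc⟩
  have hpre : StrictMono pre := by
    refine Monotone.strictMono_of_injective (fun Z Z' h => Set.preimage_mono (f := π) h)
      fun Z Z' h => ?_
    exact SetLike.coe_injective (hs.preimage_injective
      (congrArg (fun W : TopologicalSpace.IrreducibleCloseds Y => (W : Set Y)) h))
  have hhead : (e : ℕ∞) ≤ Order.height (pre l.head) := by
    obtain ⟨x, hx⟩ := l.head.isIrreducible.nonempty
    obtain ⟨c, hcl⟩ := Order.le_krullDim_iff.1 (hdim x)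
    let c' := c.map _ (TopologicalSpace.IrreducibleCloseds.map_strictMono_of_isInducing
      (Topology.IsInducing.subtypeVal (t := π ⁻¹' {x})))
    have hlast : c'.last ≤ pre l.head := by
      change closure (Subtype.val '' _) ⊆ π ⁻¹' _
      refine closure_minimal ?_ (l.head.isClosed.preimage hc)
      rintro _ ⟨y, -, rfl⟩
      have hy : π y = x := y.2
      change π y ∈ l.head
      rw [hy]
      exact hx
    have := Order.length_le_height hlast
    rwa [show c'.length = e from hcl] at this
  have hstep : ∀ i (hi : i < l.length + 1),
      ((e + i : ℕ) : ℕ∞) ≤ Order.height (pre (l ⟨i, hi⟩)) := by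
    intro i
    induction i with
    | zero => exact fun _ => hhead
    | succ i ih =>
      intro hi
      have h1 := ih (by omega)
      have h2 := Order.height_add_one_le
        (hpre (l.step ⟨i, by omega⟩))
      refine le_trans ?_ h2
      rw [← add_assoc, Nat.cast_add, Nat.cast_one]
      exact add_le_add h1 le_rfl
  refine le_trans ?_ (Order.height_le_krullDim (pre l.last))
  exact_mod_cast hstep l.length (by omega)

/-- A nonempty principal open subset of `ℂ^N` has dimension at least `N`. -/
theorem card_le_topologicalKrullDim_basicOpen {σ : Type} [Fintype σ] {q : MvPolynomial σ ℂ}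
    (hq : q ≠ 0) : ((Fintype.card σ : ℕ) : WithBot ℕ∞) ≤
      topologicalKrullDim {x : ZAff σ | MvPolynomial.eval x.coord q ≠ 0} := by
  obtain ⟨t, ht⟩ := ZAff.exists_eval_ne_zero hq
  let e := Fintype.equivFin σ
  -- the flag of coordinate subspaces through `t`
  let f : ℕ → σ → MvPolynomial σ ℂ := fun i k =>
    if (e k).val < i then MvPolynomial.X k else MvPolynomial.C (t k)
  have hf : ∀ i x k, MvPolynomial.eval x (f i k) = if (e k).val < i then x k else t k := by
    intro i x k
    simp only [f]
    split_ifs <;> simp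
  have hft : ∀ i, (fun k => MvPolynomial.eval t (f i k)) = t := fun i => by
    funext k
    rw [hf]
    simp
  have hfq : ∀ i, MvPolynomial.aeval (f i) q ≠ 0 := fun i h => by
    have := eval_aeval t (f i) q
    rw [hft, h, map_zero] at this
    exact ht this.symm
  let D : Set (ZAff σ) := {x : ZAff σ | MvPolynomial.eval x.coord q ≠ 0}
  let S : ℕ → Set D := fun i => {x | ∀ k, i ≤ (e k).val → x.1.coord k = t k}
  have hcl : ∀ i, IsClosed (S i) := fun i => by
    have : S i = Subtype.val ⁻¹' ⋂ k ∈ {k | i ≤ (e k).val},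
        {x : ZAff σ | MvPolynomial.eval x.coord (MvPolynomial.X k - MvPolynomial.C (t k)) = 0} := by
      ext x
      simp [S, sub_eq_zero]
    rw [this]
    exact (isClosed_biInter fun k _ => ZAff.isClosed_zeroLocus _).preimage continuous_subtype_val
  have hirr : ∀ i, IsIrreducible (S i) := fun i => by
    have himg : S i = (fun y : {x : ZAff σ | MvPolynomial.eval x.coord
        (MvPolynomial.aeval (f i) q) ≠ 0} =>
        (⟨ZAff.mk fun k => MvPolynomial.eval y.1.coord (f i k), by
          have h := y.2
          simp only [Set.mem_ofPred_eq, eval_aeval] at h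
          exact h⟩ : D)) '' Set.univ := by
      ext x
      constructor
      · intro hx
        have hxx : (fun k => MvPolynomial.eval x.1.coord (f i k)) = x.1.coord := by
          funext k
          rw [hf]
          split_ifs with h
          · rfl
          · exact (hx k (not_lt.1 h)).symm
        refine ⟨⟨x.1, ?_⟩, trivial, Subtype.ext (ZAff.ext hxx)⟩
        change MvPolynomial.eval x.1.coord (MvPolynomial.aeval (f i) q) ≠ 0
        rw [eval_aeval, hxx]
        exact x.2
      · rintro ⟨y, -, rfl⟩ k hk
        exact (hf i _ k).trans (if_neg (not_lt.2 hk))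
    rw [himg]
    have := Subtype.irreducibleSpace (ZAff.isIrreducible_basicOpen (hfq i))
    refine (IrreducibleSpace.isIrreducible_univ _).image _ (Continuous.continuousOn ?_)
    exact Continuous.subtype_mk
      ((ZAff.continuous_of_polynomial (f i)).comp continuous_subtype_val) _
  refine Order.le_krullDim_iff.2 ⟨⟨Fintype.card σ, fun i => ⟨S i, hirr i, hcl i⟩, fun i => ?_⟩, rfl⟩
  change S i.val ⊂ S (i.val + 1)
  refine ⟨fun x hx k hk => hx k (Nat.le_of_succ_le hk), fun h => ?_⟩
  · let k := e.symm i
    have hek : (e k).val = i.val := by simp [k]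
    have hXk : (MvPolynomial.X k - MvPolynomial.C (t k) : MvPolynomial σ ℂ) ≠ 0 := fun h0 => by
      have := congrArg (MvPolynomial.eval (t + 1)) h0
      simp at this
    obtain ⟨x, hx⟩ := ZAff.exists_eval_ne_zero (mul_ne_zero hXk (hfq (i.val + 1)))
    rw [map_mul, mul_ne_zero_iff, eval_aeval] at hx
    have hmem : (⟨ZAff.mk fun k => MvPolynomial.eval x (f (i.val + 1) k), hx.2⟩ : D) ∈
        S (i.val + 1) := fun k hk => (hf _ _ k).trans (if_neg (not_lt.2 hk))
    have h2 := h hmem k (by simp [hek])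
    have h3 : x k = t k := by
      have := (hf (i.val + 1) x k).symm.trans h2
      rwa [if_pos (by omega)] at this
    exact hx.1 (by simp [h3])

/-- A subset of a space embedded in affine space is irreducible if it is the image of a principal
open subset of an affine space under a polynomial map. -/
theorem isIrreducible_of_polynomial {σ r : Type} {X : Type*} [TopologicalSpace X] {c : X → ZAff r}
    (hc : Topology.IsInducing c) {q : MvPolynomial σ ℂ} (hq : q ≠ 0) {f : r → MvPolynomial σ ℂ}
    {T : Set X}
    (h1 : ∀ t : σ → ℂ, MvPolynomial.eval t q ≠ 0 →
      ∃ x ∈ T, ∀ k, (c x).coord k = MvPolynomial.eval t (f k))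
    (h2 : ∀ x ∈ T, ∃ t : σ → ℂ, MvPolynomial.eval t q ≠ 0 ∧
      ∀ k, (c x).coord k = MvPolynomial.eval t (f k)) : IsIrreducible T := by
  constructor
  · obtain ⟨t, ht⟩ := ZAff.exists_eval_ne_zero hq
    obtain ⟨x, hx, -⟩ := h1 t ht
    exact ⟨x, hx⟩
  · rintro U V hU hV ⟨x, hx, hxU⟩ ⟨y, hy, hyV⟩
    obtain ⟨U', hU', rfl⟩ := hc.isOpen_iff.1 hU
    obtain ⟨V', hV', rfl⟩ := hc.isOpen_iff.1 hV
    obtain ⟨t, ht, htx⟩ := h2 x hx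
    obtain ⟨s, hs, hsy⟩ := h2 y hy
    have hcont := ZAff.continuous_of_polynomial f
    have hx' : c x = ZAff.mk fun k => MvPolynomial.eval t (f k) := ZAff.ext (funext htx)
    have hy' : c y = ZAff.mk fun k => MvPolynomial.eval s (f k) := ZAff.ext (funext hsy)
    obtain ⟨z, hz, hzU, hzV⟩ := (ZAff.isIrreducible_basicOpen hq).2 _ _ (hU'.preimage hcont)
      (hV'.preimage hcont) ⟨⟨t⟩, ht, by rwa [Set.mem_preimage, hx'] at hxU⟩
      ⟨⟨s⟩, hs, by rwa [Set.mem_preimage, hy'] at hyV⟩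
    obtain ⟨w, hw, hwz⟩ := h1 z.coord hz
    have hw' : c w = ZAff.mk fun k => MvPolynomial.eval z.coord (f k) := ZAff.ext (funext hwz)
    exact ⟨w, hw, by rwa [Set.mem_preimage, hw'], by rwa [Set.mem_preimage, hw']⟩

/-! ### The parabolic subgroup and the projection from `GL_d` -/

section Parabolic

variable {ι : Type} {n : ℕ} {μ : Fin n → ℕ}

theorem AdaptedBasis.ext_basis {p p' : AdaptedBasis ι μ} (h : p.1.1 = p'.1.1) : p = p' :=
  Subtype.ext (Prod.ext h (by rw [p.flag_eq, p'.flag_eq, h]))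

/-- The entry `(a, a')` is one of those that may be nonzero in the parabolic subgroup `P_μ` of
block upper triangular matrices. -/
def Allowed (μ : Fin n → ℕ) (a a' : Fin (∑ i, μ i)) : Prop :=
  ∀ j : Fin (n + 1), a' ∈ lowSet μ j.val → a ∈ lowSet μ j.val

/-- The positions of the possibly nonzero entries of the matrices in `P_μ`. -/
abbrev ParPos (μ : Fin n → ℕ) : Type :=
  {x : Fin (∑ i, μ i) × Fin (∑ i, μ i) // Allowed μ x.1 x.2}

instance (μ : Fin n → ℕ) : Fintype (ParPos μ) :=
  Fintype.ofFinite _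

open Classical in
/-- The generic matrix of `P_μ`, with coefficients in a commutative ring. -/
def parMatrix {R : Type*} [CommRing R] (μ : Fin n → ℕ) (t : ParPos μ → R) :
    Matrix (Fin (∑ i, μ i)) (Fin (∑ i, μ i)) R :=
  fun a a' => if h : Allowed μ a a' then t ⟨(a, a'), h⟩ else 0

theorem parMatrix_map {R R' : Type*} [CommRing R] [CommRing R'] (φ : R →+* R')
    (t : ParPos μ → R) (a a' : Fin (∑ i, μ i)) :
    φ (parMatrix μ t a a') = parMatrix μ (fun k => φ (t k)) a a' := by
  simp only [parMatrix]
  split_ifs <;> simp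

/-- The determinant of the generic matrix of `P_μ`. -/
def parDet (μ : Fin n → ℕ) : MvPolynomial (ParPos μ) ℂ :=
  (parMatrix μ (MvPolynomial.X : ParPos μ → MvPolynomial (ParPos μ) ℂ)).det

theorem eval_parDet (t : ParPos μ → ℂ) :
    MvPolynomial.eval t (parDet μ) = (parMatrix μ t).det := by
  rw [parDet, RingHom.map_det]
  congr 1
  ext a a'
  rw [RingHom.mapMatrix_apply, Matrix.map_apply, parMatrix_map]
  simp

theorem parMatrix_eq {N : Matrix (Fin (∑ i, μ i)) (Fin (∑ i, μ i)) ℂ}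
    (hN : ∀ a a', ¬ Allowed μ a a' → N a a' = 0) :
    parMatrix μ (fun k => N k.1.1 k.1.2) = N := by
  ext a a'
  simp only [parMatrix]
  split_ifs with h
  · rfl
  · exact (hN a a' h).symm

theorem parDet_ne_zero (μ : Fin n → ℕ) : parDet μ ≠ 0 := by
  intro h
  have h1 := eval_parDet (μ := μ)
    (fun k => (1 : Matrix (Fin (∑ i, μ i)) (Fin (∑ i, μ i)) ℂ) k.1.1 k.1.2)
  rw [parMatrix_eq, h] at h1
  · simp at h1
  · intro a a' haa
    refine Matrix.one_apply_ne ?_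
    rintro rfl
    exact haa fun j hj => hj

/-- The right action of an invertible block upper triangular matrix on bases. -/
def parAct (b : AdaptedBasis ι μ) (t : ParPos μ → ℂ)
    (ht : MvPolynomial.eval t (parDet μ) ≠ 0) : AdaptedBasis ι μ :=
  AdaptedBasis.ofBasis (b.1.1.map (Matrix.toLinearEquiv b.1.1 (parMatrix μ t)
    (by rw [← eval_parDet]; exact isUnit_iff_ne_zero.2 ht)))

theorem parAct_basis (b : AdaptedBasis ι μ) (t : ParPos μ → ℂ)
    (ht : MvPolynomial.eval t (parDet μ) ≠ 0) (a' : Fin (∑ i, μ i)) :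
    (parAct b t ht).1.1 a' = ∑ a, parMatrix μ t a a' • b.1.1 a := by
  change (b.1.1.map _) a' = _
  rw [Module.Basis.map_apply]
  change Matrix.toLin b.1.1 b.1.1 (parMatrix μ t) (b.1.1 a') = _
  rw [Matrix.toLin_self]

theorem parAct_apply (b : AdaptedBasis ι μ) (t : ParPos μ → ℂ)
    (ht : MvPolynomial.eval t (parDet μ) ≠ 0) (a' : Fin (∑ i, μ i)) (i : ι) :
    (parAct b t ht).1.1 a' i = ∑ a, parMatrix μ t a a' * b.1.1 a i := by
  rw [parAct_basis]
  simp [Finset.sum_apply]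

theorem flag_parAct [Finite ι] (b : AdaptedBasis ι μ) (t : ParPos μ → ℂ)
    (ht : MvPolynomial.eval t (parDet μ) ≠ 0) : (parAct b t ht).flag = b.flag := by
  refine PartialFlag.ext (funext fun j => ?_)
  refine Submodule.eq_of_le_of_finrank_eq ?_ ?_
  · rw [AdaptedBasis.V_flag, AdaptedBasis.V_flag, Submodule.span_le]
    rintro _ ⟨a', ha', rfl⟩
    rw [parAct_basis]
    refine Submodule.sum_mem _ fun a _ => ?_
    by_cases h : Allowed μ a a'
    · exact Submodule.smul_mem _ _ (Submodule.subset_span ⟨a, h j ha', rfl⟩)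
    · simp [parMatrix, h]
  · rw [PartialFlag.finrank_V, PartialFlag.finrank_V]

/-- The block upper triangular matrix that relates two bases adapted to the same flag. -/
def parCoord (b b' : AdaptedBasis ι μ) : ParPos μ → ℂ := fun k =>
  b.1.1.toMatrix b'.1.1 k.1.1 k.1.2

theorem parMatrix_parCoord {b b' : AdaptedBasis ι μ} (h : b'.flag = b.flag) :
    parMatrix μ (parCoord b b') = b.1.1.toMatrix b'.1.1 := by
  refine parMatrix_eq fun a a' haa => ?_
  simp only [Allowed, not_forall] at haa
  obtain ⟨j, hj, hja⟩ := haa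
  have h1 : b'.1.1 a' ∈ b.flag.V j := by
    rw [← h, AdaptedBasis.V_flag]
    exact Submodule.subset_span ⟨a', hj, rfl⟩
  rw [AdaptedBasis.V_flag, Module.Basis.mem_span_image] at h1
  rw [Module.Basis.toMatrix_apply]
  by_contra h2
  exact hja (h1 (Finsupp.mem_support_iff.2 h2))

theorem eval_parCoord_ne_zero {b b' : AdaptedBasis ι μ} (h : b'.flag = b.flag) :
    MvPolynomial.eval (parCoord b b') (parDet μ) ≠ 0 := by
  rw [eval_parDet, parMatrix_parCoord h, ← Module.Basis.det_apply]
  exact (b.1.1.isUnit_det b'.1.1).ne_zero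

theorem parAct_parCoord {b b' : AdaptedBasis ι μ} (h : b'.flag = b.flag) :
    parAct b (parCoord b b') (eval_parCoord_ne_zero h) = b' := by
  refine AdaptedBasis.ext_basis (Module.Basis.eq_of_apply_eq fun a' => ?_)
  rw [parAct_basis, parMatrix_parCoord h, Module.Basis.sum_toMatrix_smul_self]

theorem parCoord_parAct (b : AdaptedBasis ι μ) (t : ParPos μ → ℂ)
    (ht : MvPolynomial.eval t (parDet μ) ≠ 0) : parCoord b (parAct b t ht) = t := by
  funext k
  rw [parCoord, Module.Basis.toMatrix_apply, parAct_basis]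
  simp only [map_sum, map_smul, Module.Basis.repr_self, Finsupp.coe_finsetSum, Finset.sum_apply,
    Finsupp.smul_apply, smul_eq_mul]
  rw [Finset.sum_eq_single k.1.1]
  · simp [parMatrix, k.2]
  · intro a _ ha
    simp [ha]
  · simp

theorem continuous_parAct (t : ParPos μ → ℂ) (ht : MvPolynomial.eval t (parDet μ) ≠ 0) :
    Continuous fun b : AdaptedBasis ι μ => parAct b t ht := by
  rw [AdaptedBasis.isInducing_coords.continuous_iff]
  have : (AdaptedBasis.coords ∘ fun b : AdaptedBasis ι μ => parAct b t ht) =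
      (fun x => ZAff.mk fun k => MvPolynomial.eval x.coord
        (∑ a, MvPolynomial.C (parMatrix μ t a k.1) * MvPolynomial.X (a, k.2))) ∘
        AdaptedBasis.coords := by
    funext b
    refine ZAff.ext (funext fun k => ?_)
    simp [AdaptedBasis.coords, parAct_apply]
  rw [this]
  exact (ZAff.continuous_of_polynomial _).comp AdaptedBasis.isInducing_coords.continuous

theorem AdaptedBasis.isOpenMap_flag [Finite ι] :
    IsOpenMap (AdaptedBasis.flag : AdaptedBasis ι μ → PartialFlag ι μ) := by
  intro U hU
  change @IsOpen _ (TopologicalSpace.coinduced (AdaptedBasis.flag : AdaptedBasis ι μ → _) _) _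
  rw [isOpen_coinduced]
  have : AdaptedBasis.flag ⁻¹' (AdaptedBasis.flag '' U) =
      ⋃ (t : ParPos μ → ℂ) (ht : MvPolynomial.eval t (parDet μ) ≠ 0),
        (fun b : AdaptedBasis ι μ => parAct b t ht) ⁻¹' U := by
    ext b
    simp only [Set.mem_preimage, Set.mem_image, Set.mem_iUnion]
    constructor
    · rintro ⟨b', hb', h⟩
      exact ⟨_, eval_parCoord_ne_zero h, by rwa [parAct_parCoord h]⟩
    · rintro ⟨t, ht, h⟩
      exact ⟨_, h, flag_parAct b t ht⟩
  rw [this]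
  exact isOpen_iUnion fun t => isOpen_iUnion fun ht => hU.preimage (continuous_parAct t ht)

theorem isPreirreducible_fiber_flag [Finite ι] (F : PartialFlag ι μ) :
    IsPreirreducible ((AdaptedBasis.flag : AdaptedBasis ι μ → PartialFlag ι μ) ⁻¹' {F}) := by
  by_cases hne : ∃ b : AdaptedBasis ι μ, b.flag = F
  · obtain ⟨b, rfl⟩ := hne
    refine (isIrreducible_of_polynomial AdaptedBasis.isInducing_coords (parDet_ne_zero μ)
      (f := fun k => ∑ a, parMatrix μ MvPolynomial.X a k.1 * MvPolynomial.C (b.1.1 a k.2))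
      ?_ ?_).2
    · intro t ht
      refine ⟨parAct b t ht, flag_parAct b t ht, fun k => ?_⟩
      simp [AdaptedBasis.coords, parAct_apply, parMatrix_map]
    · intro b' hb'
      refine ⟨_, eval_parCoord_ne_zero hb', fun k => ?_⟩
      conv_lhs => rw [← parAct_parCoord hb']
      simp [AdaptedBasis.coords, parAct_apply, parMatrix_map]
  · intro U V _ _ ⟨b, hb, _⟩
    exact (hne ⟨b, hb⟩).elim

/-- The fibres of `GL_d → X_μ` are copies of `P_μ`, of dimension the number of free entries. -/
theorem card_parPos_le_fiber [Fintype ι] (F : PartialFlag ι μ) :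
    ((Fintype.card (ParPos μ) : ℕ) : WithBot ℕ∞) ≤ topologicalKrullDim
      ((AdaptedBasis.flag : AdaptedBasis ι μ → PartialFlag ι μ) ⁻¹' {F}) := by
  obtain ⟨b, rfl⟩ := AdaptedBasis.surjective_flag F
  refine (card_le_topologicalKrullDim_basicOpen (parDet_ne_zero μ)).trans ?_
  let D : Set (ZAff (ParPos μ)) := {x | MvPolynomial.eval x.coord (parDet μ) ≠ 0}
  let Fib := (AdaptedBasis.flag : AdaptedBasis ι μ → PartialFlag ι μ) ⁻¹' {b.flag}
  let g : D → Fib := fun t => ⟨parAct b t.1.coord t.2, flag_parAct b t.1.coord t.2⟩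
  let u : Fib → D := fun b' => ⟨⟨parCoord b b'.1⟩, eval_parCoord_ne_zero b'.2⟩
  have hug : Function.LeftInverse u g := fun t =>
    Subtype.ext (ZAff.ext (parCoord_parAct b t.1.coord t.2))
  have hg : Continuous g := by
    refine Continuous.subtype_mk ?_ _
    rw [AdaptedBasis.isInducing_coords.continuous_iff]
    refine ((ZAff.continuous_of_polynomial fun k : Fin (∑ i, μ i) × ι =>
      ∑ a, parMatrix μ MvPolynomial.X a k.1 * MvPolynomial.C (b.1.1 a k.2)).comp
      continuous_subtype_val).congr fun t => ?_
    refine ZAff.ext (funext fun k => ?_)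
    simp [AdaptedBasis.coords, parAct_apply, parMatrix_map]
  have hu : Continuous u := by
    refine Continuous.subtype_mk ?_ _
    refine ((ZAff.continuous_of_polynomial fun k : ParPos μ =>
      ∑ i, MvPolynomial.C (b.1.1.repr (Pi.basisFun ℂ ι i) k.1.1) * MvPolynomial.X (k.1.2, i)).comp
      (AdaptedBasis.isInducing_coords.continuous.comp continuous_subtype_val)).congr fun b' => ?_
    refine ZAff.ext (funext fun k => ?_)
    have h := (Pi.basisFun ℂ ι).sum_repr (b'.1.1.1 k.1.2)
    simp only [Pi.basisFun_repr] at h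
    simp only [parCoord, Module.Basis.toMatrix_apply, Function.comp_apply]
    conv_rhs => rw [← h]
    simp [AdaptedBasis.coords, mul_comm]
  exact (hug.isEmbedding hu hg).isInducing.topologicalKrullDim_le

end Parabolic

/-! ### Sets of flags with a polynomial parametrization -/

section Param

variable {ι : Type} {n : ℕ} {μ : Fin n → ℕ}

/-- `W` is the set of flags of a family of adapted bases whose coordinates are polynomials on a
nonempty principal open subset of `ℂ^σ`. -/
def IsParam (σ : Type) (W : Set (PartialFlag ι μ)) : Prop :=
  ∃ (q : MvPolynomial σ ℂ) (f : Fin (∑ i, μ i) × ι → MvPolynomial σ ℂ)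
    (T : Set (AdaptedBasis ι μ)), q ≠ 0 ∧
    (∀ t : σ → ℂ, MvPolynomial.eval t q ≠ 0 →
      ∃ x ∈ T, ∀ k, x.coords.coord k = MvPolynomial.eval t (f k)) ∧
    (∀ x ∈ T, ∃ t : σ → ℂ, MvPolynomial.eval t q ≠ 0 ∧
      ∀ k, x.coords.coord k = MvPolynomial.eval t (f k)) ∧
    AdaptedBasis.flag '' T = W

theorem IsParam.isIrreducible {σ : Type} {W : Set (PartialFlag ι μ)} (h : IsParam σ W) :
    IsIrreducible W := by
  obtain ⟨q, f, T, hq, h1, h2, rfl⟩ := h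
  exact (isIrreducible_of_polynomial AdaptedBasis.isInducing_coords hq h1 h2).image _
    AdaptedBasis.continuous_flag.continuousOn

/-- The preimage in `GL_d` of a set parametrized by `ℂ^σ` is parametrized by `ℂ^σ × P_μ`, so its
closure has dimension at most `|σ| + dim P_μ`; its fibres over the set have dimension `dim P_μ`. -/
theorem IsParam.topologicalKrullDim_closure_le [Fintype ι] {σ : Type} [Fintype σ]
    {W : Set (PartialFlag ι μ)} (h : IsParam σ W) :
    topologicalKrullDim (closure W) ≤ (Fintype.card σ : ℕ) := by
  obtain ⟨q, f, T, hq, h1, h2, rfl⟩ := h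
  set W := (AdaptedBasis.flag : AdaptedBasis ι μ → _) '' T
  let Y := (AdaptedBasis.flag : AdaptedBasis ι μ → _) ⁻¹' closure W
  let π := (closure W).restrictPreimage (AdaptedBasis.flag : AdaptedBasis ι μ → _)
  let f' : Fin (∑ i, μ i) × ι → MvPolynomial (σ ⊕ ParPos μ) ℂ := fun k =>
    ∑ a, parMatrix μ (fun l => MvPolynomial.X (Sum.inr l)) a k.1 *
      MvPolynomial.rename Sum.inl (f (a, k.2))
  -- the polynomials `f'` parametrize the preimage of `W`, which is dense in `Y` as the map is open
  have hY : topologicalKrullDim Y ≤ (Fintype.card (σ ⊕ ParPos μ) : ℕ) := by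
    refine topologicalKrullDim_le_card (c := fun y : Y => y.1.coords)
      f' (AdaptedBasis.isInducing_coords.comp Topology.IsInducing.subtypeVal) fun p hp => ?_
    have hYcl : Y = closure (AdaptedBasis.flag ⁻¹' W) :=
      AdaptedBasis.isOpenMap_flag.preimage_closure_eq_closure_preimage
        AdaptedBasis.continuous_flag W
    have hcl : IsClosed {b : AdaptedBasis ι μ | MvPolynomial.eval b.coords.coord p = 0} :=
      (ZAff.isClosed_zeroLocus p).preimage AdaptedBasis.isInducing_coords.continuous
    have hsub : AdaptedBasis.flag ⁻¹' W ⊆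
        {b : AdaptedBasis ι μ | MvPolynomial.eval b.coords.coord p = 0} := by
      rintro b' ⟨b, hb, hbb⟩
      obtain ⟨t, -, ht⟩ := h2 b hb
      have h3 := eval_aeval (Sum.elim t (parCoord b b')) f' p
      rw [hp, map_zero] at h3
      change MvPolynomial.eval _ p = 0
      rw [h3]
      congr 2
      funext k
      conv_lhs => rw [← parAct_parCoord hbb.symm]
      have hb1 : ∀ a i, b.1.1 a i = MvPolynomial.eval t (f (a, i)) := fun a i => ht (a, i)
      simp only [f', AdaptedBasis.coords, parAct_apply, map_sum, map_mul, parMatrix_map,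
        MvPolynomial.eval_X, Sum.elim_inr, MvPolynomial.eval_rename, Sum.elim_comp_inl, hb1]
    intro y
    have : Y ⊆ _ := hYcl.le.trans (closure_minimal hsub hcl)
    exact this y.2
  have hdim := le_topologicalKrullDim_of_fibers (π := π)
    (AdaptedBasis.continuous_flag.restrictPreimage)
    (AdaptedBasis.isOpenMap_flag.restrictPreimage _)
    (Set.restrictPreimage_surjective _ AdaptedBasis.surjective_flag) (e := Fintype.card (ParPos μ))
  refine sSup_le ?_
  rintro _ ⟨l, rfl⟩
  have hm : (l.length : WithBot ℕ∞) ≤ topologicalKrullDim (closure W) :=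
    Order.le_krullDim_iff.2 ⟨l, rfl⟩
  have hfib : ∀ x : closure W, π ⁻¹' {x} = Subtype.val ⁻¹'
      ((AdaptedBasis.flag : AdaptedBasis ι μ → _) ⁻¹' {x.1}) := fun x => by
    ext y
    exact Subtype.ext_iff
  have h3 := (hdim (fun x => ?_) (fun x => ?_) hm).trans hY
  · have h4 : Fintype.card (ParPos μ) + l.length ≤ Fintype.card (σ ⊕ ParPos μ) := by
      exact_mod_cast h3
    rw [Fintype.card_sum] at h4
    have h5 : l.length ≤ Fintype.card σ := by omega
    change (l.length : WithBot ℕ∞) ≤ _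
    exact_mod_cast h5
  · rintro U V hU hV ⟨y, hy, hyU⟩ ⟨z, hz, hzV⟩
    obtain ⟨U', hU', rfl⟩ := isOpen_induced_iff.1 hU
    obtain ⟨V', hV', rfl⟩ := isOpen_induced_iff.1 hV
    rw [hfib] at hy hz ⊢
    obtain ⟨w, hw, hwU⟩ := isPreirreducible_fiber_flag x.1 U' V' hU' hV' ⟨y, hy, hyU⟩ ⟨z, hz, hzV⟩
    exact ⟨⟨w, by
      change w.flag ∈ closure W
      rw [show w.flag = x.1 from hw]
      exact x.2⟩, hw, hwU⟩
  · refine (card_parPos_le_fiber x.1).trans ?_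
    let g : (AdaptedBasis.flag : AdaptedBasis ι μ → _) ⁻¹' {x.1} → π ⁻¹' {x} := fun b =>
      ⟨⟨b.1, by
      change b.1.flag ∈ closure W
      rw [show b.1.flag = x.1 from b.2]
      exact x.2⟩, Subtype.ext b.2⟩
    have hg : Topology.IsInducing g := by
      have h5 : Continuous g :=
        Continuous.subtype_mk (Continuous.subtype_mk continuous_subtype_val _) _
      exact Topology.IsInducing.of_comp h5 (continuous_subtype_val.comp continuous_subtype_val)
        Topology.IsInducing.subtypeVal
    exact hg.topologicalKrullDim_le

end Param

/-! ### Semicontinuity of intersection dimensions -/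

section Semicontinuity

theorem exists_surjective_of_le_finrank {M : Type*} [AddCommGroup M] [Module ℂ M]
    [FiniteDimensional ℂ M] {r : ℕ} (h : r ≤ Module.finrank ℂ M) :
    ∃ f : M →ₗ[ℂ] (Fin r → ℂ), Function.Surjective f := by
  let b := Module.finBasis ℂ M
  refine ⟨(LinearMap.funLeft ℂ ℂ (Fin.castLE h)).comp b.equivFun.toLinearMap, ?_⟩
  exact (LinearMap.funLeft_surjective_of_injective ℂ ℂ _ (Fin.castLE_injective h)).comp
    b.equivFun.surjective

/-- `dim V - dim (V ∩ E) ≥ r` is detected by linear maps to `ℂ^r` that vanish on `E`. -/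
theorem finrank_inf_add_le_iff {M : Type*} [AddCommGroup M] [Module ℂ M] [FiniteDimensional ℂ M]
    (V E : Submodule ℂ M) (r : ℕ) :
    Module.finrank ℂ (V ⊓ E : Submodule ℂ M) + r ≤ Module.finrank ℂ V ↔
      ∃ R : M →ₗ[ℂ] (Fin r → ℂ), E ≤ LinearMap.ker R ∧ V.map R = ⊤ := by
  have hq := LinearMap.finrank_range_add_finrank_ker (E.mkQ.domRestrict V)
  have hker : Module.finrank ℂ (LinearMap.ker (E.mkQ.domRestrict V)) =
      Module.finrank ℂ (V ⊓ E : Submodule ℂ M) := by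
    have : LinearMap.ker (E.mkQ.domRestrict V) = E.submoduleOf V := by
      ext x
      simp [Submodule.submoduleOf]
    rw [this, LinearEquiv.finrank_eq (Submodule.equivMapOfInjective V.subtype
      V.injective_subtype (E.submoduleOf V)), Submodule.submoduleOf, Submodule.map_comap_subtype]
  rw [hker] at hq
  constructor
  · intro h
    obtain ⟨f, hf⟩ := exists_surjective_of_le_finrank
      (M := LinearMap.range (E.mkQ.domRestrict V)) (r := r) (by omega)
    obtain ⟨g, hg⟩ := LinearMap.exists_extend f
    refine ⟨g.comp E.mkQ, fun x hx => ?_, ?_⟩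
    · rw [LinearMap.mem_ker, LinearMap.comp_apply, Submodule.mkQ_apply,
        (Submodule.Quotient.mk_eq_zero E).2 hx, map_zero]
    · refine eq_top_iff.2 fun y _ => ?_
      obtain ⟨⟨_, x, rfl⟩, rfl⟩ := hf y
      refine ⟨x, x.2, ?_⟩
      rw [← hg]
      rfl
  · rintro ⟨R, hE, hV⟩
    have h1 := Submodule.finrank_map_le (E.liftQ R hE) (LinearMap.range (E.mkQ.domRestrict V))
    have h2 : (LinearMap.range (E.mkQ.domRestrict V)).map (E.liftQ R hE) = ⊤ := by
      rw [← hV, ← LinearMap.range_comp]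
      ext y
      simp only [LinearMap.mem_range, Submodule.mem_map]
      constructor
      · rintro ⟨x, rfl⟩
        exact ⟨x, x.2, rfl⟩
      · rintro ⟨x, hx, rfl⟩
        exact ⟨⟨x, hx⟩, rfl⟩
    rw [h2, finrank_top, Module.finrank_fin_fun] at h1
    omega

variable {ι : Type} {n : ℕ} {μ : Fin n → ℕ}

/-- The dimension of the intersection of a member of the flag with a fixed subspace is upper
semicontinuous: in `GL_d`, the locus where it is less than `m` is the union of the nonvanishing loci
of the determinants that express surjectivity of linear maps to `ℂ^r` vanishing on `E`. -/
theorem isClosed_setOf_le_finrank_inf [Fintype ι] (j : Fin (n + 1)) (E : Submodule ℂ (ι → ℂ))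
    (m : ℕ) : IsClosed {F : PartialFlag ι μ |
      m ≤ Module.finrank ℂ (F.V j ⊓ E : Submodule ℂ (ι → ℂ))} := by
  change @IsClosed _ (TopologicalSpace.coinduced (AdaptedBasis.flag : AdaptedBasis ι μ → _) _) _
  rw [isClosed_coinduced]
  classical
  by_cases hm : psum μ j.val < m
  · convert isClosed_empty
    ext b
    simp only [Set.mem_preimage, Set.mem_ofPred_eq, Set.mem_empty_iff_false, iff_false, not_le]
    refine lt_of_le_of_lt (Submodule.finrank_mono inf_le_left) ?_
    rwa [PartialFlag.finrank_V]
  rw [not_lt] at hm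
  set r := psum μ j.val - m + 1 with hr
  -- the matrix of `R` on chosen combinations of the initial segment of the basis
  let B : ((ι → ℂ) →ₗ[ℂ] (Fin r → ℂ)) → (Fin r → Fin (∑ i, μ i) → ℂ) →
      Matrix (Fin r) (Fin r) (MvPolynomial (Fin (∑ i, μ i) × ι) ℂ) := fun R Q l l' =>
    ∑ a, ∑ i, MvPolynomial.C (Q l a * R (Pi.single i 1) l') * MvPolynomial.X (a, i)
  have hB : ∀ R Q (b : AdaptedBasis ι μ) l l', MvPolynomial.eval b.coords.coord (B R Q l l') =
      R (∑ a, Q l a • b.1.1 a) l' := by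
    intro R Q b l l'
    simp only [B, map_sum, map_mul, MvPolynomial.eval_C, MvPolynomial.eval_X, map_smul,
      Finset.sum_apply, Pi.smul_apply, smul_eq_mul]
    refine Finset.sum_congr rfl fun a _ => ?_
    have h := pi_eq_sum_univ' (b.1.1 a)
    conv_rhs => rw [h, map_sum, Finset.sum_apply, Finset.mul_sum]
    refine Finset.sum_congr rfl fun i _ => ?_
    rw [map_smul, Pi.smul_apply, smul_eq_mul]
    simp only [AdaptedBasis.coords]
    ring
  have hset : (AdaptedBasis.flag ⁻¹' {F : PartialFlag ι μ |
      m ≤ Module.finrank ℂ (F.V j ⊓ E : Submodule ℂ (ι → ℂ))})ᶜ =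
      ⋃ (R : (ι → ℂ) →ₗ[ℂ] (Fin r → ℂ)) (Q : Fin r → Fin (∑ i, μ i) → ℂ)
        (_ : E ≤ LinearMap.ker R) (_ : ∀ l a, a ∉ lowSet μ j.val → Q l a = 0),
        {b : AdaptedBasis ι μ | MvPolynomial.eval b.coords.coord (B R Q).det = 0}ᶜ := by
    ext b
    have hdet : ∀ R Q, MvPolynomial.eval b.coords.coord (B R Q).det =
        Matrix.det fun l l' => R (∑ a, Q l a • b.1.1 a) l' := by
      intro R Q
      rw [RingHom.map_det]
      congr 1
      ext l l'
      exact hB R Q b l l'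
    simp only [Set.mem_compl_iff, Set.mem_preimage, Set.mem_ofPred_eq, Set.mem_iUnion, hdet]
    have h1 : ¬ m ≤ Module.finrank ℂ (b.flag.V j ⊓ E : Submodule ℂ (ι → ℂ)) ↔
        Module.finrank ℂ (b.flag.V j ⊓ E : Submodule ℂ (ι → ℂ)) + r ≤
          Module.finrank ℂ (b.flag.V j) := by
      rw [PartialFlag.finrank_V]
      omega
    rw [h1, finrank_inf_add_le_iff]
    refine exists_congr fun R => ?_
    rw [AdaptedBasis.V_flag]
    constructor
    · rintro ⟨hE, hR⟩
      have h2 : ∀ l : Fin r, ∃ Q : Fin (∑ i, μ i) → ℂ, (∀ a, a ∉ lowSet μ j.val → Q a = 0) ∧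
          R (∑ a, Q a • b.1.1 a) = Pi.single l 1 := by
        intro l
        obtain ⟨v, hv, hvl⟩ := (hR.symm ▸ Submodule.mem_top : Pi.single l 1 ∈ Submodule.map R _)
        refine ⟨b.1.1.repr v, fun a ha => ?_, ?_⟩
        · have := b.1.1.mem_span_image.1 hv
          by_contra h0
          exact ha (this (Finsupp.mem_support_iff.2 h0))
        · rw [b.1.1.sum_repr, hvl]
      choose Q hQ hQR using h2
      refine ⟨Q, hE, hQ, ?_⟩
      have : (fun l l' => R (∑ a, Q l a • b.1.1 a) l') = (1 : Matrix (Fin r) (Fin r) ℂ) := by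
        funext l l'
        rw [hQR, Matrix.one_apply, Pi.single_apply]
        simp [eq_comm]
      rw [this, Matrix.det_one]
      exact one_ne_zero
    · rintro ⟨Q, hE, hQ, hdet⟩
      refine ⟨hE, ?_⟩
      have hli := Matrix.linearIndependent_rows_of_det_ne_zero hdet
      have hspan := hli.span_eq_top_of_card_eq_finrank (by simp)
      rw [eq_top_iff, ← hspan, Submodule.span_le]
      rintro _ ⟨l, rfl⟩
      refine ⟨∑ a, Q l a • b.1.1 a, Submodule.sum_mem _ fun a _ => ?_, rfl⟩
      by_cases ha : a ∈ lowSet μ j.val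
      · exact Submodule.smul_mem _ _ (Submodule.subset_span ⟨a, ha, rfl⟩)
      · rw [hQ l a ha, zero_smul]
        exact Submodule.zero_mem _
  rw [← isOpen_compl_iff, hset]
  refine isOpen_iUnion fun R => isOpen_iUnion fun Q => isOpen_iUnion fun _ =>
    isOpen_iUnion fun _ => ?_
  exact ((ZAff.isClosed_zeroLocus _).preimage
    AdaptedBasis.isInducing_coords.continuous).isOpen_compl

end Semicontinuity

/-! ### Horizontal strips -/

section Strips

/-- `lam / tau` is a horizontal strip: it has at most one box in each column, which is then the
bottom box of that column of `lam`. -/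
structure IsStrip (tau lam : YoungDiagram) : Prop where
  le : tau ≤ lam
  mem_of_below : ∀ {i j : ℕ}, (i + 1, j) ∈ lam → (i, j) ∈ tau

/-- The columns that contain a box of `lam / tau`. -/
def stripCols (tau lam : YoungDiagram) : Finset ℕ := (lam.cells \ tau.cells).image Prod.snd

theorem mem_stripCols {tau lam : YoungDiagram} {c : ℕ} :
    c ∈ stripCols tau lam ↔ ∃ i, (i, c) ∈ lam ∧ (i, c) ∉ tau := by
  simp [stripCols]

theorem top_mem_of_mem_stripCols {tau lam : YoungDiagram} {c : ℕ} (hc : c ∈ stripCols tau lam) :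
    (0, c) ∈ lam := by
  obtain ⟨i, hi, -⟩ := mem_stripCols.1 hc
  exact lam.up_left_mem (Nat.zero_le i) le_rfl hi

theorem mem_iff_of_notMem_stripCols {tau lam : YoungDiagram} (hle : tau ≤ lam) {c : ℕ}
    (hc : c ∉ stripCols tau lam) (i : ℕ) : (i, c) ∈ tau ↔ (i, c) ∈ lam :=
  ⟨fun h => hle h, fun h => by
    by_contra h'
    exact hc (mem_stripCols.2 ⟨i, h, h'⟩)⟩

theorem IsStrip.mem_iff_below {tau lam : YoungDiagram} (h : IsStrip tau lam) {c : ℕ}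
    (hc : c ∈ stripCols tau lam) (i : ℕ) : (i, c) ∈ tau ↔ (i + 1, c) ∈ lam := by
  refine ⟨fun hi => ?_, h.mem_of_below⟩
  obtain ⟨l, hl, hlt⟩ := mem_stripCols.1 hc
  have : i < l := by
    by_contra h'
    exact hlt (tau.up_left_mem (not_lt.1 h') le_rfl hi)
  exact lam.up_left_mem this le_rfl hl

theorem IsStrip.injOn_snd {tau lam : YoungDiagram} (h : IsStrip tau lam) :
    Set.InjOn Prod.snd ((lam.cells \ tau.cells : Finset (ℕ × ℕ)) : Set (ℕ × ℕ)) := by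
  rintro ⟨i, c⟩ hi ⟨i', c'⟩ hi' (rfl : c = c')
  simp only [Finset.coe_sdiff, Set.mem_sdiff, Finset.mem_coe, YoungDiagram.mem_cells] at hi hi'
  by_contra hne
  rcases Nat.lt_or_gt_of_ne (fun hii => hne (by rw [hii]) : i ≠ i') with hlt | hlt
  · exact hi.2 (h.mem_of_below (lam.up_left_mem hlt le_rfl hi'.1))
  · exact hi'.2 (h.mem_of_below (lam.up_left_mem hlt le_rfl hi.1))

theorem IsStrip.sum_cells {tau lam : YoungDiagram} (h : IsStrip tau lam) (f : ℕ → ℕ) :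
    ∑ b ∈ lam.cells, f b.2 = ∑ b ∈ tau.cells, f b.2 + ∑ c ∈ stripCols tau lam, f c := by
  rw [stripCols, Finset.sum_image h.injOn_snd, add_comm]
  exact (Finset.sum_sdiff (YoungDiagram.cells_subset_iff.2 h.le)).symm

theorem IsStrip.card_eq {tau lam : YoungDiagram} (h : IsStrip tau lam) :
    lam.card = tau.card + (stripCols tau lam).card := by
  have := h.sum_cells fun _ => 1
  simpa using this

/-- The sum of the column indices of the boxes of `lam`, which equals `d_lam`. -/
def colSum (lam : YoungDiagram) : ℕ := ∑ b ∈ lam.cells, b.2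

theorem sum_cells_eq_sum_rows (lam : YoungDiagram) (f : ℕ → ℕ) {M : ℕ} (hM : lam.colLen 0 ≤ M) :
    ∑ b ∈ lam.cells, f b.2 = ∑ i ∈ Finset.range M, ∑ j ∈ Finset.range (lam.rowLen i), f j := by
  rw [Finset.sum_sigma']
  refine Finset.sum_bij' (fun b _ => ⟨b.1, b.2⟩) (fun b _ => (b.1, b.2)) ?_ ?_ ?_ ?_ ?_
  · rintro ⟨i, j⟩ hb
    rw [YoungDiagram.mem_cells] at hb
    simp only [Finset.mem_sigma, Finset.mem_range]
    exact ⟨(YoungDiagram.mem_iff_lt_colLen.1 (lam.up_left_mem le_rfl (Nat.zero_le j) hb)).trans_le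
      hM, YoungDiagram.mem_iff_lt_rowLen.1 hb⟩
  · rintro ⟨i, j⟩ hb
    simp only [Finset.mem_sigma, Finset.mem_range] at hb
    exact (YoungDiagram.mem_cells _).2 (YoungDiagram.mem_iff_lt_rowLen.2 hb.2)
  all_goals simp

/-- A row of length `l` contributes `0 + 1 + ⋯ + (l - 1)` to either side. -/
theorem dNum_rowLen_eq_colSum {lam : YoungDiagram} {n : ℕ} (h : lam.colLen 0 ≤ n) :
    dNum (fun i : Fin n => lam.rowLen i) = colSum lam := by
  rw [colSum, sum_cells_eq_sum_rows lam (fun j => j) h, dNum, Finset.sum_range]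
  exact Finset.sum_congr rfl fun i _ => by rw [Nat.choose_two_right, Finset.sum_range_id]

theorem card_eq_sum_rowLen (lam : YoungDiagram) {M : ℕ} (hM : lam.colLen 0 ≤ M) :
    lam.card = ∑ i ∈ Finset.range M, lam.rowLen i := by
  have := sum_cells_eq_sum_rows lam (fun _ => 1) hM
  simpa using this

/-- Moving a set of columns to the right among columns of the same length, one obtains the columns
of a horizontal strip. A rearrangement with the largest sum of column indices does this. -/
theorem exists_perm_stripCols (lam : YoungDiagram) (γ : Finset ℕ) (hγ : ∀ c ∈ γ, (0, c) ∈ lam) :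
    ∃ (w : Equiv.Perm ℕ) (tau : YoungDiagram), (∀ c, lam.colLen (w c) = lam.colLen c) ∧
      IsStrip tau lam ∧ (∀ c, w c ∈ stripCols tau lam ↔ c ∈ γ) ∧
      (stripCols tau lam).card = γ.card ∧ ∑ c ∈ γ, c ≤ ∑ c ∈ stripCols tau lam, c := by
  classical
  let P : Equiv.Perm ℕ → Prop := fun w => ∀ c, lam.colLen (w c) = lam.colLen c
  have hP1 : P 1 := fun c => rfl
  have hbd : ∀ w, P w → ∑ c ∈ γ, w c ≤ γ.card * lam.rowLen 0 := by
    intro w hw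
    refine Finset.sum_le_card_nsmul _ _ _ fun c hc => ?_
    have : (0, w c) ∈ lam := by
      rw [YoungDiagram.mem_iff_lt_colLen, hw, ← YoungDiagram.mem_iff_lt_colLen]
      exact hγ c hc
    exact (YoungDiagram.mem_iff_lt_rowLen.1 this).le
  obtain ⟨w, hw, hmax⟩ : ∃ w, P w ∧ ∀ w', P w' → ∑ c ∈ γ, w' c ≤ ∑ c ∈ γ, w c := by
    have hfin : ((fun w : Equiv.Perm ℕ => ∑ c ∈ γ, w c) '' {w | P w}).Finite :=
      (Set.finite_Iic (γ.card * lam.rowLen 0)).subset (by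
        rintro _ ⟨w, hw, rfl⟩
        exact hbd w hw)
    obtain ⟨_, ⟨w, hw, rfl⟩, hmax⟩ := hfin.exists_maximal ⟨_, ⟨1, hP1, rfl⟩⟩
    refine ⟨w, hw, fun w' hw' => ?_⟩
    by_contra hlt
    exact hlt (hmax ⟨w', hw', rfl⟩ (not_le.1 hlt).le)
  -- by maximality, the new columns are the rightmost ones among columns of the same length
  have hnice : ∀ c, c ∈ γ → lam.colLen (w c + 1) = lam.colLen (w c) → w.symm (w c + 1) ∈ γ := by
    intro c hc hcol
    by_contra hnot
    have hP' : P (w.trans (Equiv.swap (w c) (w c + 1))) := by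
      intro e
      rw [Equiv.trans_apply, ← hw e]
      rcases eq_or_ne (w e) (w c) with h1 | h1
      · rw [h1, Equiv.swap_apply_left, hcol]
      rcases eq_or_ne (w e) (w c + 1) with h2 | h2
      · rw [h2, Equiv.swap_apply_right, hcol]
      · rw [Equiv.swap_apply_of_ne_of_ne h1 h2]
    have h3 := hmax _ hP'
    have h4 : ∑ e ∈ γ, w e < ∑ e ∈ γ, (w.trans (Equiv.swap (w c) (w c + 1))) e := by
      refine Finset.sum_lt_sum (fun e he => ?_) ⟨c, hc, by simp⟩
      rw [Equiv.trans_apply]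
      rcases eq_or_ne (w e) (w c) with h1 | h1
      · rw [h1, Equiv.swap_apply_left]
        omega
      · rw [Equiv.swap_apply_of_ne_of_ne h1]
        intro h2
        exact hnot (by rw [← h2, Equiv.symm_apply_apply]; exact he)
    omega
  have hnice' : ∀ c k, c ∈ γ.map w.toEmbedding → lam.colLen (c + k) = lam.colLen c →
      c + k ∈ γ.map w.toEmbedding := by
    intro c k hc
    induction k with
    | zero => exact fun _ => hc
    | succ k ih =>
      intro hk
      have h1 := lam.colLen_anti c (c + k) (by omega)
      have h2 := lam.colLen_anti (c + k) (c + (k + 1)) (by omega)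
      obtain ⟨e, he, hek⟩ := Finset.mem_map.1 (ih (by omega))
      rw [Equiv.coe_toEmbedding] at hek
      have h3 := hnice e he (by rw [hek, add_assoc]; omega)
      rw [hek, add_assoc] at h3
      exact Finset.mem_map.2 ⟨_, h3, by simp⟩
  let tau : YoungDiagram :=
    { cells := lam.cells.filter fun b => ¬ (b.2 ∈ γ.map w.toEmbedding ∧ b.1 + 1 = lam.colLen b.2)
      isLowerSet := by
        rintro ⟨i, j⟩ ⟨i', j'⟩ ⟨hi, hj⟩ hb
        simp only [Finset.coe_filter, YoungDiagram.mem_cells, Set.mem_ofPred_eq] at hb ⊢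
        refine ⟨lam.up_left_mem hi hj hb.1, fun ⟨hγ', hlen⟩ => hb.2 ?_⟩
        have h1 := lam.colLen_anti j' j hj
        have h2 := YoungDiagram.mem_iff_lt_colLen.1 hb.1
        change i' ≤ i at hi
        change j' ≤ j at hj
        obtain ⟨k, rfl⟩ := Nat.exists_eq_add_of_le hj
        exact ⟨hnice' j' k hγ' (by omega), by omega⟩ }
  have htau : ∀ i j, (i, j) ∈ tau ↔ (i, j) ∈ lam ∧
      ¬ (j ∈ γ.map w.toEmbedding ∧ i + 1 = lam.colLen j) := by
    intro i j
    rw [← YoungDiagram.mem_cells]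
    simp [tau]
  have hcols : stripCols tau lam = γ.map w.toEmbedding := by
    ext c
    rw [mem_stripCols]
    constructor
    · rintro ⟨i, hi, hit⟩
      rw [htau, not_and_not_right] at hit
      exact (hit hi).1
    · intro hc
      have h0 : (0, c) ∈ lam := by
        obtain ⟨e, he, rfl⟩ := Finset.mem_map.1 hc
        rw [YoungDiagram.mem_iff_lt_colLen, Equiv.coe_toEmbedding, hw,
          ← YoungDiagram.mem_iff_lt_colLen]
        exact hγ e he
      have h1 := YoungDiagram.mem_iff_lt_colLen.1 h0
      have h2 : (lam.colLen c - 1, c) ∈ lam := YoungDiagram.mem_iff_lt_colLen.2 (by omega)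
      refine ⟨lam.colLen c - 1, h2, fun h => ((htau _ _).1 h).2 ⟨hc, by omega⟩⟩
  refine ⟨w, tau, hw, ⟨fun b hb => ((htau b.1 b.2).1 hb).1, fun {i j} hij => ?_⟩, ?_, ?_, ?_⟩
  · refine (htau _ _).2 ⟨lam.up_left_mem (Nat.le_succ i) le_rfl hij, fun h => ?_⟩
    have := YoungDiagram.mem_iff_lt_colLen.1 hij
    omega
  · intro c
    rw [hcols, Finset.mem_map_equiv, Equiv.symm_apply_apply]
  · rw [hcols, Finset.card_map]
  · rw [hcols, Finset.sum_map]
    exact hmax 1 hP1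

/-- The coordinates of the Schubert cell with column set `γ`: pairs `(c, j)` with `c ∈ γ`, `j < c`
and `j ∉ γ`. -/
def cellPos (γ : Finset ℕ) : Finset ((_ : ℕ) × ℕ) :=
  γ.sigma fun c => (Finset.range c).filter (· ∉ γ)

theorem mem_cellPos {γ : Finset ℕ} {c j : ℕ} :
    (⟨c, j⟩ : (_ : ℕ) × ℕ) ∈ cellPos γ ↔ c ∈ γ ∧ j < c ∧ j ∉ γ := by
  simp [cellPos]

/-- The number of coordinates of the Schubert cell with column set `γ`. -/
theorem card_cellPos_add (γ : Finset ℕ) :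
    (cellPos γ).card + γ.card.choose 2 = ∑ c ∈ γ, c := by
  have h1 : ∑ c ∈ γ, (γ.filter (· < c)).card = γ.card.choose 2 := by
    induction γ using Finset.induction_on_max with
    | empty => simp
    | insert a s ha ih =>
      have hna : a ∉ s := fun h => (ha a h).false
      rw [Finset.sum_insert hna, Finset.card_insert_of_notMem hna, Nat.choose_succ_succ',
        Nat.choose_one_right, ← ih]
      congr 1
      · congr 1
        ext x
        simp only [Finset.mem_filter, Finset.mem_insert]
        exact ⟨fun h => h.1.resolve_left h.2.ne, fun h => ⟨Or.inr h, ha x h⟩⟩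
      · refine Finset.sum_congr rfl fun c hc => ?_
        rw [Finset.filter_insert, if_neg (ha c hc).not_gt]
  rw [cellPos, Finset.card_sigma, ← h1, ← Finset.sum_add_distrib]
  refine Finset.sum_congr rfl fun c _ => ?_
  have h2 : γ.filter (· < c) = (Finset.range c).filter (· ∈ γ) := by
    ext x
    simp [and_comm]
  rw [h2, add_comm, Finset.card_filter_add_card_filter_not, Finset.card_range]

end Strips

/-! ### Existence of horizontal strips, and dominance -/

section Dominance

/-- Every set of `m` parts of `μ` has sum at most `lam_1 + ⋯ + lam_m`: dominance of `μ^+` by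
`lam`. -/
def SubsetDominates (lam : YoungDiagram) {n : ℕ} (μ : Fin n → ℕ) : Prop :=
  ∀ I : Finset (Fin n), ∑ i ∈ I, μ i ≤ ∑ r ∈ Finset.range I.card, lam.rowLen r

theorem Dominates.subsetDominates {lam : YoungDiagram} {n : ℕ} {μ : Fin n → ℕ}
    (h : Dominates lam (sortDesc μ)) : SubsetDominates lam μ := by
  intro I
  have hanti : Antitone (sortDesc μ) := fun i j hij =>
    Tuple.monotone_sort (fun i => OrderDual.toDual (μ i)) hij
  set w := Tuple.sort (fun i => OrderDual.toDual (μ i)) with hw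
  refine le_trans ?_ (h I.card)
  obtain ⟨J, hJ, h1⟩ : ∃ J : Finset (Fin n), J.card = I.card ∧
      ∑ i ∈ I, μ i = ∑ i ∈ J, sortDesc μ i := by
    refine ⟨I.map w.symm.toEmbedding, Finset.card_map _, ?_⟩
    rw [Finset.sum_map]
    refine Finset.sum_congr rfl fun i _ => ?_
    simp [sortDesc, ← hw]
  have hIn : I.card ≤ n := by simpa using I.card_le_univ
  have h2 : (Finset.univ.filter fun i : Fin n => i.val < I.card) =
      (Finset.univ : Finset (Fin I.card)).map (Fin.castLEEmb hIn) := by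
    ext i
    simp only [Finset.mem_filter, Finset.mem_univ, true_and, Finset.mem_map]
    exact ⟨fun hi => ⟨⟨i.val, hi⟩, rfl⟩, by rintro ⟨j, rfl⟩; exact j.2⟩
  have h3 : J = (Finset.univ : Finset (Fin I.card)).map (J.orderEmbOfFin hJ).toEmbedding := by
    apply Finset.coe_injective
    simp
  rw [h1, h2, Finset.sum_map, h3, Finset.sum_map]
  refine Finset.sum_le_sum fun i _ => hanti ?_
  have h4 : ∀ (k : ℕ) (hk : k < I.card), k ≤ (J.orderEmbOfFin hJ ⟨k, hk⟩).val := by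
    intro k
    induction k with
    | zero => exact fun _ => Nat.zero_le _
    | succ k ih =>
      intro hk
      have h5 := ih (by omega)
      have h6 : (J.orderEmbOfFin hJ ⟨k, by omega⟩).val < (J.orderEmbOfFin hJ ⟨k + 1, hk⟩).val :=
        (J.orderEmbOfFin hJ).strictMono (by simp)
      omega
  exact h4 i.val i.2

/-- The most dominant way to remove a horizontal strip of size `μ_n`: two consecutive rows
`lam_r ≥ μ_n ≥ lam_{r+1}` are merged into one row of length `lam_r + lam_{r+1} - μ_n`. -/
theorem SubsetDominates.exists_strip {lam : YoungDiagram} {n : ℕ} {μ : Fin (n + 1) → ℕ}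
    (h : SubsetDominates lam μ) :
    ∃ tau : YoungDiagram, IsStrip tau lam ∧ lam.card = tau.card + μ (Fin.last n) ∧
      SubsetDominates tau fun i : Fin n => μ i.castSucc := by
  set k := μ (Fin.last n) with hk
  have hzero : ∀ i, lam.colLen 0 ≤ i → lam.rowLen i = 0 := by
    intro i hi
    by_contra h0
    have h1 : (i, 0) ∈ lam := YoungDiagram.mem_iff_lt_rowLen.2 (by omega)
    have := YoungDiagram.mem_iff_lt_colLen.1 h1
    omega
  have hex : ∃ r, lam.rowLen (r + 1) ≤ k := ⟨lam.colLen 0, by rw [hzero _ (by omega)]; omega⟩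
  classical
  let r := Nat.find hex
  have hr1 : lam.rowLen (r + 1) ≤ k := Nat.find_spec hex
  have hr2 : k ≤ lam.rowLen r := by
    rcases Nat.eq_zero_or_pos r with h0 | h0
    · have := h {Fin.last n}
      rw [h0]
      simpa using this
    · have := Nat.find_min hex (m := r - 1) (by omega)
      rw [Nat.sub_add_cancel h0] at this
      omega
  -- the row lengths of the smaller diagram
  let ρ : ℕ → ℕ := fun i => if i < r then lam.rowLen i else
    if i = r then lam.rowLen r + lam.rowLen (r + 1) - k else lam.rowLen (i + 1)
  have hρ : ∀ i, lam.rowLen (i + 1) ≤ ρ i ∧ ρ i ≤ lam.rowLen i := by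
    intro i
    have := lam.rowLen_anti i (i + 1) (by omega)
    simp only [ρ]
    split_ifs with h1 h2
    · omega
    · subst h2
      omega
    · omega
  have hanti : ∀ i i', i ≤ i' → ρ i' ≤ ρ i := by
    intro i i' hii
    rcases hii.eq_or_lt with rfl | hlt
    · exact le_rfl
    · exact (hρ i').2.trans ((lam.rowLen_anti _ _ hlt).trans (hρ i).1)
  let tau : YoungDiagram :=
    { cells := lam.cells.filter fun b => b.2 < ρ b.1
      isLowerSet := by
        rintro ⟨i, j⟩ ⟨i', j'⟩ ⟨hi, hj⟩ hb
        simp only [Finset.coe_filter, YoungDiagram.mem_cells, Set.mem_ofPred_eq] at hb ⊢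
        change i' ≤ i at hi
        change j' ≤ j at hj
        exact ⟨lam.up_left_mem hi hj hb.1, (hj.trans_lt hb.2).trans_le (hanti _ _ hi)⟩ }
  have htau : ∀ i j, (i, j) ∈ tau ↔ j < ρ i := by
    intro i j
    rw [← YoungDiagram.mem_cells]
    simp only [tau, Finset.mem_filter, YoungDiagram.mem_cells, YoungDiagram.mem_iff_lt_rowLen]
    exact ⟨fun h => h.2, fun h => ⟨h.trans_le (hρ i).2, h⟩⟩
  have hrow : ∀ i, tau.rowLen i = ρ i := fun i => by
    refine eq_of_forall_lt_iff fun j => ?_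
    rw [← YoungDiagram.mem_iff_lt_rowLen, htau]
  have hle : tau ≤ lam := fun b hb =>
    YoungDiagram.mem_iff_lt_rowLen.2 (((htau b.1 b.2).1 hb).trans_le (hρ b.1).2)
  have hsmall : ∀ m, m ≤ r → ∑ i ∈ Finset.range m, ρ i = ∑ i ∈ Finset.range m, lam.rowLen i :=
    fun m hm => Finset.sum_congr rfl fun i hi => if_pos ((Finset.mem_range.1 hi).trans_le hm)
  have hlarge : ∀ m, ∑ i ∈ Finset.range (r + 1 + m), ρ i + k =
      ∑ i ∈ Finset.range (r + 1 + m + 1), lam.rowLen i := by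
    intro m
    induction m with
    | zero =>
      rw [add_zero, Finset.sum_range_succ, hsmall r le_rfl, Finset.sum_range_succ _ (r + 1),
        Finset.sum_range_succ]
      have : ρ r = lam.rowLen r + lam.rowLen (r + 1) - k := by simp [ρ]
      omega
    | succ m ih =>
      rw [← add_assoc, Finset.sum_range_succ, Finset.sum_range_succ _ (r + 1 + m + 1), ← ih]
      have : ρ (r + 1 + m) = lam.rowLen (r + 1 + m + 1) := by
        simp only [ρ]
        rw [if_neg (by omega), if_neg (by omega)]
      omega
  refine ⟨tau, ⟨hle, fun {i j} hij => ?_⟩, ?_, fun I => ?_⟩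
  · exact (htau _ _).2 ((YoungDiagram.mem_iff_lt_rowLen.1 hij).trans_le (hρ i).1)
  · rw [card_eq_sum_rowLen tau (M := r + 1 + (lam.colLen 0 + tau.colLen 0)) (by omega),
      card_eq_sum_rowLen lam (M := r + 1 + (lam.colLen 0 + tau.colLen 0) + 1) (by omega),
      ← hlarge]
    simp only [hrow]
  · simp only [hrow]
    -- at most `r` parts are bounded by the unchanged rows; for more parts, add `μ_n` to both sides
    rcases le_or_gt I.card r with hI | hI
    · rw [hsmall _ hI]
      have := h (I.map Fin.castSuccEmb)
      rw [Finset.card_map, Finset.sum_map] at this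
      exact this
    · obtain ⟨m, hm⟩ := Nat.exists_eq_add_of_le hI
      have hnot : Fin.last n ∉ I.map Fin.castSuccEmb := by
        simp [Fin.castSucc_ne_last]
      have := h (insert (Fin.last n) (I.map Fin.castSuccEmb))
      rw [Finset.card_insert_of_notMem hnot, Finset.sum_insert hnot, Finset.card_map,
        Finset.sum_map] at this
      have h2 := hlarge m
      rw [show r + 1 + m = I.card by omega] at h2
      simp only [Fin.coe_castSuccEmb] at this
      omega

end Dominance

/-! ### Tableaux as chains of shapes -/

section Tableaux

/-- A chain of shapes from the empty diagram to `lam` in which consecutive shapes differ by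
horizontal strips of sizes `μ_1, …, μ_n`. -/
structure ShapeChain (lam : YoungDiagram) {n : ℕ} (μ : Fin n → ℕ) (tau : ℕ → YoungDiagram) :
    Prop where
  zero : tau 0 = ⊥
  last : tau n = lam
  strip : ∀ i : Fin n, IsStrip (tau i.val) (tau (i.val + 1))
  card : ∀ i : Fin n, (tau (i.val + 1)).card = (tau i.val).card + μ i

variable {lam : YoungDiagram} {n : ℕ}

theorem ShapeChain.init {μ : Fin (n + 1) → ℕ} {tau : ℕ → YoungDiagram} (h : ShapeChain lam μ tau) :
    ShapeChain (tau n) (fun i : Fin n => μ i.castSucc) tau where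
  zero := h.zero
  last := rfl
  strip i := h.strip i.castSucc
  card i := h.card i.castSucc

theorem ShapeChain.strip_last {μ : Fin (n + 1) → ℕ} {tau : ℕ → YoungDiagram}
    (h : ShapeChain lam μ tau) : IsStrip (tau n) lam := by
  have := h.strip (Fin.last n)
  rwa [Fin.val_last, h.last] at this

theorem ShapeChain.card_last {μ : Fin (n + 1) → ℕ} {tau : ℕ → YoungDiagram}
    (h : ShapeChain lam μ tau) : lam.card = (tau n).card + μ (Fin.last n) := by
  have := h.card (Fin.last n)
  rwa [Fin.val_last, h.last] at this

theorem ShapeChain.congr {μ : Fin n → ℕ} {tau tau' : ℕ → YoungDiagram}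
    (h : ShapeChain lam μ tau) (heq : ∀ j ≤ n, tau' j = tau j) : ShapeChain lam μ tau' where
  zero := by rw [heq 0 (Nat.zero_le _), h.zero]
  last := by rw [heq n le_rfl, h.last]
  strip i := by
    rw [heq _ i.2.le, heq _ (Nat.succ_le_of_lt i.2)]
    exact h.strip i
  card i := by
    rw [heq _ i.2.le, heq _ (Nat.succ_le_of_lt i.2)]
    exact h.card i

theorem ShapeChain.card_eq_psum {μ : Fin n → ℕ} {tau : ℕ → YoungDiagram}
    (h : ShapeChain lam μ tau) : lam.card = ∑ i, μ i := by
  have : ∀ j ≤ n, (tau j).card = psum μ j := by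
    intro j
    induction j with
    | zero => intro _; rw [h.zero, psum_zero]; rfl
    | succ j ih =>
      intro hj
      rw [h.card ⟨j, hj⟩, ih (by omega)]
      exact (psum_succ μ ⟨j, hj⟩).symm
  rw [← psum_last, ← this n le_rfl, h.last]

/-- Appending one more shape at position `n + 1`. -/
theorem ShapeChain.snoc {tau' : YoungDiagram} {μ : Fin (n + 1) → ℕ} {tau : ℕ → YoungDiagram}
    (h : ShapeChain tau' (fun i : Fin n => μ i.castSucc) tau) (hs : IsStrip tau' lam)
    (hc : lam.card = tau'.card + μ (Fin.last n)) :
    ShapeChain lam μ (Function.update tau (n + 1) lam) := by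
  have hlt : ∀ j, j ≤ n → Function.update tau (n + 1) lam j = tau j := fun j hj =>
    Function.update_of_ne (by omega) _ _
  refine ⟨by rw [hlt 0 (Nat.zero_le _), h.zero], Function.update_self _ _ _, fun i => ?_,
    fun i => ?_⟩
  · induction i using Fin.lastCases with
    | last =>
      rw [Fin.val_last, Function.update_self, hlt n le_rfl, h.last]
      exact hs
    | cast i =>
      rw [Fin.val_castSucc, hlt _ i.2.le, hlt _ i.2]
      exact h.strip i
  · induction i using Fin.lastCases with
    | last =>
      rw [Fin.val_last, Function.update_self, hlt n le_rfl, h.last]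
      exact hc
    | cast i =>
      rw [Fin.val_castSucc, hlt _ i.2.le, hlt _ i.2]
      exact h.card i

/-- The prescribed numbers of entries `1, …, n` add up to the number of boxes, so no other entry
occurs. -/
theorem Std.entry_mem {μ : Fin n → ℕ} (hsum : ∑ i, μ i = lam.card) (S : Std lam μ) {i j : ℕ}
    (h : (i, j) ∈ lam) : 1 ≤ S.1 i j ∧ S.1 i j ≤ n := by
  have hsub : (Finset.univ : Finset (Fin n)).biUnion
      (fun m => lam.cells.filter fun c => S.1 c.1 c.2 = m.val + 1) ⊆ lam.cells :=
    Finset.biUnion_subset.2 fun m _ => Finset.filter_subset _ _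
  have hcard : ((Finset.univ : Finset (Fin n)).biUnion
      (fun m => lam.cells.filter fun c => S.1 c.1 c.2 = m.val + 1)).card = lam.cells.card := by
    rw [Finset.card_biUnion]
    · rw [Finset.sum_congr rfl fun m _ => S.2 m, hsum]
    · intro m _ m' _ hm
      refine Finset.disjoint_filter.2 fun c _ h1 h2 => hm (Fin.ext ?_)
      omega
  have heq := Finset.eq_of_subset_of_card_le hsub hcard.ge
  have h1 : (i, j) ∈ lam.cells := h
  rw [← heq, Finset.mem_biUnion] at h1
  obtain ⟨m, -, hm⟩ := h1
  have := (Finset.mem_filter.1 hm).2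
  have := m.2
  simp only at *
  omega

theorem Std.shapeChain {μ : Fin n → ℕ} (hsum : ∑ i, μ i = lam.card) (S : Std lam μ) :
    ShapeChain lam μ (sublevel S.1) where
  zero := by
    refine SetLike.ext fun ⟨i, j⟩ => ?_
    rw [mem_sublevel]
    refine ⟨fun h => ?_, fun h => (YoungDiagram.notMem_bot _ h).elim⟩
    have := Std.entry_mem hsum S h.1
    omega
  last := by
    refine SetLike.ext fun ⟨i, j⟩ => ?_
    rw [mem_sublevel]
    exact ⟨fun h => h.1, fun h => ⟨h, (Std.entry_mem hsum S h).2⟩⟩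
  strip m := by
    refine ⟨fun ⟨i, j⟩ h => ?_, fun {i j} h => ?_⟩
    · rw [mem_sublevel] at h ⊢
      exact ⟨h.1, by omega⟩
    · rw [mem_sublevel] at h ⊢
      have : S.1 i j < S.1 (i + 1) j := S.1.col_strict (Nat.lt_succ_self i) h.1
      exact ⟨lam.up_left_mem (Nat.le_succ i) le_rfl h.1, by omega⟩
  card m := by
    rw [← S.2 m]
    change (sublevel S.1 _).cells.card = (sublevel S.1 _).cells.card + _
    rw [sublevel, sublevel, ← Finset.card_union_of_disjoint]
    · congr 1
      ext b
      simp only [Finset.mem_filter, Finset.mem_union]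
      have : S.1 b.1 b.2 ≤ m.val + 1 ↔ S.1 b.1 b.2 ≤ m.val ∨ S.1 b.1 b.2 = m.val + 1 := by omega
      rw [this, and_or_left]
    · refine Finset.disjoint_filter.2 fun c _ h1 h2 => ?_
      omega

theorem Std.ext_sublevel {μ : Fin n → ℕ} (hsum : ∑ i, μ i = lam.card) {S S' : Std lam μ}
    (h : ∀ j ≤ n, sublevel S.1 j = sublevel S'.1 j) : S = S' := by
  refine Subtype.ext (SemistandardYoungTableau.ext fun i j => ?_)
  by_cases hij : (i, j) ∈ lam
  · have h1 := Std.entry_mem hsum S hij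
    have h2 := Std.entry_mem hsum S' hij
    have h3 : ∀ m ≤ n, S.1 i j ≤ m ↔ S'.1 i j ≤ m := fun m hm => by
      have : (i, j) ∈ sublevel S.1 m ↔ (i, j) ∈ sublevel S'.1 m := by rw [h m hm]
      simpa [mem_sublevel, hij] using this
    have h4 := (h3 _ h1.2).1 le_rfl
    have h5 := (h3 _ h2.2).2 le_rfl
    omega
  · rw [S.1.zeros hij, S'.1.zeros hij]

theorem sublevel_restrict (S : SemistandardYoungTableau lam) {j m : ℕ} (hj : j ≤ m) :
    sublevel (restrict S m) j = sublevel S j := by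
  refine SetLike.ext fun ⟨a, b⟩ => ?_
  rw [mem_sublevel (restrict S m), mem_sublevel S j]
  have h1 : (restrict S m) a b = if (a, b) ∈ sublevel S m then S a b else 0 := rfl
  rw [h1]
  constructor
  · rintro ⟨h2, h3⟩
    rw [if_pos h2] at h3
    exact ⟨((mem_sublevel S m).1 h2).1, h3⟩
  · rintro ⟨h2, h3⟩
    have h4 := (mem_sublevel S m).2 ⟨h2, h3.trans hj⟩
    exact ⟨h4, by rwa [if_pos h4]⟩

/-- The tableau whose entries `≤ j` form the `j`-th shape of a chain. -/
theorem ShapeChain.exists_std {μ : Fin n → ℕ} {tau : ℕ → YoungDiagram}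
    (h : ShapeChain lam μ tau) : ∃ S : Std lam μ, ∀ j ≤ n, sublevel S.1 j = tau j := by
  classical
  have hmono : ∀ j k, j ≤ k → k ≤ n → tau j ≤ tau k := by
    intro j k hjk
    induction k, hjk using Nat.le_induction with
    | base => exact fun _ => le_rfl
    | succ k _ ih => exact fun hk => (ih (by omega)).trans (h.strip ⟨k, hk⟩).le
  have hex : ∀ i j, (i, j) ∈ lam → ∃ m, m ≤ n ∧ (i, j) ∈ tau m := fun i j hij =>
    ⟨n, le_rfl, by rwa [h.last]⟩
  let ent : ℕ → ℕ → ℕ := fun i j => if hij : (i, j) ∈ lam then Nat.find (hex i j hij) else 0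
  have hent : ∀ i j, (i, j) ∈ lam → ∀ m ≤ n, ent i j ≤ m ↔ (i, j) ∈ tau m := by
    intro i j hij m hm
    simp only [ent, dif_pos hij]
    constructor
    · intro hle
      exact hmono _ _ hle hm (Nat.find_spec (hex i j hij)).2
    · intro hmem
      exact Nat.find_min' _ ⟨hm, hmem⟩
  have hle : ∀ i j, (i, j) ∈ lam → ent i j ≤ n := fun i j hij =>
    (hent i j hij n le_rfl).2 (by rwa [h.last])
  have hpos : ∀ i j, (i, j) ∈ lam → 0 < ent i j := by
    intro i j hij
    by_contra h0
    have := (hent i j hij 0 (Nat.zero_le _)).1 (by omega)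
    rw [h.zero] at this
    exact YoungDiagram.notMem_bot _ this
  let S : SemistandardYoungTableau lam :=
    { entry := ent
      row_weak' := by
        intro i j1 j2 hj hc
        have hc1 := lam.up_left_mem le_rfl hj.le hc
        exact (hent _ _ hc1 _ (hle _ _ hc)).2
          ((tau _).up_left_mem le_rfl hj.le ((hent _ _ hc _ (hle _ _ hc)).1 le_rfl))
      col_strict' := by
        intro i1 i2 j hi hc
        have hc1 := lam.up_left_mem hi.le le_rfl hc
        have h1 := hpos _ _ hc
        have h2 := hle _ _ hc
        have h3 := (hent _ _ hc _ h2).1 le_rfl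
        have h4 := (h.strip ⟨ent i2 j - 1, by omega⟩).mem_of_below (i := i1) (j := j)
        simp only [Nat.sub_add_cancel h1] at h4
        have h5 := (hent _ _ hc1 (ent i2 j - 1) (by omega)).2
          (h4 ((tau _).up_left_mem hi le_rfl h3))
        omega
      zeros' := fun hij => dif_neg hij }
  have hS : ∀ j ≤ n, sublevel S j = tau j := by
    intro m hm
    refine SetLike.ext fun ⟨i, j⟩ => ?_
    rw [mem_sublevel]
    constructor
    · rintro ⟨h1, h2⟩
      exact (hent i j h1 m hm).1 h2
    · intro h1
      have h2 : (i, j) ∈ lam := h.last ▸ hmono m n hm le_rfl h1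
      exact ⟨h2, (hent i j h2 m hm).2 h1⟩
  refine ⟨⟨S, fun m => ?_⟩, hS⟩
  have h1 := h.card m
  rw [← hS _ m.2.le, ← hS _ (Nat.succ_le_of_lt m.2)] at h1
  change (sublevel S _).cells.card = (sublevel S _).cells.card + _ at h1
  rw [← Nat.add_left_cancel_iff, ← h1, sublevel, sublevel, ← Finset.card_union_of_disjoint]
  · congr 1
    ext b
    simp only [Finset.mem_filter, Finset.mem_union]
    have : S b.1 b.2 ≤ m.val + 1 ↔ S b.1 b.2 ≤ m.val ∨ S b.1 b.2 = m.val + 1 := by omega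
    rw [this, and_or_left]
  · refine Finset.disjoint_filter.2 fun c _ h1 h2 => ?_
    omega

end Tableaux

/-! ### Coordinates with respect to boxes -/

section Coordinates

variable {lam tau : YoungDiagram}

/-- The box in row `r` and column `c`. -/
def bx {r c : ℕ} (h : (r, c) ∈ lam) : Box lam := ⟨toLex (r, c), h⟩

@[simp] theorem row_bx {r c : ℕ} (h : (r, c) ∈ lam) : (bx h).row = r := rfl

@[simp] theorem col_bx {r c : ℕ} (h : (r, c) ∈ lam) : (bx h).col = c := rfl

theorem Box.mem (b : Box lam) : (b.row, b.col) ∈ lam := b.2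

theorem bx_congr {r c r' c' : ℕ} (h : (r, c) ∈ lam) (h' : (r', c') ∈ lam) :
    bx h = bx h' ↔ r = r' ∧ c = c' := by
  constructor
  · intro he
    exact ⟨congrArg Box.row he, congrArg Box.col he⟩
  · rintro ⟨rfl, rfl⟩
    rfl

open Classical in
/-- The coordinate of a vector at the box in row `r` and column `c`; it is zero if there is no
such box. -/
def co (lam : YoungDiagram) (r c : ℕ) : (Box lam → ℂ) →ₗ[ℂ] ℂ :=
  if h : (r, c) ∈ lam then LinearMap.proj (bx h) else 0

theorem co_of_mem {r c : ℕ} (h : (r, c) ∈ lam) (v : Box lam → ℂ) : co lam r c v = v (bx h) := by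
  simp [co, h]

theorem co_of_notMem {r c : ℕ} (h : (r, c) ∉ lam) (v : Box lam → ℂ) : co lam r c v = 0 := by
  simp [co, h]

@[simp] theorem co_row_col (b : Box lam) (v : Box lam → ℂ) : co lam b.row b.col v = v b :=
  co_of_mem b.mem v

theorem ext_co {v w : Box lam → ℂ} (h : ∀ r c, (r, c) ∈ lam → co lam r c v = co lam r c w) :
    v = w := by
  funext b
  rw [← co_row_col b v, ← co_row_col b w]
  exact h _ _ b.mem

theorem nilp_stdVec (b : Box lam) : nilp lam (stdVec b) =
    if h : (b.row + 1, b.col) ∈ lam then stdVec (bx h) else 0 := by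
  have : stdVec b = Pi.basisFun ℂ (Box lam) b := by
    rw [Pi.basisFun_apply]
    unfold stdVec
    congr
  rw [this, nilp, Module.Basis.constr_basis]
  rfl

theorem co_stdVec {r c : ℕ} (b : Box lam) :
    co lam r c (stdVec b) = if r = b.row ∧ c = b.col then 1 else 0 := by
  by_cases h : (r, c) ∈ lam
  · rw [co_of_mem h, stdVec, Pi.single_apply]
    exact if_congr (bx_congr h b.mem) rfl rfl
  · rw [co_of_notMem h, if_neg]
    rintro ⟨rfl, rfl⟩
    exact h b.mem

theorem eq_sum_stdVec (v : Box lam → ℂ) : v = ∑ b, v b • stdVec b := by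
  have := pi_eq_sum_univ v
  conv_lhs => rw [this]
  refine Finset.sum_congr rfl fun b _ => ?_
  congr 1
  funext b'
  simp [stdVec, Pi.single_apply, eq_comm]

theorem co_nilp_zero (c : ℕ) (v : Box lam → ℂ) : co lam 0 c (nilp lam v) = 0 := by
  rw [eq_sum_stdVec v]
  simp only [map_sum, map_smul, nilp_stdVec]
  refine Finset.sum_eq_zero fun b _ => ?_
  split_ifs
  · rw [co_stdVec, if_neg (by simp), smul_zero]
  · simp

theorem co_nilp_succ {r c : ℕ} (h : (r + 1, c) ∈ lam) (v : Box lam → ℂ) :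
    co lam (r + 1) c (nilp lam v) = co lam r c v := by
  conv_lhs => rw [eq_sum_stdVec v]
  simp only [map_sum, map_smul, nilp_stdVec]
  have h0 := lam.up_left_mem (Nat.le_succ r) le_rfl h
  rw [Finset.sum_eq_single (bx h0)]
  · rw [dif_pos (show ((bx h0).row + 1, (bx h0).col) ∈ lam from h), co_stdVec, co_of_mem h0]
    simp
  · intro b _ hb
    split_ifs with h1
    · rw [co_stdVec, if_neg, smul_zero]
      rintro ⟨h2, h3⟩
      simp only [row_bx, col_bx, add_left_inj] at h2 h3
      exact hb ((bx_congr b.mem h0).2 ⟨h2.symm, h3.symm⟩)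
    · simp
  · simp

theorem co_nilp_pow_add (i : ℕ) {r c : ℕ} (h : (r + i, c) ∈ lam) (v : Box lam → ℂ) :
    co lam (r + i) c ((nilp lam ^ i) v) = co lam r c v := by
  induction i with
  | zero => rfl
  | succ i ih =>
    rw [pow_succ', Module.End.mul_apply, ← add_assoc, co_nilp_succ (by rwa [add_assoc])]
    exact ih (lam.up_left_mem (by omega) le_rfl h)

theorem co_nilp_pow_lt (i : ℕ) {r c : ℕ} (h : r < i) (v : Box lam → ℂ) :
    co lam r c ((nilp lam ^ i) v) = 0 := by
  by_cases hm : (r, c) ∈ lam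
  · obtain ⟨k, rfl⟩ := Nat.exists_eq_add_of_lt h
    have h1 := co_nilp_pow_add r (r := 0) (c := c) (by rwa [zero_add])
      ((nilp lam ^ (k + 1)) v)
    rw [zero_add, ← Module.End.mul_apply, ← pow_add, ← add_assoc] at h1
    rw [h1, pow_succ', Module.End.mul_apply, co_nilp_zero]
  · exact co_of_notMem hm _

/-- The vectors whose coordinates in the top row vanish in the columns `γ`. -/
def topZero (lam : YoungDiagram) (γ : Finset ℕ) : Submodule ℂ (Box lam → ℂ) :=
  ⨅ c ∈ γ, LinearMap.ker (co lam 0 c)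

theorem mem_topZero {γ : Finset ℕ} {v : Box lam → ℂ} :
    v ∈ topZero lam γ ↔ ∀ c ∈ γ, co lam 0 c v = 0 := by
  simp [topZero, Submodule.mem_iInf]

theorem mem_range_nilp {v : Box lam → ℂ} :
    v ∈ LinearMap.range (nilp lam) ↔ ∀ c, co lam 0 c v = 0 := by
  constructor
  · rintro ⟨u, rfl⟩ c
    exact co_nilp_zero c u
  · intro h
    refine ⟨fun b => co lam (b.row + 1) b.col v, ext_co fun r c hrc => ?_⟩
    cases r with
    | zero => rw [co_nilp_zero, h]
    | succ r =>
      rw [co_nilp_succ hrc, co_of_mem (lam.up_left_mem (Nat.le_succ r) le_rfl hrc)]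
      rfl

end Coordinates

/-! ### Jordan types -/

section JordanType

variable {lam tau : YoungDiagram}

/-- The subspaces on which `x^lam` has Jordan type `tau^T` are the images of the embeddings
`ℂ^tau → ℂ^lam` that intertwine the nilpotents. -/
theorem hasJordanType_iff {E : Submodule ℂ (Box lam → ℂ)} :
    HasJordanType E tau ↔ ∃ B : (Box tau → ℂ) →ₗ[ℂ] (Box lam → ℂ), Function.Injective B ∧
      (∀ u, B (nilp tau u) = nilp lam (B u)) ∧ LinearMap.range B = E := by
  constructor
  · rintro ⟨θ, hE, hθ⟩
    refine ⟨E.subtype.comp θ.symm.toLinearMap, E.injective_subtype.comp θ.symm.injective,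
      fun u => ?_, ?_⟩
    · obtain ⟨v, rfl⟩ := θ.surjective u
      rw [← hθ]
      simp
    · rw [LinearMap.range_comp, LinearEquiv.range, Submodule.map_subtype_top]
  · rintro ⟨B, hB, hx, rfl⟩
    refine ⟨(LinearEquiv.ofInjective B hB).symm, ?_, ?_⟩
    · rintro _ ⟨u, rfl⟩
      exact ⟨nilp tau u, hx u⟩
    · rintro ⟨_, u, rfl⟩
      rw [LinearEquiv.symm_apply_eq]
      refine Subtype.ext ?_
      have h1 : (⟨B u, ⟨u, rfl⟩⟩ : LinearMap.range B) = LinearEquiv.ofInjective B hB u := rfl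
      rw [h1, LinearEquiv.symm_apply_apply]
      exact (hx u).symm

theorem HasJordanType.map {lam' : YoungDiagram} {E : Submodule ℂ (Box lam → ℂ)}
    (h : HasJordanType E tau) {L : (Box lam → ℂ) →ₗ[ℂ] (Box lam' → ℂ)}
    (hL : Set.InjOn L E) (hx : ∀ v, L (nilp lam v) = nilp lam' (L v)) :
    HasJordanType (E.map L) tau := by
  obtain ⟨B, hB, hBx, rfl⟩ := hasJordanType_iff.1 h
  refine hasJordanType_iff.2 ⟨L.comp B, fun u v huv => ?_, fun u => ?_, LinearMap.range_comp _ _⟩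
  · exact hB (hL ⟨u, rfl⟩ ⟨v, rfl⟩ huv)
  · rw [LinearMap.comp_apply, hBx, hx, LinearMap.comp_apply]

theorem hasJordanType_top : HasJordanType (⊤ : Submodule ℂ (Box lam → ℂ)) lam :=
  hasJordanType_iff.2 ⟨LinearMap.id, Function.injective_id, fun _ => rfl, LinearMap.range_id⟩

theorem card_box_eq (P : ℕ → Prop) [DecidablePred P] :
    Fintype.card {b : Box lam // P b.row} = (lam.cells.filter fun b => P b.1).card := by
  rw [← Fintype.card_coe]
  refine Fintype.card_congr ⟨fun b => ⟨ofLex b.1.1, Finset.mem_filter.2 ⟨b.1.2, b.2⟩⟩,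
    fun b => ⟨⟨toLex b.1, (Finset.mem_filter.1 b.2).1⟩, (Finset.mem_filter.1 b.2).2⟩,
    fun _ => rfl, fun _ => rfl⟩

theorem card_box (lam : YoungDiagram) : Fintype.card (Box lam) = lam.card := by
  change _ = Finset.card _
  rw [← Fintype.card_coe]
  exact Fintype.card_congr ⟨fun b => ⟨ofLex b.1, b.2⟩, fun b => ⟨toLex b.1, b.2⟩,
    fun _ => rfl, fun _ => rfl⟩

theorem finrank_ker_nilp_pow (tau : YoungDiagram) (i : ℕ) :
    (tau.cells.filter fun b => i ≤ b.1).card +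
      Module.finrank ℂ (LinearMap.ker (nilp tau ^ i)) = tau.card := by
  let R : (Box tau → ℂ) →ₗ[ℂ] ({b : Box tau // i ≤ b.row} → ℂ) :=
    LinearMap.pi fun b => co tau (b.1.row - i) b.1.col
  have hR : Function.Surjective R := by
    intro u
    refine ⟨fun b => if h : (b.row + i, b.col) ∈ tau then u ⟨bx h, Nat.le_add_left _ _⟩ else 0, ?_⟩
    funext ⟨b, hb⟩
    have h1 : (b.row - i, b.col) ∈ tau := tau.up_left_mem (Nat.sub_le _ _) le_rfl b.mem
    change co tau (b.row - i) b.col _ = _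
    rw [co_of_mem h1]
    have h2 : (b.row - i + i, b.col) ∈ tau := by
      rw [Nat.sub_add_cancel hb]
      exact b.mem
    refine (dif_pos h2).trans (congrArg u (Subtype.ext ?_))
    exact (bx_congr h2 b.mem).2 ⟨Nat.sub_add_cancel hb, rfl⟩
  have hker : LinearMap.ker R = LinearMap.ker (nilp tau ^ i) := by
    ext v
    simp only [LinearMap.mem_ker]
    constructor
    · intro h
      refine ext_co fun r c hrc => ?_
      rw [map_zero]
      rcases lt_or_ge r i with hlt | hge
      · exact co_nilp_pow_lt i hlt v
      · obtain ⟨k, rfl⟩ := Nat.exists_eq_add_of_le hge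
        rw [add_comm i k, co_nilp_pow_add i (by rwa [add_comm k i])]
        have := congrFun h ⟨bx hrc, hge⟩
        simpa [R] using this
    · intro h
      funext ⟨b, hb⟩
      change co tau (b.row - i) b.col v = 0
      rw [← co_nilp_pow_add i (by rw [Nat.sub_add_cancel hb]; exact b.mem), h, map_zero]
  have := LinearMap.finrank_range_add_finrank_ker R
  rwa [hker, LinearMap.range_eq_top.2 hR, finrank_top, Module.finrank_fintype_fun_eq_card,
    Module.finrank_fintype_fun_eq_card, card_box, card_box_eq (fun r => i ≤ r)] at this

theorem nilp_pow_comm {B : (Box tau → ℂ) →ₗ[ℂ] (Box lam → ℂ)}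
    (hx : ∀ u, B (nilp tau u) = nilp lam (B u)) (i : ℕ) (u : Box tau → ℂ) :
    B ((nilp tau ^ i) u) = (nilp lam ^ i) (B u) := by
  induction i with
  | zero => rfl
  | succ i ih => rw [pow_succ', pow_succ', Module.End.mul_apply, Module.End.mul_apply, hx, ih]

/-- The Jordan type `tau^T` is determined by the dimensions of the kernels of the powers. -/
theorem HasJordanType.finrank_inf_ker {E : Submodule ℂ (Box lam → ℂ)}
    (h : HasJordanType E tau) (i : ℕ) :
    (tau.cells.filter fun b => i ≤ b.1).card +
      Module.finrank ℂ (E ⊓ LinearMap.ker (nilp lam ^ i) : Submodule ℂ (Box lam → ℂ)) =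
      tau.card := by
  obtain ⟨B, hB, hx, rfl⟩ := hasJordanType_iff.1 h
  have hmap : LinearMap.range B ⊓ LinearMap.ker (nilp lam ^ i) =
      (LinearMap.ker (nilp tau ^ i)).map B := by
    ext v
    simp only [Submodule.mem_inf, LinearMap.mem_range, LinearMap.mem_ker, Submodule.mem_map]
    constructor
    · rintro ⟨⟨u, rfl⟩, hu⟩
      rw [← nilp_pow_comm hx, map_eq_zero_iff B hB] at hu
      exact ⟨u, hu, rfl⟩
    · rintro ⟨u, hu, rfl⟩
      exact ⟨⟨u, rfl⟩, by rw [← nilp_pow_comm hx, hu, map_zero]⟩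
  rw [← finrank_ker_nilp_pow tau i, hmap,
    LinearEquiv.finrank_eq (Submodule.equivMapOfInjective B hB _)]

theorem finrank_range_of_injective {B : (Box tau → ℂ) →ₗ[ℂ] (Box lam → ℂ)}
    (hB : Function.Injective B) : Module.finrank ℂ (LinearMap.range B) = tau.card := by
  rw [LinearMap.finrank_range_of_inj hB, Module.finrank_fintype_fun_eq_card, card_box]

theorem HasJordanType.finrank_eq {E : Submodule ℂ (Box lam → ℂ)} (h : HasJordanType E tau) :
    Module.finrank ℂ E = tau.card := by
  obtain ⟨B, hB, hx, rfl⟩ := hasJordanType_iff.1 h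
  exact finrank_range_of_injective hB

/-- A diagram is determined by the numbers of boxes in its rows from the `i`-th on. -/
theorem eq_of_card_filter_eq {tau tau' : YoungDiagram}
    (h : ∀ i, (tau.cells.filter fun b => i ≤ b.1).card =
      (tau'.cells.filter fun b => i ≤ b.1).card) : tau = tau' := by
  have hrow : ∀ (ν : YoungDiagram) i, (ν.cells.filter fun b => i ≤ b.1).card =
      (ν.cells.filter fun b => i + 1 ≤ b.1).card + ν.rowLen i := by
    intro ν i
    rw [YoungDiagram.rowLen_eq_card, YoungDiagram.row, ← Finset.card_union_of_disjoint]
    · congr 1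
      ext b
      simp only [Finset.mem_filter, Finset.mem_union]
      have : i ≤ b.1 ↔ i + 1 ≤ b.1 ∨ b.1 = i := by omega
      rw [this, and_or_left]
    · refine Finset.disjoint_filter.2 fun c _ h1 h2 => ?_
      omega
  refine SetLike.ext fun ⟨i, j⟩ => ?_
  have h1 := hrow tau i
  have h2 := hrow tau' i
  rw [h i, h (i + 1)] at h1
  rw [YoungDiagram.mem_iff_lt_rowLen, YoungDiagram.mem_iff_lt_rowLen]
  omega

theorem HasJordanType.unique {tau' : YoungDiagram} {E : Submodule ℂ (Box lam → ℂ)}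
    (h : HasJordanType E tau) (h' : HasJordanType E tau') : tau = tau' := by
  refine eq_of_card_filter_eq fun i => ?_
  have h1 := h.finrank_inf_ker i
  have h2 := h'.finrank_inf_ker i
  have h3 := h.finrank_eq
  have h4 := h'.finrank_eq
  omega

end JordanType

/-! ### Hyperplane sections containing the image of the nilpotent -/

section StripEmb

variable {lam tau : YoungDiagram}

theorem co_pi {f : Box lam → (Box tau → ℂ) →ₗ[ℂ] ℂ} {r c : ℕ} (h : (r, c) ∈ lam)
    (v : Box tau → ℂ) : co lam r c (LinearMap.pi f v) = f (bx h) v := by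
  rw [co_of_mem h]
  rfl

/-- The embedding `ℂ^tau → ℂ^lam` which shifts the columns containing a box of the strip
`lam / tau` down by one. -/
def stripEmb (tau lam : YoungDiagram) : (Box tau → ℂ) →ₗ[ℂ] (Box lam → ℂ) :=
  LinearMap.pi fun b => if b.col ∈ stripCols tau lam then
    (if b.row = 0 then 0 else co tau (b.row - 1) b.col) else co tau b.row b.col

theorem co_stripEmb_of_notMem {r c : ℕ} (hc : c ∉ stripCols tau lam) (h : (r, c) ∈ lam)
    (u : Box tau → ℂ) : co lam r c (stripEmb tau lam u) = co tau r c u := by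
  rw [stripEmb, co_pi h]
  simp [hc]

theorem co_stripEmb_zero {c : ℕ} (hc : c ∈ stripCols tau lam) (u : Box tau → ℂ) :
    co lam 0 c (stripEmb tau lam u) = 0 := by
  rw [stripEmb, co_pi (top_mem_of_mem_stripCols hc)]
  simp [hc]

theorem co_stripEmb_succ {r c : ℕ} (hc : c ∈ stripCols tau lam) (h : (r + 1, c) ∈ lam)
    (u : Box tau → ℂ) : co lam (r + 1) c (stripEmb tau lam u) = co tau r c u := by
  rw [stripEmb, co_pi h]
  simp [hc]

theorem IsStrip.injective_stripEmb (h : IsStrip tau lam) :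
    Function.Injective (stripEmb tau lam) := by
  refine (injective_iff_map_eq_zero _).2 fun u hu => ext_co fun r c hrc => ?_
  rw [map_zero]
  by_cases hc : c ∈ stripCols tau lam
  · rw [← co_stripEmb_succ hc ((h.mem_iff_below hc r).1 hrc), hu, map_zero]
  · rw [← co_stripEmb_of_notMem hc (h.le hrc), hu, map_zero]

theorem IsStrip.range_stripEmb (h : IsStrip tau lam) :
    LinearMap.range (stripEmb tau lam) = topZero lam (stripCols tau lam) := by
  ext v
  rw [mem_topZero]
  constructor
  · rintro ⟨u, rfl⟩ c hc
    exact co_stripEmb_zero hc u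
  · intro hv
    refine ⟨fun b => if b.col ∈ stripCols tau lam then co lam (b.row + 1) b.col v else
      co lam b.row b.col v, ext_co fun r c hrc => ?_⟩
    by_cases hc : c ∈ stripCols tau lam
    · cases r with
      | zero => rw [co_stripEmb_zero hc, hv c hc]
      | succ r =>
        rw [co_stripEmb_succ hc hrc, co_of_mem ((h.mem_iff_below hc r).2 hrc)]
        simp [hc]
    · rw [co_stripEmb_of_notMem hc hrc,
        co_of_mem ((mem_iff_of_notMem_stripCols h.le hc r).2 hrc)]
      simp [hc]

theorem IsStrip.stripEmb_nilp (h : IsStrip tau lam) (u : Box tau → ℂ) :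
    stripEmb tau lam (nilp tau u) = nilp lam (stripEmb tau lam u) := by
  refine ext_co fun r c hrc => ?_
  by_cases hc : c ∈ stripCols tau lam
  · cases r with
    | zero => rw [co_stripEmb_zero hc, co_nilp_zero]
    | succ r =>
      rw [co_stripEmb_succ hc hrc, co_nilp_succ hrc]
      cases r with
      | zero => rw [co_nilp_zero, co_stripEmb_zero hc]
      | succ r =>
        rw [co_nilp_succ ((h.mem_iff_below hc _).2 hrc),
          co_stripEmb_succ hc (lam.up_left_mem (Nat.le_succ _) le_rfl hrc)]
  · rw [co_stripEmb_of_notMem hc hrc]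
    cases r with
    | zero => rw [co_nilp_zero, co_nilp_zero]
    | succ r =>
      rw [co_nilp_succ hrc, co_nilp_succ ((mem_iff_of_notMem_stripCols h.le hc _).2 hrc),
        co_stripEmb_of_notMem hc (lam.up_left_mem (Nat.le_succ _) le_rfl hrc)]

theorem IsStrip.hasJordanType (h : IsStrip tau lam) :
    HasJordanType (topZero lam (stripCols tau lam)) tau :=
  hasJordanType_iff.2 ⟨_, h.injective_stripEmb, h.stripEmb_nilp, h.range_stripEmb⟩

end StripEmb

/-! ### Automorphisms commuting with the nilpotent: shears and column permutations -/

section Shear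

variable {lam : YoungDiagram}

/-- The transpose of the matrix `g(U)`: in every row of boxes, the coordinates `a c j` times the
coordinates in the columns `j ∉ γ` to the left of `c ∈ γ` are added to the coordinate in the
column `c`. -/
def shear (lam : YoungDiagram) (γ : Finset ℕ) (a : ℕ → ℕ → ℂ) :
    (Box lam → ℂ) →ₗ[ℂ] (Box lam → ℂ) :=
  LinearMap.pi fun b => co lam b.row b.col +
    if b.col ∈ γ then ∑ j ∈ (Finset.range b.col).filter (· ∉ γ), a b.col j • co lam b.row j else 0

theorem co_shear (γ : Finset ℕ) (a : ℕ → ℕ → ℂ) {r c : ℕ} (h : (r, c) ∈ lam) (v : Box lam → ℂ) :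
    co lam r c (shear lam γ a v) = co lam r c v +
      if c ∈ γ then ∑ j ∈ (Finset.range c).filter (· ∉ γ), a c j * co lam r j v else 0 := by
  rw [shear, co_pi h, row_bx, col_bx]
  split_ifs with hc
  · simp
  · simp

theorem co_shear_of_notMem {γ : Finset ℕ} (a : ℕ → ℕ → ℂ) (r : ℕ) {c : ℕ} (hc : c ∉ γ)
    (v : Box lam → ℂ) : co lam r c (shear lam γ a v) = co lam r c v := by
  by_cases h : (r, c) ∈ lam
  · rw [co_shear γ a h, if_neg hc, add_zero]
  · rw [co_of_notMem h, co_of_notMem h]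

theorem shear_neg_shear (γ : Finset ℕ) (a : ℕ → ℕ → ℂ) (v : Box lam → ℂ) :
    shear lam γ (-a) (shear lam γ a v) = v := by
  refine ext_co fun r c h => ?_
  rw [co_shear γ _ h, co_shear γ _ h]
  split_ifs with hc
  · rw [add_assoc, ← Finset.sum_add_distrib, Finset.sum_eq_zero, add_zero]
    intro j hj
    rw [co_shear_of_notMem _ _ (Finset.mem_filter.1 hj).2]
    simp
  · simp

theorem shear_shear_neg (γ : Finset ℕ) (a : ℕ → ℕ → ℂ) (v : Box lam → ℂ) :
    shear lam γ a (shear lam γ (-a) v) = v := by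
  have := shear_neg_shear γ (-a) v
  rwa [neg_neg] at this

theorem injective_shear (γ : Finset ℕ) (a : ℕ → ℕ → ℂ) : Function.Injective (shear lam γ a) :=
  Function.LeftInverse.injective (shear_neg_shear γ a)

theorem shear_nilp (γ : Finset ℕ) (a : ℕ → ℕ → ℂ) (v : Box lam → ℂ) :
    shear lam γ a (nilp lam v) = nilp lam (shear lam γ a v) := by
  refine ext_co fun r c h => ?_
  cases r with
  | zero =>
    rw [co_nilp_zero, co_shear γ a h, co_nilp_zero, zero_add]
    split_ifs
    · exact Finset.sum_eq_zero fun j _ => by rw [co_nilp_zero, mul_zero]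
    · rfl
  | succ r =>
    rw [co_nilp_succ h, co_shear γ a h, co_nilp_succ h,
      co_shear γ a (lam.up_left_mem (Nat.le_succ r) le_rfl h)]
    congr 1
    split_ifs
    · refine Finset.sum_congr rfl fun j hj => ?_
      rw [co_nilp_succ (lam.up_left_mem le_rfl
        (Finset.mem_range.1 (Finset.mem_filter.1 hj).1).le h)]
    · rfl

theorem shear_zero (γ : Finset ℕ) (v : Box lam → ℂ) : shear lam γ 0 v = v := by
  refine ext_co fun r c h => ?_
  rw [co_shear γ _ h]
  simp

end Shear

section ColPerm

variable {lam : YoungDiagram}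

/-- The permutation of coordinates induced by a permutation of the columns. -/
def colPerm (lam : YoungDiagram) (w : Equiv.Perm ℕ) : (Box lam → ℂ) →ₗ[ℂ] (Box lam → ℂ) :=
  LinearMap.pi fun b => co lam b.row (w b.col)

theorem mem_perm_iff {w : Equiv.Perm ℕ} (hw : ∀ c, lam.colLen (w c) = lam.colLen c) (r c : ℕ) :
    (r, w c) ∈ lam ↔ (r, c) ∈ lam := by
  rw [YoungDiagram.mem_iff_lt_colLen, YoungDiagram.mem_iff_lt_colLen, hw]

theorem co_colPerm {w : Equiv.Perm ℕ} (hw : ∀ c, lam.colLen (w c) = lam.colLen c) (r c : ℕ)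
    (v : Box lam → ℂ) : co lam r c (colPerm lam w v) = co lam r (w c) v := by
  by_cases h : (r, c) ∈ lam
  · rw [colPerm, co_pi h]
    rfl
  · rw [co_of_notMem h, co_of_notMem (fun h' => h ((mem_perm_iff hw r c).1 h'))]

theorem colPerm_nilp {w : Equiv.Perm ℕ} (hw : ∀ c, lam.colLen (w c) = lam.colLen c)
    (v : Box lam → ℂ) : colPerm lam w (nilp lam v) = nilp lam (colPerm lam w v) := by
  refine ext_co fun r c h => ?_
  rw [co_colPerm hw]
  cases r with
  | zero => rw [co_nilp_zero, co_nilp_zero]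
  | succ r => rw [co_nilp_succ h, co_nilp_succ ((mem_perm_iff hw _ c).2 h), co_colPerm hw]

theorem colPerm_symm_colPerm {w : Equiv.Perm ℕ} (hw : ∀ c, lam.colLen (w c) = lam.colLen c)
    (v : Box lam → ℂ) : colPerm lam w.symm (colPerm lam w v) = v := by
  have hw' : ∀ c, lam.colLen (w.symm c) = lam.colLen c := fun c => by
    rw [← hw (w.symm c), Equiv.apply_symm_apply]
  refine ext_co fun r c _ => ?_
  rw [co_colPerm hw', co_colPerm hw, Equiv.apply_symm_apply]

end ColPerm

/-! ### Echelon reduction -/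

section Echelon

/-- Reduced echelon form for a family of functionals: the dependent ones (those in the span of
their predecessors) are combinations of the preceding independent ones, on which all values can
be prescribed. -/
theorem exists_echelon {M : Type*} [AddCommGroup M] [Module ℂ M] (φ : ℕ → M →ₗ[ℂ] ℂ) (m : ℕ) :
    ∃ (γ : Finset ℕ) (a : ℕ → ℕ → ℂ), (∀ c ∈ γ, c < m) ∧
      (∀ c ∈ γ, ∀ v, φ c v = ∑ j ∈ (Finset.range c).filter (· ∉ γ), a c j * φ j v) ∧
      ∀ u : ℕ → ℂ, ∃ v, ∀ j < m, j ∉ γ → φ j v = u j := by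
  classical
  let γ : Finset ℕ := (Finset.range m).filter fun c => φ c ∈ Submodule.span ℂ (φ '' Set.Iio c)
  have hγ : ∀ c, c ∈ γ ↔ c < m ∧ φ c ∈ Submodule.span ℂ (φ '' Set.Iio c) := by simp [γ]
  let Q : ℕ → Submodule ℂ (M →ₗ[ℂ] ℂ) := fun c =>
    Submodule.span ℂ (φ '' ((Finset.range c).filter (· ∉ γ) : Finset ℕ))
  have hQmono : ∀ c c', c ≤ c' → Q c ≤ Q c' := fun c c' h =>
    Submodule.span_mono (Set.image_mono fun j hj => by
      simp only [Finset.coe_filter, Finset.mem_range, Set.mem_ofPred_eq] at hj ⊢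
      exact ⟨hj.1.trans_le h, hj.2⟩)
  have hQ : ∀ c, c ≤ m → φ '' Set.Iio c ⊆ Q c := by
    intro c
    induction c with
    | zero => simp
    | succ c ih =>
      rintro hc _ ⟨j, hj, rfl⟩
      have ih' := ih (by omega)
      rcases (Nat.lt_succ_iff_lt_or_eq.1 hj) with h | rfl
      · exact hQmono c (c + 1) (Nat.le_succ c) (ih' ⟨j, h, rfl⟩)
      · by_cases hjγ : j ∈ γ
        · exact hQmono j (j + 1) (Nat.le_succ j) (Submodule.span_le.2 ih' ((hγ j).1 hjγ).2)
        · exact Submodule.subset_span ⟨j, by simp [hjγ], rfl⟩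
  have h1 : ∀ c ∈ γ, ∃ b : ℕ → ℂ,
      φ c = ∑ j ∈ (Finset.range c).filter (· ∉ γ), b j • φ j := by
    intro c hc
    have h2 : φ c ∈ Q c := Submodule.span_le.2 (hQ c ((hγ c).1 hc).1.le) ((hγ c).1 hc).2
    obtain ⟨b, hb⟩ := (Submodule.mem_span_image_finset_iff_exists_fun' ℂ).1 h2
    exact ⟨b, hb.symm⟩
  choose! a ha using h1
  refine ⟨γ, a, fun c hc => ((hγ c).1 hc).1, fun c hc v => ?_, fun u => ?_⟩
  · conv_lhs => rw [ha c hc]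
    simp
  · let J := (Finset.range m).filter (· ∉ γ)
    let ρ : M →ₗ[ℂ] (J → ℂ) := LinearMap.pi fun j => φ j
    have hρ : LinearMap.range ρ = ⊤ := by
      by_contra hne
      obtain ⟨f, hf0, hf⟩ := Submodule.exists_le_ker_of_lt_top _ (lt_top_iff_ne_top.2 hne)
      -- a nonzero functional `∑ β_j x_j` which vanishes on the image
      let β : ℕ → ℂ := fun j => if h : j ∈ J then f (Pi.single ⟨j, h⟩ 1) else 0
      have hβ : ∀ v, ∑ j ∈ J, β j * φ j v = 0 := by
        intro v
        have h2 : f (ρ v) = 0 := hf ⟨v, rfl⟩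
        rw [pi_eq_sum_univ' (ρ v), map_sum] at h2
        rw [← h2, ← Finset.sum_coe_sort]
        refine Finset.sum_congr rfl fun j _ => ?_
        rw [map_smul, smul_eq_mul, mul_comm]
        congr 1
        simp only [β, dif_pos j.2]
      have hβ0 : (J.filter fun j => β j ≠ 0).Nonempty := by
        by_contra hemp
        rw [Finset.not_nonempty_iff_eq_empty, Finset.filter_eq_empty_iff] at hemp
        refine hf0 (LinearMap.pi_ext' fun j => LinearMap.ext_ring ?_)
        have := hemp j.2
        simpa [β, j.2] using this
      -- the largest index involved is dependent on its predecessors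
      set j₀ := (J.filter fun j => β j ≠ 0).max' hβ0 with hj₀
      obtain ⟨hj₀J, hβj₀⟩ := Finset.mem_filter.1 (Finset.max'_mem _ hβ0)
      rw [← hj₀] at hj₀J hβj₀
      have hmem : β j₀ • φ j₀ ∈ Submodule.span ℂ (φ '' Set.Iio j₀) := by
        have h3 : ∑ j ∈ J, β j • φ j = 0 := LinearMap.ext fun v => by
          simpa using hβ v
        rw [← Finset.add_sum_erase _ _ hj₀J] at h3
        rw [eq_neg_of_add_eq_zero_left h3]
        refine Submodule.neg_mem _ (Submodule.sum_mem _ fun j hj => ?_)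
        obtain ⟨hne', hjJ⟩ := Finset.mem_erase.1 hj
        by_cases hb : β j = 0
        · rw [hb, zero_smul]
          exact Submodule.zero_mem _
        · exact Submodule.smul_mem _ _ (Submodule.subset_span ⟨j, lt_of_le_of_ne
            (Finset.le_max' _ _ (Finset.mem_filter.2 ⟨hjJ, hb⟩)) hne', rfl⟩)
      have h4 := (Submodule.smul_mem_iff _ hβj₀).1 hmem
      have h5 := Finset.mem_filter.1 hj₀J
      exact h5.2 ((hγ _).2 ⟨Finset.mem_range.1 h5.1, h4⟩)
    obtain ⟨v, hv⟩ := LinearMap.range_eq_top.1 hρ fun j => u j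
    refine ⟨v, fun j hj hjγ => ?_⟩
    exact congrFun hv ⟨j, by simp [J, hj, hjγ]⟩

variable {lam : YoungDiagram}

/-- The decomposition of the space of subspaces containing the image of the nilpotent into
(transposed) Schubert cells. -/
theorem exists_shear_mem_topZero_iff {H : Submodule ℂ (Box lam → ℂ)}
    (hH : LinearMap.range (nilp lam) ≤ H) :
    ∃ (γ : Finset ℕ) (a : ℕ → ℕ → ℂ), (∀ c ∈ γ, (0, c) ∈ lam) ∧
      ∀ v, v ∈ H ↔ shear lam γ a v ∈ topZero lam γ := by
  obtain ⟨γ, a, hγ, h1, h2⟩ := exists_echelon (fun c => (co lam 0 c).domRestrict H)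
    (lam.rowLen 0)
  have hγ' : ∀ c ∈ γ, (0, c) ∈ lam := fun c hc => YoungDiagram.mem_iff_lt_rowLen.2 (hγ c hc)
  have hle : ∀ v ∈ H, shear lam γ (-a) v ∈ topZero lam γ := by
    intro v hv
    refine mem_topZero.2 fun c hc => ?_
    rw [co_shear γ _ (hγ' c hc), if_pos hc]
    have := h1 c hc ⟨v, hv⟩
    simp only [LinearMap.domRestrict_apply] at this
    rw [this, ← Finset.sum_add_distrib]
    exact Finset.sum_eq_zero fun j _ => by simp
  refine ⟨γ, -a, hγ', fun v => ⟨hle v, fun hv => ?_⟩⟩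
  obtain ⟨v', hv'⟩ := h2 fun c => co lam 0 c v
  have h3 : v - v' ∈ LinearMap.range (nilp lam) := by
    have h4 : shear lam γ (-a) (v - v') ∈ topZero lam γ := by
      rw [map_sub]
      exact Submodule.sub_mem _ hv (hle _ v'.2)
    have h5 : ∀ j, j ∉ γ → co lam 0 j (v - v') = 0 := by
      intro j hj
      by_cases hjl : (0, j) ∈ lam
      · rw [map_sub, sub_eq_zero]
        exact (hv' j (YoungDiagram.mem_iff_lt_rowLen.1 hjl) hj).symm
      · exact co_of_notMem hjl _
    refine mem_range_nilp.2 fun c => ?_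
    by_cases hc : c ∈ γ
    · have h6 := mem_topZero.1 h4 c hc
      rw [co_shear γ _ (hγ' c hc), if_pos hc, Finset.sum_eq_zero, add_zero] at h6
      · exact h6
      · intro j hj
        rw [h5 j (Finset.mem_filter.1 hj).2, mul_zero]
    · exact h5 c hc
  have := H.add_mem (hH h3) v'.2
  rwa [sub_add_cancel] at this

/-- Every subspace containing the image of the nilpotent is carried to `⟨f_c : c ∈ γ⟩^⊥`, for a
horizontal strip, by an automorphism that commutes with the nilpotent. -/
theorem exists_range_eq {H : Submodule ℂ (Box lam → ℂ)}
    (hH : LinearMap.range (nilp lam) ≤ H) :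
    ∃ (γ : Finset ℕ) (a : ℕ → ℕ → ℂ), (∀ c ∈ γ, (0, c) ∈ lam) ∧
      ∀ (w : Equiv.Perm ℕ) (tau : YoungDiagram), (∀ c, lam.colLen (w c) = lam.colLen c) →
      IsStrip tau lam → (∀ c, w c ∈ stripCols tau lam ↔ c ∈ γ) →
      H = LinearMap.range ((shear lam γ a).comp ((colPerm lam w).comp (stripEmb tau lam))) := by
  obtain ⟨γ, a, hγ, hHa⟩ := exists_shear_mem_topZero_iff hH
  refine ⟨γ, -a, hγ, fun w tau hw hstrip hwγ => ?_⟩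
  rw [LinearMap.range_comp, LinearMap.range_comp, hstrip.range_stripEmb]
  have hw' : ∀ c, lam.colLen (w.symm c) = lam.colLen c := fun c => by
    rw [← hw (w.symm c), Equiv.apply_symm_apply]
  ext v
  rw [hHa, Submodule.mem_map]
  constructor
  · intro hv
    refine ⟨shear lam γ a v, ⟨colPerm lam w.symm (shear lam γ a v), ?_, ?_⟩,
      shear_neg_shear γ a v⟩
    · refine mem_topZero.2 fun c hc => ?_
      rw [co_colPerm hw']
      refine mem_topZero.1 hv _ ((hwγ _).1 ?_)
      rwa [Equiv.apply_symm_apply]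
    · have := colPerm_symm_colPerm hw' (shear lam γ a v)
      rwa [Equiv.symm_symm] at this
  · rintro ⟨_, ⟨u, hu, rfl⟩, rfl⟩
    rw [shear_shear_neg]
    refine mem_topZero.2 fun c hc => ?_
    rw [co_colPerm hw]
    exact mem_topZero.1 hu _ ((hwγ c).2 hc)

end Echelon

/-! ### Extending flags along an embedding -/

section Extends

variable {ι κ : Type} {n : ℕ} {μ : Fin (n + 1) → ℕ}

/-- The flag `F` is the image of `F'` under `B`, followed by the whole space. -/
def Extends (B : (κ → ℂ) →ₗ[ℂ] (ι → ℂ)) (F' : PartialFlag κ fun i : Fin n => μ i.castSucc)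
    (F : PartialFlag ι μ) : Prop :=
  ∀ i : Fin (n + 1), F.V i.castSucc = (F'.V i).map B

theorem Extends.unique {B : (κ → ℂ) →ₗ[ℂ] (ι → ℂ)}
    {F' : PartialFlag κ fun i : Fin n => μ i.castSucc} {F₁ F₂ : PartialFlag ι μ}
    (h₁ : Extends B F' F₁) (h₂ : Extends B F' F₂) : F₁ = F₂ := by
  refine PartialFlag.ext (funext fun j => ?_)
  induction j using Fin.lastCases with
  | last => rw [F₁.last, F₂.last]
  | cast i => rw [h₁ i, h₂ i]

theorem Extends.V_last {B : (κ → ℂ) →ₗ[ℂ] (ι → ℂ)}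
    {F' : PartialFlag κ fun i : Fin n => μ i.castSucc} {F : PartialFlag ι μ}
    (h : Extends B F' F) : F.V (Fin.last n).castSucc = LinearMap.range B := by
  rw [h, F'.last, Submodule.map_top]

theorem sum_eq_add_last (μ : Fin (n + 1) → ℕ) :
    ∑ i, μ i = ∑ i : Fin n, μ i.castSucc + μ (Fin.last n) := Fin.sum_univ_castSucc μ

/-- An adapted basis of a flag, followed by a basis of a complement, is an adapted basis of the
extended flag. -/
theorem exists_adaptedBasis_extends [Fintype ι] [Fintype κ]
    (p' : AdaptedBasis κ fun i : Fin n => μ i.castSucc) {B : (κ → ℂ) →ₗ[ℂ] (ι → ℂ)}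
    (hcard : Fintype.card ι = Fintype.card κ + μ (Fin.last n)) {e : Fin (μ (Fin.last n)) → ι → ℂ}
    (he : LinearMap.range B ⊔ Submodule.span ℂ (Set.range e) = ⊤) :
    ∃ p : AdaptedBasis ι μ,
      (∀ a, p.1.1 a = if h : a.val < ∑ i : Fin n, μ i.castSucc then B (p'.1.1 ⟨a, h⟩) else
        e ⟨a - ∑ i : Fin n, μ i.castSucc, by have h2 := sum_eq_add_last μ; have := a.2; omega⟩) ∧
      Extends B p'.flag p.flag := by
  have hsum : ∑ i, μ i = ∑ i : Fin n, μ i.castSucc + μ (Fin.last n) := sum_eq_add_last μ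
  let v : Fin (∑ i, μ i) → ι → ℂ := fun a =>
    if h : a.val < ∑ i : Fin n, μ i.castSucc then B (p'.1.1 ⟨a, h⟩) else
    e ⟨a - ∑ i : Fin n, μ i.castSucc, by have := a.2; omega⟩
  have htop : ⊤ ≤ Submodule.span ℂ (Set.range v) := by
    rw [← he, sup_le_iff]
    constructor
    · rw [← Submodule.map_top, ← p'.1.1.span_eq, Submodule.map_span, Submodule.span_le]
      rintro _ ⟨_, ⟨a, rfl⟩, rfl⟩
      refine Submodule.subset_span
        ⟨⟨a, by have : a.val < ∑ i : Fin n, μ i.castSucc := a.2; omega⟩, ?_⟩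
      exact dif_pos a.2
    · rw [Submodule.span_le]
      rintro _ ⟨a, rfl⟩
      refine Submodule.subset_span ⟨⟨∑ i : Fin n, μ i.castSucc + a, by have := a.2; omega⟩, ?_⟩
      refine (dif_neg (by simp)).trans ?_
      congr 1
      exact Fin.ext (by simp)
  let b := basisOfTopLeSpanOfCardEqFinrank v htop (by
    rw [Fintype.card_fin, Module.finrank_fintype_fun_eq_card, hcard, hsum,
      ← p'.flag.card_eq])
  have hb : ⇑b = v := coe_basisOfTopLeSpanOfCardEqFinrank _ _ _
  refine ⟨AdaptedBasis.ofBasis b, fun a => congrFun hb a, fun i => ?_⟩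
  rw [AdaptedBasis.V_flag, AdaptedBasis.V_flag, Submodule.map_span]
  change Submodule.span ℂ (b '' _) = _
  rw [hb]
  congr 1
  have hps : psum μ i.val = psum (fun i : Fin n => μ i.castSucc) i.val :=
    psum_castSucc (Nat.lt_succ_iff.1 i.2)
  have hle : psum μ i.val ≤ ∑ i : Fin n, μ i.castSucc := hps.le.trans (psum_le_sum _ _)
  ext x
  simp only [Set.mem_image, lowSet, Set.mem_ofPred_eq, Fin.val_castSucc]
  constructor
  · rintro ⟨a, ha, rfl⟩
    have has : a.val < ∑ i : Fin n, μ i.castSucc := ha.trans_le hle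
    exact ⟨_, ⟨⟨a, has⟩, (by rw [← hps]; exact ha), rfl⟩, (by
      simp only [v, dif_pos has])⟩
  · rintro ⟨_, ⟨a, ha, rfl⟩, rfl⟩
    exact ⟨⟨a, by have : a.val < ∑ i : Fin n, μ i.castSucc := a.2; omega⟩,
      (by rw [hps]; exact ha), dif_pos a.2⟩

theorem exists_complement [Fintype ι] [Fintype κ] {B : (κ → ℂ) →ₗ[ℂ] (ι → ℂ)}
    (hB : Function.Injective B) {k : ℕ} (hcard : Fintype.card ι = Fintype.card κ + k) :
    ∃ e : Fin k → ι → ℂ, LinearMap.range B ⊔ Submodule.span ℂ (Set.range e) = ⊤ := by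
  obtain ⟨C, hC⟩ := (LinearMap.range B).exists_isCompl
  have h1 := Submodule.finrank_add_eq_of_isCompl hC
  rw [LinearMap.finrank_range_of_inj hB, Module.finrank_fintype_fun_eq_card,
    Module.finrank_fintype_fun_eq_card] at h1
  let b := Module.finBasisOfFinrankEq ℂ C (show Module.finrank ℂ C = k by omega)
  refine ⟨fun l => b l, ?_⟩
  have h4 : Submodule.span ℂ (Set.range fun l => (b l : ι → ℂ)) = C := by
    rw [show (Set.range fun l => (b l : ι → ℂ)) = C.subtype '' Set.range b by
      rw [← Set.range_comp]; rfl, Submodule.span_image, b.span_eq, Submodule.map_subtype_top]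
  rw [h4, hC.sup_eq_top]

/-- Flags extend along every embedding of the right codimension. -/
theorem exists_extends [Fintype ι] [Fintype κ] (F' : PartialFlag κ fun i : Fin n => μ i.castSucc)
    {B : (κ → ℂ) →ₗ[ℂ] (ι → ℂ)} (hB : Function.Injective B)
    (hcard : Fintype.card ι = Fintype.card κ + μ (Fin.last n)) :
    ∃ F : PartialFlag ι μ, Extends B F' F := by
  obtain ⟨e, he⟩ := exists_complement hB hcard
  obtain ⟨p', rfl⟩ := AdaptedBasis.surjective_flag F'
  obtain ⟨p, -, hp⟩ := exists_adaptedBasis_extends p' hcard he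
  exact ⟨p.flag, hp⟩

theorem exists_of_extends {F : PartialFlag ι μ} {B : (κ → ℂ) →ₗ[ℂ] (ι → ℂ)}
    (hB : Function.Injective B) (hF : F.V (Fin.last n).castSucc = LinearMap.range B) :
    ∃ F' : PartialFlag κ fun i : Fin n => μ i.castSucc, Extends B F' F := by
  have hmap : ∀ i : Fin (n + 1), ((F.V i.castSucc).comap B).map B = F.V i.castSucc := fun i => by
    rw [Submodule.map_comap_eq, ← hF, inf_eq_right]
    exact F.monotone_V (Fin.castSucc_le_castSucc_iff.2 (Fin.le_last i))
  have hdim : ∀ i : Fin (n + 1), Module.finrank ℂ ((F.V i.castSucc).comap B) =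
      Module.finrank ℂ (F.V i.castSucc) := fun i => by
    conv_rhs => rw [← hmap i]
    exact (Submodule.equivMapOfInjective B hB _).finrank_eq
  refine ⟨⟨fun i => (F.V i.castSucc).comap B, ?_, ?_, fun i => ?_, fun i => ?_⟩,
    fun i => (hmap i).symm⟩
  · rw [Fin.castSucc_zero, F.zero, Submodule.comap_bot, LinearMap.ker_eq_bot.2 hB]
  · rw [hF, LinearMap.range_eq_map, Submodule.comap_map_eq_of_injective hB]
  · exact Submodule.comap_mono (F.monotone_V (by simp [Fin.le_def]))
  · rw [hdim, hdim]
    exact F.dim i.castSucc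

/-- If `W'` has a polynomial parametrization, then so has the set of extensions of the flags in
`W'` along a polynomial family of embeddings. -/
theorem IsParam.extend [Fintype ι] [Fintype κ] [DecidableEq ι] {σ₁ σ₂ : Type}
    {W' : Set (PartialFlag κ fun i : Fin n => μ i.castSucc)} (hW' : IsParam σ₂ W')
    {B : (κ → ℂ) →ₗ[ℂ] (ι → ℂ)} (hB : Function.Injective B)
    (hcard : Fintype.card ι = Fintype.card κ + μ (Fin.last n))
    {q : MvPolynomial σ₁ ℂ} (hq : q ≠ 0) {L : (σ₁ → ℂ) → (ι → ℂ) →ₗ[ℂ] (ι → ℂ)}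
    (hL : ∀ t, MvPolynomial.eval t q ≠ 0 → Function.Injective (L t))
    (hpoly : ∀ b b', ∃ p : MvPolynomial σ₁ ℂ, ∀ t, L t (Pi.single b' 1) b = MvPolynomial.eval t p)
    {W : Set (PartialFlag ι μ)}
    (hW : ∀ F, F ∈ W ↔ ∃ t, MvPolynomial.eval t q ≠ 0 ∧ ∃ F' ∈ W', Extends ((L t).comp B) F' F) :
    IsParam (σ₁ ⊕ σ₂) W := by
  classical
  obtain ⟨q₂, f', T', hq₂, h1, h2, rfl⟩ := hW'
  obtain ⟨e, he⟩ := exists_complement hB hcard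
  choose N hN using hpoly
  -- the coordinates of the images under `B` of the basis vectors, and of the complement
  let U : Fin (∑ i, μ i) → ι → MvPolynomial (σ₁ ⊕ σ₂) ℂ := fun a b =>
    if h : a.val < ∑ i : Fin n, μ i.castSucc then ∑ k, MvPolynomial.C (B (Pi.single k 1) b) *
      MvPolynomial.rename Sum.inr (f' (⟨a, h⟩, k))
    else MvPolynomial.C (e ⟨a - ∑ i : Fin n, μ i.castSucc, by
      have h2 := sum_eq_add_last μ; have := a.2; omega⟩ b)
  let f : Fin (∑ i, μ i) × ι → MvPolynomial (σ₁ ⊕ σ₂) ℂ := fun x =>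
    ∑ b', MvPolynomial.rename Sum.inl (N x.2 b') * U x.1 b'
  have happly : ∀ {m : Type} [Fintype m] [DecidableEq m] (A : (m → ℂ) →ₗ[ℂ] (ι → ℂ)) (v : m → ℂ)
      (b : ι), A v b = ∑ k, A (Pi.single k 1) b * v k := by
    intro m _ _ A v b
    conv_lhs => rw [pi_eq_sum_univ' v, map_sum, Finset.sum_apply]
    refine Finset.sum_congr rfl fun k _ => ?_
    rw [map_smul, Pi.smul_apply, smul_eq_mul, mul_comm]
  have hf : ∀ t t₂ (p' : AdaptedBasis κ fun i : Fin n => μ i.castSucc),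
      (∀ k, p'.coords.coord k = MvPolynomial.eval t₂ (f' k)) → ∀ a b,
      MvPolynomial.eval (Sum.elim t t₂) (f (a, b)) =
        (if h : a.val < ∑ i : Fin n, μ i.castSucc then (L t).comp B (p'.1.1 ⟨a, h⟩) else
          L t (e ⟨a - ∑ i : Fin n, μ i.castSucc, by
            have h2 := sum_eq_add_last μ; have := a.2; omega⟩)) b := by
    intro t t₂ p' hp' a b
    have hp'' : ∀ a k, p'.1.1 a k = MvPolynomial.eval t₂ (f' (a, k)) := fun a k => hp' (a, k)
    simp only [f, U, map_sum, map_mul, MvPolynomial.eval_rename, Sum.elim_comp_inl, ← hN]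
    split_ifs with h
    · rw [LinearMap.comp_apply, happly (L t)]
      refine Finset.sum_congr rfl fun b' _ => ?_
      congr 1
      rw [happly B, map_sum]
      refine Finset.sum_congr rfl fun k _ => ?_
      rw [map_mul, MvPolynomial.eval_C, MvPolynomial.eval_rename, Sum.elim_comp_inr, hp'']
    · rw [happly (L t)]
      refine Finset.sum_congr rfl fun b' _ => ?_
      rw [MvPolynomial.eval_C]
  have hex : ∀ t t₂, MvPolynomial.eval t q ≠ 0 →
      ∀ p' : AdaptedBasis κ fun i : Fin n => μ i.castSucc,
      (∀ k, p'.coords.coord k = MvPolynomial.eval t₂ (f' k)) →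
      ∃ p : AdaptedBasis ι μ, (∀ k, p.coords.coord k = MvPolynomial.eval (Sum.elim t t₂) (f k)) ∧
        Extends ((L t).comp B) p'.flag p.flag := by
    intro t t₂ ht p' hp'
    have he' : LinearMap.range ((L t).comp B) ⊔
        Submodule.span ℂ (Set.range fun l => L t (e l)) = ⊤ := by
      rw [LinearMap.range_comp, Set.range_comp' (L t) e, ← Submodule.map_span,
        ← Submodule.map_sup, he, Submodule.map_top, LinearMap.range_eq_top]
      exact LinearMap.injective_iff_surjective.1 (hL t ht)
    obtain ⟨p, hp, hext⟩ := exists_adaptedBasis_extends p' (B := (L t).comp B) hcard he'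
    refine ⟨p, fun ⟨a, b⟩ => ?_, hext⟩
    rw [hf t t₂ p' hp']
    exact congrFun (hp a) b
  let T : Set (AdaptedBasis ι μ) := {p | ∃ t t₂, MvPolynomial.eval t q ≠ 0 ∧
    MvPolynomial.eval t₂ q₂ ≠ 0 ∧ ∀ k, p.coords.coord k = MvPolynomial.eval (Sum.elim t t₂) (f k)}
  refine ⟨MvPolynomial.rename Sum.inl q * MvPolynomial.rename Sum.inr q₂, f, T,
    mul_ne_zero ?_ ?_, ?_, ?_, ?_⟩
  · rwa [Ne, map_eq_zero_iff _ (MvPolynomial.rename_injective _ Sum.inl_injective)]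
  · rwa [Ne, map_eq_zero_iff _ (MvPolynomial.rename_injective _ Sum.inr_injective)]
  · intro t ht
    rw [map_mul, mul_ne_zero_iff, MvPolynomial.eval_rename, MvPolynomial.eval_rename] at ht
    obtain ⟨p', hp', hp'c⟩ := h1 _ ht.2
    obtain ⟨p, hp, -⟩ := hex _ _ ht.1 p' hp'c
    rw [Sum.elim_comp_inl_inr] at hp
    exact ⟨p, ⟨_, _, ht.1, ht.2, by rwa [Sum.elim_comp_inl_inr]⟩, hp⟩
  · rintro p ⟨t, t₂, ht, ht₂, hp⟩
    refine ⟨Sum.elim t t₂, ?_, hp⟩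
    rw [map_mul, mul_ne_zero_iff, MvPolynomial.eval_rename, MvPolynomial.eval_rename,
      Sum.elim_comp_inl, Sum.elim_comp_inr]
    exact ⟨ht, ht₂⟩
  · ext F
    rw [hW]
    constructor
    · rintro ⟨p, ⟨t, t₂, ht, ht₂, hp⟩, rfl⟩
      obtain ⟨p', hp', hp'c⟩ := h1 _ ht₂
      obtain ⟨p₂, hp₂, hext⟩ := hex _ _ ht p' hp'c
      have : p = p₂ := AdaptedBasis.ext_basis (Module.Basis.eq_of_apply_eq fun a => funext fun b =>
        (hp (a, b)).trans (hp₂ (a, b)).symm)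
      rw [this]
      exact ⟨t, ht, p'.flag, ⟨p', hp', rfl⟩, hext⟩
    · rintro ⟨t, ht, _, ⟨p', hp', rfl⟩, hext⟩
      obtain ⟨t₂, ht₂, hp'c⟩ := h2 p' hp'
      obtain ⟨p, hp, hext'⟩ := hex _ _ ht p' hp'c
      exact ⟨p, ⟨t, t₂, ht, ht₂, hp⟩, hext'.unique hext⟩

/-- The flag variety of the zero space is a point. -/
theorem isParam_of_isEmpty [Fintype ι] [IsEmpty ι] {μ : Fin 0 → ℕ} {W : Set (PartialFlag ι μ)}
    (hW : W.Nonempty) : IsParam Empty W := by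
  have huniv : ∀ F : PartialFlag ι μ, F ∈ W := by
    intro F
    obtain ⟨F₀, hF₀⟩ := hW
    have : F = F₀ := PartialFlag.ext (funext fun j => Subsingleton.elim _ _)
    rwa [this]
  refine ⟨1, fun _ => 0, Set.univ, one_ne_zero, fun t _ => ?_, fun x _ => ?_, ?_⟩
  · obtain ⟨F, -⟩ := hW
    obtain ⟨p, -⟩ := AdaptedBasis.surjective_flag F
    exact ⟨p, trivial, fun k => isEmptyElim k.2⟩
  · exact ⟨fun _ => 0, by simp, fun k => isEmptyElim k.2⟩
  · rw [Set.image_univ_of_surjective AdaptedBasis.surjective_flag]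
    exact (Set.eq_univ_of_forall huniv).symm

end Extends

/-! ### Spaltenstein varieties as iterated fibrations -/

section Recursion

variable {lam tau : YoungDiagram} {n : ℕ}

/-- The condition defining the Spaltenstein variety inside the flag variety. -/
def IsSpaltenstein {μ : Fin n → ℕ} (F : PartialFlag (Box lam) μ) : Prop :=
  ∀ i : Fin n, (F.V i.succ).map (nilp lam) ≤ F.V i.castSucc

theorem Extends.isSpaltenstein_iff {μ : Fin (n + 1) → ℕ}
    {B : (Box tau → ℂ) →ₗ[ℂ] (Box lam → ℂ)}
    {F' : PartialFlag (Box tau) fun i : Fin n => μ i.castSucc} {F : PartialFlag (Box lam) μ}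
    (h : Extends B F' F) (hB : Function.Injective B)
    (hx : ∀ u, B (nilp tau u) = nilp lam (B u))
    (hr : LinearMap.range (nilp lam) ≤ LinearMap.range B) :
    IsSpaltenstein F ↔ IsSpaltenstein F' := by
  have hcomm : (nilp lam).comp B = B.comp (nilp tau) := LinearMap.ext fun u => (hx u).symm
  have key : ∀ i : Fin n, (F.V i.castSucc.succ).map (nilp lam) ≤ F.V i.castSucc.castSucc ↔
      (F'.V i.succ).map (nilp tau) ≤ F'.V i.castSucc := fun i => by
    rw [Fin.succ_castSucc, h, h, ← Submodule.map_comp, hcomm, Submodule.map_comp,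
      Submodule.map_le_map_iff_of_injective hB]
  refine ⟨fun hF i => (key i).1 (hF _), fun hF i => ?_⟩
  induction i using Fin.lastCases with
  | last =>
    rw [h.V_last]
    exact LinearMap.map_le_range.trans hr
  | cast i => exact (key i).2 (hF i)

theorem hasJordanType_map_iff {nu : YoungDiagram} {B : (Box tau → ℂ) →ₗ[ℂ] (Box lam → ℂ)}
    (hB : Function.Injective B) (hx : ∀ u, B (nilp tau u) = nilp lam (B u))
    {E : Submodule ℂ (Box tau → ℂ)} : HasJordanType (E.map B) nu ↔ HasJordanType E nu := by
  refine ⟨fun h => ?_, fun h => h.map hB.injOn hx⟩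
  obtain ⟨B₀, hB₀, hx₀, hr⟩ := hasJordanType_iff.1 h
  obtain ⟨G, hG⟩ := LinearMap.exists_leftInverse_of_injective B (LinearMap.ker_eq_bot.2 hB)
  have hGB : ∀ u, G (B u) = u := fun u => LinearMap.congr_fun hG u
  have hBG : ∀ u, B (G (B₀ u)) = B₀ u := fun u => by
    obtain ⟨v, -, hv⟩ : B₀ u ∈ E.map B := hr ▸ LinearMap.mem_range_self B₀ u
    rw [← hv, hGB]
  refine hasJordanType_iff.2 ⟨G.comp B₀, fun u v huv => hB₀ ?_, fun u => hB ?_, ?_⟩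
  · rw [← hBG u, ← hBG v]
    exact congrArg B huv
  · rw [LinearMap.comp_apply, LinearMap.comp_apply, hBG, hx₀, hx, hBG]
  · rw [LinearMap.range_comp, hr, ← Submodule.map_comp, hG, Submodule.map_id]

theorem IsStrip.range_nilp_le (h : IsStrip tau lam) :
    LinearMap.range (nilp lam) ≤ LinearMap.range (stripEmb tau lam) := by
  rw [h.range_stripEmb]
  exact fun v hv => mem_topZero.2 fun c _ => mem_range_nilp.1 hv c

/-- An injective endomorphism commuting with `x^λ` preserves the relation between an embedding
and the image of `x^λ`. -/
theorem range_nilp_le_comp {L : (Box lam → ℂ) →ₗ[ℂ] (Box lam → ℂ)} (hL : Function.Injective L)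
    (hLx : ∀ v, L (nilp lam v) = nilp lam (L v)) {B : (Box tau → ℂ) →ₗ[ℂ] (Box lam → ℂ)}
    (hB : LinearMap.range (nilp lam) ≤ LinearMap.range B) :
    LinearMap.range (nilp lam) ≤ LinearMap.range (L.comp B) := by
  rintro _ ⟨v, rfl⟩
  obtain ⟨u, rfl⟩ := LinearMap.injective_iff_surjective.1 hL v
  obtain ⟨t, ht⟩ := hB ⟨u, rfl⟩
  exact ⟨t, by rw [LinearMap.comp_apply, ht, hLx]⟩

theorem shear_colPerm_nilp (γ : Finset ℕ) (a : ℕ → ℕ → ℂ) {w : Equiv.Perm ℕ}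
    (hw : ∀ c, lam.colLen (w c) = lam.colLen c) (v : Box lam → ℂ) :
    (shear lam γ a).comp (colPerm lam w) (nilp lam v) =
      nilp lam ((shear lam γ a).comp (colPerm lam w) v) := by
  rw [LinearMap.comp_apply, colPerm_nilp hw, shear_nilp, LinearMap.comp_apply]

theorem injective_shear_colPerm (γ : Finset ℕ) (a : ℕ → ℕ → ℂ) {w : Equiv.Perm ℕ}
    (hw : ∀ c, lam.colLen (w c) = lam.colLen c) :
    Function.Injective ((shear lam γ a).comp (colPerm lam w)) :=
  (injective_shear γ a).comp (Function.LeftInverse.injective (colPerm_symm_colPerm hw))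

theorem IsSpaltenstein.range_nilp_le {μ : Fin (n + 1) → ℕ} {F : PartialFlag (Box lam) μ}
    (h : IsSpaltenstein F) : LinearMap.range (nilp lam) ≤ F.V (Fin.last n).castSucc := by
  have := h (Fin.last n)
  rwa [Fin.succ_last, F.last, Submodule.map_top] at this

theorem PartialFlag.card_V_last {μ : Fin (n + 1) → ℕ} (F : PartialFlag (Box lam) μ) :
    lam.card = Module.finrank ℂ (F.V (Fin.last n).castSucc) + μ (Fin.last n) := by
  have := F.dim (Fin.last n)
  rwa [Fin.succ_last, F.last, finrank_top, Module.finrank_fintype_fun_eq_card, card_box] at this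

/-- A point of a Spaltenstein variety is obtained by extending a point of a smaller one along an
embedding of the standard form. -/
theorem IsSpaltenstein.exists_extends {μ : Fin (n + 1) → ℕ} {F : PartialFlag (Box lam) μ}
    (h : IsSpaltenstein F) :
    ∃ (tau : YoungDiagram) (L : (Box lam → ℂ) →ₗ[ℂ] (Box lam → ℂ)), IsStrip tau lam ∧
      lam.card = tau.card + μ (Fin.last n) ∧
      Function.Injective L ∧ (∀ v, L (nilp lam v) = nilp lam (L v)) ∧
      ∃ F' : PartialFlag (Box tau) fun i : Fin n => μ i.castSucc, IsSpaltenstein F' ∧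
        Extends (L.comp (stripEmb tau lam)) F' F := by
  obtain ⟨γ, a, hγ, hH⟩ := exists_range_eq h.range_nilp_le
  obtain ⟨w, tau, hw, hs, hwγ, -, -⟩ := exists_perm_stripCols lam γ hγ
  have hr := hH w tau hw hs hwγ
  have hL := injective_shear_colPerm (lam := lam) γ a hw
  have hLx := shear_colPerm_nilp (lam := lam) γ a hw
  rw [← LinearMap.comp_assoc] at hr
  have hinj : Function.Injective (((shear lam γ a).comp (colPerm lam w)).comp (stripEmb tau lam)) :=
    hL.comp hs.injective_stripEmb
  obtain ⟨F', hF'⟩ := exists_of_extends hinj hr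
  refine ⟨tau, _, hs, ?_, hL, hLx, F', ?_, hF'⟩
  · rw [F.card_V_last, hr, finrank_range_of_injective hinj]
  · refine (hF'.isSpaltenstein_iff hinj (fun u => ?_)
      (range_nilp_le_comp hL hLx hs.range_nilp_le)).1 h
    rw [LinearMap.comp_apply, hs.stripEmb_nilp, hLx]
    rfl

theorem eq_bot_of_card_eq_zero (h : lam.card = 0) : lam = ⊥ :=
  YoungDiagram.ext (Finset.card_eq_zero.1 h)

theorem isEmpty_box (h : lam.card = 0) : IsEmpty (Box lam) :=
  Fintype.card_eq_zero_iff.1 ((card_box lam).trans h)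

theorem exists_partialFlag_zero (μ : Fin 0 → ℕ) (h : lam.card = 0) :
    ∃ F : PartialFlag (Box lam) μ, IsSpaltenstein F := by
  have := isEmpty_box h
  exact ⟨⟨fun _ => ⊥, rfl, Subsingleton.elim _ _, fun i => i.elim0, fun i => i.elim0⟩,
    fun i => i.elim0⟩

/-- Dominance implies that the Spaltenstein variety is not empty. -/
theorem exists_isSpaltenstein {μ : Fin n → ℕ} (hd : SubsetDominates lam μ)
    (hc : lam.card = ∑ i, μ i) : ∃ F : PartialFlag (Box lam) μ, IsSpaltenstein F := by
  induction n generalizing lam with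
  | zero => exact exists_partialFlag_zero μ (by simpa using hc)
  | succ n ih =>
    obtain ⟨tau, hs, hcard, hd'⟩ := hd.exists_strip
    have h2 := sum_eq_add_last μ
    obtain ⟨F', hF'⟩ := ih hd' (by omega)
    obtain ⟨F, hF⟩ := SpaltensteinVariety.exists_extends F' hs.injective_stripEmb
      (by rw [card_box, card_box, hcard])
    exact ⟨F, (hF.isSpaltenstein_iff hs.injective_stripEmb hs.stripEmb_nilp hs.range_nilp_le).2 hF'⟩

/-- Every point of the Spaltenstein variety determines a chain of shapes: the Jordan types of the
restrictions of `x^λ` to the members of the flag. -/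
theorem IsSpaltenstein.exists_shapeChain {μ : Fin n → ℕ} {F : PartialFlag (Box lam) μ}
    (h : IsSpaltenstein F) :
    ∃ tau : ℕ → YoungDiagram, ShapeChain lam μ tau ∧
      ∀ j : Fin (n + 1), HasJordanType (F.V j) (tau j.val) := by
  induction n generalizing lam with
  | zero =>
    have h0 : lam.card = 0 := by
      have := F.card_eq
      rwa [card_box, Finset.univ_eq_empty, Finset.sum_empty, eq_comm] at this
    obtain rfl := eq_bot_of_card_eq_zero h0
    refine ⟨fun _ => ⊥, ⟨rfl, rfl, fun i => i.elim0, fun i => i.elim0⟩, fun j => ?_⟩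
    rw [Subsingleton.elim (α := Fin 1) j (Fin.last 0), F.last]
    exact hasJordanType_top
  | succ n ih =>
    obtain ⟨tau', L, hs, hcard, hL, hLx, F', hF', hext⟩ := h.exists_extends
    obtain ⟨tau, htau, hj⟩ := ih hF'
    refine ⟨_, htau.snoc hs hcard, fun j => ?_⟩
    induction j using Fin.lastCases with
    | last =>
      rw [F.last, Fin.val_last, Function.update_self]
      exact hasJordanType_top
    | cast i =>
      rw [hext, Fin.val_castSucc, Function.update_of_ne (by have := i.2; omega)]
      refine (hj i).map (hL.comp hs.injective_stripEmb).injOn fun u => ?_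
      rw [LinearMap.comp_apply, hs.stripEmb_nilp, hLx, LinearMap.comp_apply]

end Recursion

/-! ### A finite cover by parametrized sets of small dimension -/

section Cover

variable {lam tau : YoungDiagram} {n : ℕ}

theorem shear_congr {γ : Finset ℕ} {a a' : ℕ → ℕ → ℂ}
    (h : ∀ x ∈ cellPos γ, a x.1 x.2 = a' x.1 x.2) : shear lam γ a = shear lam γ a' := by
  refine LinearMap.ext fun v => ext_co fun r c hrc => ?_
  rw [co_shear γ a hrc, co_shear γ a' hrc]
  congr 1
  refine ite_congr rfl (fun hc => Finset.sum_congr rfl fun j hj => ?_) fun _ => rfl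
  rw [Finset.mem_filter, Finset.mem_range] at hj
  rw [h ⟨c, j⟩ (mem_cellPos.2 ⟨hc, hj⟩)]

/-- The coefficients of a shear with prescribed values at the positions in `A`, and zero at the
others. -/
def cellCoef {R : Type*} [Zero R] (A : Finset ((_ : ℕ) × ℕ)) (t : A → R) (c j : ℕ) : R :=
  if h : (⟨c, j⟩ : (_ : ℕ) × ℕ) ∈ A then t ⟨_, h⟩ else 0

theorem cellCoef_of_mem {R : Type*} [Zero R] {A : Finset ((_ : ℕ) × ℕ)} (t : A → R)
    {x : (_ : ℕ) × ℕ} (h : x ∈ A) : cellCoef A t x.1 x.2 = t ⟨x, h⟩ := dif_pos h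

theorem cellCoef_of_notMem {R : Type*} [Zero R] {A : Finset ((_ : ℕ) × ℕ)} (t : A → R)
    {x : (_ : ℕ) × ℕ} (h : x ∉ A) : cellCoef A t x.1 x.2 = 0 := dif_neg h

theorem eval_cellCoef_X {A : Finset ((_ : ℕ) × ℕ)} (t : A → ℂ) (c j : ℕ) :
    MvPolynomial.eval t (cellCoef A MvPolynomial.X c j) = cellCoef A t c j := by
  unfold cellCoef
  split_ifs <;> simp

theorem shear_cellCoef (γ : Finset ℕ) (a : ℕ → ℕ → ℂ) :
    shear lam γ (cellCoef (cellPos γ) fun x => a x.1.1 x.1.2) = shear lam γ a :=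
  shear_congr fun _ hx => cellCoef_of_mem _ hx

theorem exists_polynomial_shear (γ : Finset ℕ) (A : Finset ((_ : ℕ) × ℕ)) (v : Box lam → ℂ)
    (b : Box lam) : ∃ p : MvPolynomial A ℂ, ∀ t,
      shear lam γ (cellCoef A t) v b = MvPolynomial.eval t p := by
  refine ⟨MvPolynomial.C (v b) + if b.col ∈ γ then ∑ j ∈ (Finset.range b.col).filter (· ∉ γ),
    cellCoef A MvPolynomial.X b.col j * MvPolynomial.C (co lam b.row j v) else 0, fun t => ?_⟩
  rw [← co_row_col b (shear lam γ _ v), co_shear γ _ b.mem, co_row_col, map_add,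
    MvPolynomial.eval_C]
  split_ifs
  · simp only [map_sum, map_mul, eval_cellCoef_X, MvPolynomial.eval_C]
  · rw [map_zero]

theorem dNum_succ (μ : Fin (n + 1) → ℕ) :
    dNum μ = dNum (fun i : Fin n => μ i.castSucc) + (μ (Fin.last n)).choose 2 :=
  Fin.sum_univ_castSucc _

theorem colSum_eq (h : IsStrip tau lam) :
    colSum lam = colSum tau + ∑ c ∈ stripCols tau lam, c := h.sum_cells fun j => j

/-- The set of extensions of the flags in `W'` along the embeddings obtained from `B` by
composition with the shears for `γ` whose coefficients outside `A` vanish. -/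
def extendShear {μ : Fin (n + 1) → ℕ} (γ : Finset ℕ) (A : Finset ((_ : ℕ) × ℕ))
    (B : (Box tau → ℂ) →ₗ[ℂ] (Box lam → ℂ))
    (W' : Set (PartialFlag (Box tau) fun i : Fin n => μ i.castSucc)) :
    Set (PartialFlag (Box lam) μ) :=
  {F | ∃ t : A → ℂ, ∃ F' ∈ W', Extends ((shear lam γ (cellCoef A t)).comp B) F' F}

theorem isParam_extendShear {μ : Fin (n + 1) → ℕ} (γ : Finset ℕ) (A : Finset ((_ : ℕ) × ℕ))
    {B : (Box tau → ℂ) →ₗ[ℂ] (Box lam → ℂ)} (hB : Function.Injective B)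
    (hcard : lam.card = tau.card + μ (Fin.last n))
    {W' : Set (PartialFlag (Box tau) fun i : Fin n => μ i.castSucc)} {σ : Type}
    (hW' : IsParam σ W') : IsParam (A ⊕ σ) (extendShear (μ := μ) γ A B W') := by
  refine hW'.extend hB (by rwa [card_box, card_box]) (q := 1) one_ne_zero
    (L := fun t => shear lam γ (cellCoef A t)) (fun t _ => injective_shear _ _)
    (fun b b' => exists_polynomial_shear γ A _ b) fun F => ?_
  constructor
  · rintro ⟨t, F', hF', hF⟩
    exact ⟨t, by simp, F', hF', hF⟩
  · rintro ⟨t, -, F', hF', hF⟩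
    exact ⟨t, F', hF', hF⟩

/-- The Spaltenstein variety is covered by finitely many sets with polynomial parametrizations in at
most `d_λ - d_μ` parameters: for each set `γ` of columns that `V_{n-1}` may lead to, the sets
already found for the smaller diagram are extended along all shears for `γ`. -/
theorem exists_cover {μ : Fin n → ℕ} (hc : lam.card = ∑ i, μ i) :
    ∃ 𝒲 : Set (Set (PartialFlag (Box lam) μ)), 𝒲.Finite ∧
      {F | IsSpaltenstein F} ⊆ ⋃₀ 𝒲 ∧
      ∀ W ∈ 𝒲, ∃ (σ : Type) (_ : Fintype σ), IsParam σ W ∧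
        Fintype.card σ + dNum μ ≤ colSum lam := by
  classical
  induction n generalizing lam with
  | zero =>
    have h0 : lam.card = 0 := by simpa using hc
    have := isEmpty_box h0
    refine ⟨{{F | IsSpaltenstein F}}, Set.finite_singleton _, by simp, ?_⟩
    rintro W rfl
    refine ⟨Empty, inferInstance, isParam_of_isEmpty (exists_partialFlag_zero μ h0), ?_⟩
    simp [dNum]
  | succ n ih =>
    have h2 := sum_eq_add_last μ
    have key : ∀ γ : Finset ℕ, (∀ c ∈ γ, (0, c) ∈ lam) ∧ γ.card = μ (Fin.last n) →
        ∃ 𝒲 : Set (Set (PartialFlag (Box lam) μ)), 𝒲.Finite ∧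
          (∀ F : PartialFlag (Box lam) μ, IsSpaltenstein F → ∀ a,
            (∀ (w : Equiv.Perm ℕ) (tau : YoungDiagram), (∀ c, lam.colLen (w c) = lam.colLen c) →
              IsStrip tau lam → (∀ c, w c ∈ stripCols tau lam ↔ c ∈ γ) →
              F.V (Fin.last n).castSucc = LinearMap.range
                ((shear lam γ a).comp ((colPerm lam w).comp (stripEmb tau lam)))) →
            F ∈ ⋃₀ 𝒲) ∧
          ∀ W ∈ 𝒲, ∃ (σ : Type) (_ : Fintype σ), IsParam σ W ∧
            Fintype.card σ + dNum μ ≤ colSum lam := by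
      rintro γ ⟨hγ, hγc⟩
      obtain ⟨w, tau, hw, hs, hwγ, hscard, hsum⟩ := exists_perm_stripCols lam γ hγ
      have hcard : lam.card = tau.card + μ (Fin.last n) := by rw [hs.card_eq, hscard, hγc]
      have hB : Function.Injective ((colPerm lam w).comp (stripEmb tau lam)) :=
        (Function.LeftInverse.injective (colPerm_symm_colPerm hw)).comp hs.injective_stripEmb
      obtain ⟨𝒲', hfin, hcov, hpar⟩ := ih (lam := tau) (μ := fun i : Fin n => μ i.castSucc)
        (by omega)
      refine ⟨extendShear γ (cellPos γ) ((colPerm lam w).comp (stripEmb tau lam)) '' 𝒲',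
        hfin.image _, fun F hF a ha => ?_, ?_⟩
      · have hr := ha w tau hw hs hwγ
        have hinj := (injective_shear (lam := lam) γ a).comp hB
        obtain ⟨F', hF'⟩ := exists_of_extends hinj hr
        have hsp : IsSpaltenstein F' := by
          refine (hF'.isSpaltenstein_iff hinj (fun u => ?_) ?_).1 hF
          · rw [LinearMap.comp_apply, LinearMap.comp_apply, hs.stripEmb_nilp, colPerm_nilp hw,
              shear_nilp, LinearMap.comp_apply, LinearMap.comp_apply]
          · rw [← LinearMap.comp_assoc]
            exact range_nilp_le_comp (injective_shear_colPerm γ a hw)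
              (shear_colPerm_nilp γ a hw) hs.range_nilp_le
        obtain ⟨W', hW', hFW'⟩ := hcov hsp
        refine ⟨_, ⟨W', hW', rfl⟩, fun x => a x.1.1 x.1.2, F', hFW', ?_⟩
        rwa [shear_cellCoef]
      · rintro _ ⟨W', hW', rfl⟩
        obtain ⟨σ, _, hσ, hle⟩ := hpar W' hW'
        refine ⟨_, inferInstance, isParam_extendShear γ _ hB hcard hσ, ?_⟩
        have h3 := card_cellPos_add γ
        have h4 := colSum_eq hs
        have h5 := dNum_succ μ
        rw [Fintype.card_sum, Fintype.card_coe]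
        rw [hγc] at h3
        omega
    choose! 𝒲 hfin hcov hpar using key
    let G : Set (Finset ℕ) := {γ | (∀ c ∈ γ, (0, c) ∈ lam) ∧ γ.card = μ (Fin.last n)}
    have hG : G.Finite := by
      refine (Finset.range (lam.rowLen 0)).powerset.finite_toSet.subset fun γ hγ => ?_
      rw [Finset.mem_coe, Finset.mem_powerset]
      intro c hc
      rw [Finset.mem_range]
      exact YoungDiagram.mem_iff_lt_rowLen.1 (hγ.1 c hc)
    refine ⟨⋃ γ ∈ G, 𝒲 γ, hG.biUnion fun γ hγ => hfin γ hγ, fun F hF => ?_, fun W hW => ?_⟩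
    · obtain ⟨γ, a, hγ, hH⟩ := exists_range_eq (IsSpaltenstein.range_nilp_le hF)
      have hγG : γ ∈ G := by
        refine ⟨hγ, ?_⟩
        obtain ⟨w, tau, hw, hs, hwγ, hscard, -⟩ := exists_perm_stripCols lam γ hγ
        have h3 := F.card_V_last
        have hinj : Function.Injective
            ((shear lam γ a).comp ((colPerm lam w).comp (stripEmb tau lam))) :=
          (injective_shear γ a).comp
            ((Function.LeftInverse.injective (colPerm_symm_colPerm hw)).comp hs.injective_stripEmb)
        rw [hH w tau hw hs hwγ, finrank_range_of_injective hinj, hs.card_eq] at h3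
        omega
      obtain ⟨W, hW, hFW⟩ := hcov γ hγG F hF a hH
      exact ⟨W, Set.mem_biUnion hγG hW, hFW⟩
    · obtain ⟨γ, hγ, hW⟩ := Set.mem_iUnion₂.1 hW
      exact hpar γ hγ W hW

end Cover

/-! ### Irreducibility of the sets with prescribed Jordan types -/

section Fibre

variable {lam tau : YoungDiagram} {n : ℕ}

/-- The endomorphisms commuting with `x^λ` form a linear space, in which the invertible ones are
the complement of the zero set of a nonzero polynomial. -/
theorem exists_param_commutant (lam : YoungDiagram) :
    ∃ (m : ℕ) (L : (Fin m → ℂ) → (Box lam → ℂ) →ₗ[ℂ] (Box lam → ℂ)) (q : MvPolynomial (Fin m) ℂ),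
      q ≠ 0 ∧ (∀ t v, L t (nilp lam v) = nilp lam (L t v)) ∧
      (∀ t, MvPolynomial.eval t q ≠ 0 ↔ Function.Injective (L t)) ∧
      (∀ v b, ∃ p : MvPolynomial (Fin m) ℂ, ∀ t, L t v b = MvPolynomial.eval t p) ∧
      ∀ A : (Box lam → ℂ) →ₗ[ℂ] (Box lam → ℂ), (∀ v, A (nilp lam v) = nilp lam (A v)) →
        ∃ t, L t = A := by
  classical
  let C : Submodule ℂ (Module.End ℂ (Box lam → ℂ)) :=
    LinearMap.ker (LinearMap.mulRight ℂ (nilp lam) - LinearMap.mulLeft ℂ (nilp lam))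
  have hC : ∀ A, A ∈ C ↔ ∀ v, A (nilp lam v) = nilp lam (A v) := fun A => by
    rw [LinearMap.mem_ker, LinearMap.sub_apply, sub_eq_zero, LinearMap.mulRight_apply,
      LinearMap.mulLeft_apply, LinearMap.ext_iff]
    rfl
  have : Module.Free ℂ C := Module.Free.of_divisionRing ℂ C
  let B := Module.finBasis ℂ C
  let L : (Fin (Module.finrank ℂ C) → ℂ) → (Box lam → ℂ) →ₗ[ℂ] (Box lam → ℂ) := fun t =>
    ∑ i, t i • (B i : (Box lam → ℂ) →ₗ[ℂ] (Box lam → ℂ))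
  have hL : ∀ t v b, L t v b = MvPolynomial.eval t
      (∑ i, MvPolynomial.X i * MvPolynomial.C ((B i).1 v b)) := fun t v b => by
    simp only [L, LinearMap.sum_apply, LinearMap.smul_apply, Finset.sum_apply, Pi.smul_apply,
      smul_eq_mul, map_sum, map_mul, MvPolynomial.eval_X, MvPolynomial.eval_C]
  have hsurj : ∀ A ∈ C, ∃ t, L t = A := fun A hA => by
    refine ⟨B.equivFun ⟨A, hA⟩, ?_⟩
    have := congrArg Subtype.val (B.sum_equivFun ⟨A, hA⟩)
    rw [AddSubmonoidClass.coe_finsetSum] at this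
    exact this
  let q : MvPolynomial (Fin (Module.finrank ℂ C)) ℂ := Matrix.det (Matrix.of fun b b' =>
    ∑ i, MvPolynomial.X i * MvPolynomial.C ((B i).1 (Pi.single b' 1) b))
  have hq : ∀ t, MvPolynomial.eval t q = LinearMap.det (L t) := fun t => by
    rw [← LinearMap.det_toMatrix', RingHom.map_det]
    congr 1
    ext b b'
    rw [LinearMap.toMatrix'_apply, RingHom.mapMatrix_apply, Matrix.map_apply, Matrix.of_apply]
    exact (hL t _ _).symm
  refine ⟨_, L, q, fun h0 => ?_, fun t => ?_, fun t => ?_, fun v b => ⟨_, fun t => hL t v b⟩,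
    fun A hA => hsurj A ((hC A).2 hA)⟩
  · obtain ⟨t, ht⟩ := hsurj LinearMap.id ((hC _).2 fun v => rfl)
    have := hq t
    rw [h0, map_zero, ht, LinearMap.det_id] at this
    exact one_ne_zero this.symm
  · exact (hC _).1 (Submodule.sum_mem _ fun i _ => Submodule.smul_mem _ _ (B i).2)
  · rw [hq, ← isUnit_iff_ne_zero, ← LinearMap.isUnit_iff_isUnit_det, Module.End.isUnit_iff]
    exact ⟨fun h => h.1, fun h => ⟨h, LinearMap.injective_iff_surjective.1 h⟩⟩

/-- The flags of the Spaltenstein variety with a prescribed chain of Jordan types. -/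
def fibreChain {μ : Fin n → ℕ} (tau : ℕ → YoungDiagram) : Set (PartialFlag (Box lam) μ) :=
  {F | IsSpaltenstein F ∧ ∀ j : Fin (n + 1), HasJordanType (F.V j) (tau j.val)}

/-- The flags with a prescribed chain of Jordan types are the extensions of such flags for the
smaller diagram along one fixed embedding followed by an arbitrary automorphism commuting
with `x^λ`. -/
theorem ShapeChain.exists_isParam {μ : Fin n → ℕ} {tau : ℕ → YoungDiagram}
    (h : ShapeChain lam μ tau) :
    ∃ σ : Type, IsParam σ (fibreChain tau : Set (PartialFlag (Box lam) μ)) := by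
  induction n generalizing lam with
  | zero =>
    obtain rfl : lam = ⊥ := h.last.symm.trans h.zero
    have := isEmpty_box (lam := ⊥) rfl
    refine ⟨Empty, isParam_of_isEmpty ?_⟩
    obtain ⟨F, hF⟩ := exists_partialFlag_zero (lam := ⊥) μ rfl
    refine ⟨F, hF, fun j => ?_⟩
    rw [Subsingleton.elim (α := Fin 1) j (Fin.last 0), F.last]
    exact h.last.symm ▸ hasJordanType_top
  | succ n ih =>
    obtain ⟨σ, hσ⟩ := ih h.init
    obtain ⟨m, L, q, hq, hLx, hLq, hLp, hLs⟩ := exists_param_commutant lam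
    have hs := h.strip_last
    have hcomm : ∀ t u, (L t).comp (stripEmb (tau n) lam) (nilp (tau n) u) =
        nilp lam ((L t).comp (stripEmb (tau n) lam) u) := fun t u => by
      rw [LinearMap.comp_apply, hs.stripEmb_nilp, hLx, LinearMap.comp_apply]
    refine ⟨_, hσ.extend hs.injective_stripEmb (by rw [card_box, card_box, h.card_last]) hq
      (fun t ht => (hLq t).1 ht) (fun b b' => hLp _ b) (W := fibreChain tau) fun F => ?_⟩
    constructor
    · rintro ⟨hF, hj⟩
      obtain ⟨tau', A, hs', hcard, hA, hAx, F', hF', hext⟩ := hF.exists_extends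
      have hinj := hA.comp hs'.injective_stripEmb
      have hx' : ∀ u, A.comp (stripEmb tau' lam) (nilp tau' u) =
          nilp lam (A.comp (stripEmb tau' lam) u) := fun u => by
        rw [LinearMap.comp_apply, hs'.stripEmb_nilp, hAx, LinearMap.comp_apply]
      have htau : tau' = tau n := by
        have h1 := hj (Fin.last n).castSucc
        rw [hext.V_last] at h1
        exact (hasJordanType_iff.2 ⟨_, hinj, hx', rfl⟩).unique h1
      subst htau
      obtain ⟨t, rfl⟩ := hLs A hAx
      refine ⟨t, (hLq t).2 hA, F', ⟨hF', fun j => ?_⟩, hext⟩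
      have h1 := hj j.castSucc
      rw [hext] at h1
      exact (hasJordanType_map_iff hinj hx').1 h1
    · rintro ⟨t, ht, F', ⟨hF', hj⟩, hext⟩
      have hA := (hLq t).1 ht
      have hinj := hA.comp hs.injective_stripEmb
      refine ⟨(hext.isSpaltenstein_iff hinj (hcomm t)
        (range_nilp_le_comp hA (hLx t) hs.range_nilp_le)).2 hF', fun j => ?_⟩
      induction j using Fin.lastCases with
      | last =>
        rw [F.last, Fin.val_last, h.last]
        exact hasJordanType_top
      | cast i =>
        rw [hext]
        exact (hj i).map hinj.injOn (hcomm t)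

end Fibre

/-! ### Schubert cells in echelon coordinates -/

section Perp

variable {ι : Type} [Fintype ι]

theorem mem_perp {U : Submodule ℂ (ι → ℂ)} {v : ι → ℂ} : v ∈ perp U ↔ ∀ u ∈ U, u ⬝ᵥ v = 0 :=
  Iff.rfl

theorem mem_perp_span {s : Set (ι → ℂ)} {v : ι → ℂ} :
    v ∈ perp (Submodule.span ℂ s) ↔ ∀ u ∈ s, u ⬝ᵥ v = 0 := by
  refine ⟨fun h u hu => h u (Submodule.subset_span hu), fun h u hu => ?_⟩
  induction hu using Submodule.span_induction with
  | mem u hu => exact h u hu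
  | zero => exact zero_dotProduct v
  | add u w _ _ hu hw => rw [add_dotProduct, hu, hw, add_zero]
  | smul a u _ hu => rw [smul_dotProduct, hu, smul_zero]

theorem stdVec_dotProduct [DecidableEq ι] (b : ι) (v : ι → ℂ) : stdVec b ⬝ᵥ v = v b := by
  rw [stdVec, single_one_dotProduct]

theorem perp_perp [DecidableEq ι] (U : Submodule ℂ (ι → ℂ)) : perp (perp U) = U := by
  have hnd : (Matrix.toBilin' (1 : Matrix ι ι ℂ)).Nondegenerate :=
    LinearMap.BilinForm.nondegenerate_toBilin'_of_det_ne_zero' 1 (by simp)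
  have hB : ∀ u v, Matrix.toBilin' (1 : Matrix ι ι ℂ) u v = u ⬝ᵥ v := fun u v => by
    rw [Matrix.toBilin'_apply', Matrix.one_mulVec]
  have hperp : ∀ W : Submodule ℂ (ι → ℂ),
      perp W = LinearMap.BilinForm.orthogonal (Matrix.toBilin' (1 : Matrix ι ι ℂ)) W := fun W => by
    ext v
    rw [mem_perp, LinearMap.BilinForm.mem_orthogonal_iff]
    refine forall₂_congr fun u _ => ?_
    rw [← hB]
  rw [hperp, hperp]
  refine LinearMap.BilinForm.orthogonal_orthogonal hnd (fun u v huv => ?_) U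
  rwa [hB, dotProduct_comm, ← hB]

variable [LinearOrder ι]

theorem mem_span_stdVec_Iic {b : ι} {v : ι → ℂ} :
    v ∈ Submodule.span ℂ (stdVec '' Set.Iic b) ↔ ∀ j, b < j → v j = 0 := by
  constructor
  · intro h j hj
    induction h using Submodule.span_induction with
    | mem u hu =>
      obtain ⟨i, hi, rfl⟩ := hu
      exact Pi.single_eq_of_ne (lt_of_le_of_lt hi hj).ne' _
    | zero => rfl
    | add u w _ _ hu hw => rw [Pi.add_apply, hu, hw, add_zero]
    | smul a u _ hu => rw [Pi.smul_apply, hu, smul_zero]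
  · intro h
    rw [pi_eq_sum_univ' v]
    refine Submodule.sum_mem _ fun j _ => ?_
    by_cases hj : b < j
    · rw [h j hj, zero_smul]
      exact zero_mem _
    · exact Submodule.smul_mem _ _ (Submodule.subset_span ⟨j, not_lt.1 hj, rfl⟩)

theorem cellVec_apply {k : ℕ} (c : Fin k ↪o ι) (a : Fin k → ι → ℂ) (i : Fin k) (b : ι) :
    cellVec c a i b = (if b = c i then 1 else 0) +
      if b ≤ c i ∧ ∀ l ≤ i, b ≠ c l then a i b else 0 := by
  rw [cellVec, Pi.add_apply, Finset.sum_apply, stdVec, Pi.single_apply]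
  congr 1
  have : ∀ j, (a i j • stdVec j : ι → ℂ) b = if j = b then a i b else 0 := fun j => by
    rw [Pi.smul_apply, stdVec, Pi.single_apply, smul_eq_mul, mul_ite, mul_one, mul_zero]
    by_cases h : j = b
    · rw [if_pos h, if_pos h.symm, h]
    · rw [if_neg h, if_neg (Ne.symm h)]
  rw [Finset.sum_congr rfl fun j _ => this j, Finset.sum_ite_eq']
  simp

theorem cellVec_apply_col {k : ℕ} (c : Fin k ↪o ι) (a : Fin k → ι → ℂ) (i m : Fin k) :
    cellVec c a i (c m) = if i = m then 1 else 0 := by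
  rw [cellVec_apply, if_neg (c := _ ∧ _), add_zero]
  · simp [eq_comm]
  · rintro ⟨h1, h2⟩
    exact h2 m (c.le_iff_le.1 h1) rfl

theorem cellVec_apply_of_lt {k : ℕ} (c : Fin k ↪o ι) (a : Fin k → ι → ℂ) {i : Fin k} {b : ι}
    (h : c i < b) : cellVec c a i b = 0 := by
  rw [cellVec_apply, if_neg h.ne', if_neg fun h' => h'.1.not_gt h, add_zero]

theorem linearIndependent_cellVec {k : ℕ} (c : Fin k ↪o ι) (a : Fin k → ι → ℂ) :
    LinearIndependent ℂ (cellVec c a) := by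
  rw [Fintype.linearIndependent_iff]
  intro x hx m
  have := congrFun hx (c m)
  simpa [Finset.sum_apply, cellVec_apply_col] using this

theorem finrank_span_cellVec_inf {k : ℕ} (c : Fin k ↪o ι) (a : Fin k → ι → ℂ) (b : ι) :
    Module.finrank ℂ (Submodule.span ℂ (Set.range (cellVec c a)) ⊓
      Submodule.span ℂ (stdVec '' Set.Iic b) : Submodule ℂ (ι → ℂ)) =
      (Finset.univ.filter fun l => c l ≤ b).card := by
  have h : (Submodule.span ℂ (Set.range (cellVec c a)) ⊓
      Submodule.span ℂ (stdVec '' Set.Iic b) : Submodule ℂ (ι → ℂ)) =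
      Submodule.span ℂ (Set.range fun l : {l // c l ≤ b} => cellVec c a l) := by
    refine le_antisymm (fun u hu => ?_) ?_
    · obtain ⟨h1, h2⟩ := hu
      obtain ⟨x, rfl⟩ := (Submodule.mem_span_range_iff_exists_fun ℂ).1 h1
      rw [SetLike.mem_coe, mem_span_stdVec_Iic] at h2
      have hx : ∀ m, b < c m → x m = 0 := fun m hm => by
        have := h2 _ hm
        simpa [Finset.sum_apply, cellVec_apply_col] using this
      refine Submodule.sum_mem _ fun l _ => ?_
      by_cases hl : c l ≤ b
      · exact Submodule.smul_mem _ _ (Submodule.subset_span ⟨⟨l, hl⟩, rfl⟩)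
      · rw [hx l (not_le.1 hl), zero_smul]
        exact zero_mem _
    · rw [Submodule.span_le]
      rintro _ ⟨l, rfl⟩
      refine ⟨Submodule.subset_span ⟨l, rfl⟩, ?_⟩
      rw [SetLike.mem_coe, mem_span_stdVec_Iic]
      exact fun j hj => cellVec_apply_of_lt c a (l.2.trans_lt hj)
  rw [h, finrank_span_eq_card, Fintype.card_subtype]
  exact (linearIndependent_cellVec c a).comp _ Subtype.val_injective

/-- Spans of echelon vectors lie in the Schubert cell: they meet each `⟨f_1, …, f_b⟩` in the
dimension prescribed by `c`. -/
theorem span_cellVec_mem_schubertCell {k : ℕ} (c : Fin k ↪o ι) (a : Fin k → ι → ℂ) :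
    Submodule.span ℂ (Set.range (cellVec c a)) ∈ schubertCell c := by
  refine ⟨⟨?_, fun i => ?_⟩, fun c' hc' hne hmem => hne ?_⟩
  · rw [finrank_span_eq_card (linearIndependent_cellVec c a), Fintype.card_fin]
  · rw [finrank_span_cellVec_inf, ← Fin.card_Iic]
    exact Finset.card_le_card fun l hl => by simpa using hl
  · refine DFunLike.ext _ _ fun i => (hc' i).antisymm (not_lt.1 fun hlt => ?_)
    have h1 := hmem.2 i
    rw [finrank_span_cellVec_inf] at h1
    have h2 : (Finset.univ.filter fun l => c l ≤ c' i) ⊆ Finset.Iio i := fun l hl => by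
      rw [Finset.mem_filter] at hl
      exact Finset.mem_Iio.2 (c.lt_iff_lt.1 (hl.2.trans_lt hlt))
    have h3 := Finset.card_le_card h2
    rw [Fin.card_Iio] at h3
    omega

end Perp

/-! ### The relation between a cell and the preceding one -/

section CellRel

variable {lam : YoungDiagram} {n : ℕ}

theorem le_iff_of_row {b b' : Box lam} (h : b.row = 0) :
    b' ≤ b ↔ b'.row = 0 ∧ b'.col ≤ b.col := by
  have h1 : b' ≤ b ↔ b'.row < b.row ∨ b'.row = b.row ∧ b'.col ≤ b.col := Prod.Lex.le_iff
  rw [h1, h]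
  simp

theorem Box.ext {b b' : Box lam} (h1 : b.row = b'.row) (h2 : b.col = b'.col) : b = b' :=
  (bx_congr b.mem b'.mem).2 ⟨h1, h2⟩

theorem shear_stdVec_apply (γ : Finset ℕ) (α : ℕ → ℕ → ℂ) (b b' : Box lam) :
    shear lam γ α (stdVec b') b = (if b' = b then 1 else 0) +
      if b'.row = b.row ∧ b'.col < b.col ∧ b.col ∈ γ ∧ b'.col ∉ γ then α b.col b'.col else 0 := by
  rw [← co_row_col b (shear lam γ α _), co_shear γ α b.mem, co_row_col]
  congr 1
  · rw [stdVec, Pi.single_apply]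
    exact if_congr eq_comm rfl rfl
  · by_cases hb : b.col ∈ γ
    · rw [if_pos hb]
      simp only [co_stdVec]
      by_cases hr : b.row = b'.row
      · simp only [hr, true_and, mul_ite, mul_one, mul_zero, Finset.sum_ite_eq', Finset.mem_filter,
          Finset.mem_range, hb]
      · simp [hr, Ne.symm hr]
    · simp [hb]

/-- The columns of the Schubert cell attached to a tableau and the set of columns `γ` of the strip
filled with the largest entry. -/
theorem mem_columnsWith {μ : Fin (n + 1) → ℕ} {S : SemistandardYoungTableau lam}
    (h : ShapeChain lam μ (sublevel S)) (b : Box lam) :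
    b ∈ columnsWith S (n + 1) ↔ b.row = 0 ∧ b.col ∈ stripCols (sublevel S n) lam := by
  rw [columnsWith, Finset.mem_filter, mem_stripCols]
  simp only [Finset.mem_univ, true_and]
  refine and_congr_right fun _ => ⟨?_, ?_⟩
  · rintro ⟨⟨r, c⟩, hp, rfl, hS⟩
    refine ⟨r, hp, fun h' => ?_⟩
    have := ((mem_sublevel S n).1 h').2
    dsimp only at hS
    omega
  · rintro ⟨r, hr, hr'⟩
    refine ⟨(r, b.col), hr, rfl, ?_⟩
    have h1 : (r, b.col) ∈ sublevel S (n + 1) := by rwa [h.last]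
    have h2 := ((mem_sublevel S _).1 h1).2
    have h3 : ¬ S r b.col ≤ n := fun h' => hr' ((mem_sublevel S n).2 ⟨hr, h'⟩)
    dsimp only
    omega

/-- An increasing enumeration of the boxes in the top row and in the columns in `γ`. -/
def IsColSeq {k : ℕ} (γ : Finset ℕ) (c : Fin k ↪o Box lam) : Prop :=
  ∀ b, b ∈ Set.range c ↔ b.row = 0 ∧ b.col ∈ γ

theorem isColSeq_colSeq {μ : Fin (n + 1) → ℕ} {S : SemistandardYoungTableau lam}
    (h : ShapeChain lam μ (sublevel S)) :
    IsColSeq (stripCols (sublevel S n) lam) (colSeq S (n + 1)) := fun b => by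
  rw [colSeq, Finset.range_orderEmbOfFin, Finset.mem_coe, mem_columnsWith h]

variable {k : ℕ} {γ : Finset ℕ} {c : Fin k ↪o Box lam}

theorem IsColSeq.exists_eq (hc : IsColSeq γ c) (hγ : ∀ j ∈ γ, (0, j) ∈ lam) {j : ℕ} (hj : j ∈ γ) :
    ∃ i, c i = bx (hγ j hj) := (hc _).2 ⟨rfl, hj⟩

theorem IsColSeq.mem_perp_iff (hc : IsColSeq γ c) (hγ : ∀ j ∈ γ, (0, j) ∈ lam)
    {v : Box lam → ℂ} :
    v ∈ perp (Submodule.span ℂ (Set.range fun i => stdVec (c i))) ↔ v ∈ topZero lam γ := by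
  rw [mem_perp_span, Set.forall_mem_range, mem_topZero]
  constructor
  · intro h j hj
    obtain ⟨i, hi⟩ := hc.exists_eq hγ hj
    rw [co_of_mem (hγ j hj), ← hi, ← stdVec_dotProduct (c i) v, h]
  · intro h i
    obtain ⟨h1, h2⟩ := (hc (c i)).1 ⟨i, rfl⟩
    rw [stdVec_dotProduct, ← co_row_col (c i) v, h1, h _ h2]

/-- The rows of a shear at the columns in `γ` of the top row are the vectors spanning the
corresponding point of the Schubert cell. -/
theorem IsColSeq.shear_apply (hc : IsColSeq γ c) {a : Fin k → Box lam → ℂ} {α : ℕ → ℕ → ℂ}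
    (ha : ∀ i b, b.row = 0 → a i b = α (c i).col b.col) (i : Fin k) (b : Box lam) :
    shear lam γ α (stdVec b) (c i) = cellVec c a i b := by
  obtain ⟨h1, h2⟩ := (hc (c i)).1 ⟨i, rfl⟩
  rw [shear_stdVec_apply, cellVec_apply]
  congr 1
  have hiff : (b.row = (c i).row ∧ b.col < (c i).col ∧ (c i).col ∈ γ ∧ b.col ∉ γ) ↔
      (b ≤ c i ∧ ∀ l ≤ i, b ≠ c l) := by
    rw [le_iff_of_row h1, h1]
    constructor
    · rintro ⟨h3, h4, -, h5⟩
      exact ⟨⟨h3, h4.le⟩, fun l _ hl => h5 ((hc b).1 ⟨l, hl.symm⟩).2⟩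
    · rintro ⟨⟨h3, h4⟩, h5⟩
      have h6 : b.col ∉ γ := fun h6 => by
        obtain ⟨l, hl⟩ := (hc b).2 ⟨h3, h6⟩
        refine h5 l (c.le_iff_le.1 ?_) hl.symm
        rw [hl, le_iff_of_row h1]
        exact ⟨h3, h4⟩
      exact ⟨h3, lt_of_le_of_ne h4 fun h7 => h6 (h7 ▸ h2), h2, h6⟩
  by_cases h : b ≤ c i ∧ ∀ l ≤ i, b ≠ c l
  · rw [if_pos h, if_pos (hiff.2 h), ha i b ((hiff.2 h).1.trans h1)]
  · rw [if_neg h, if_neg fun h' => h (hiff.1 h')]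

theorem shear_below (γ : Finset ℕ) (α : ℕ → ℕ → ℂ) {b : Box lam}
    (h : (b.row + 1, b.col) ∈ lam) :
    (fun b' => shear lam γ α (stdVec b') (bx h)) =
      nilp lam fun b' => shear lam γ α (stdVec b') b := by
  refine ext_co fun r j hrj => ?_
  rw [co_of_mem hrj]
  cases r with
  | zero =>
    rw [co_nilp_zero, shear_stdVec_apply, if_neg, if_neg, add_zero]
    · simp
    · rw [bx_congr]
      simp
  | succ r =>
    have hr := lam.up_left_mem (Nat.le_succ r) le_rfl hrj
    rw [co_nilp_succ hrj, co_of_mem hr]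
    have h1 : stdVec (bx hrj) = nilp lam (stdVec (bx hr)) := by
      rw [nilp_stdVec, dif_pos (by exact hrj)]
      rfl
    rw [h1, shear_nilp, ← co_of_mem h (nilp lam _), co_nilp_succ h, co_row_col]

theorem mulVec_stdVec {g : Matrix (Box lam) (Box lam) ℂ} (b b' : Box lam) :
    g.mulVec (stdVec b) b' = g b' b := by
  rw [stdVec, Matrix.mulVec_single_one, Matrix.col_apply]

theorem nilp_stdVec_ne_zero {b : Box lam} :
    nilp lam (stdVec b) ≠ 0 ↔ (b.row + 1, b.col) ∈ lam := by
  rw [nilp_stdVec]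
  split_ifs with h
  · simp [stdVec, h]
  · simp [h]

/-- The matrix `g(U)` is characterised by the property that its transpose is a shear. -/
theorem IsColSeq.isTransport_iff (hc : IsColSeq γ c) {a : Fin k → Box lam → ℂ} {α : ℕ → ℕ → ℂ}
    (ha : ∀ i b, b.row = 0 → a i b = α (c i).col b.col) (g : GL (Box lam) ℂ) :
    IsTransport c a g ↔ (g.1.transpose).mulVecLin = shear lam γ α := by
  have hcol : (∀ b, g.1.mulVec (stdVec b) = fun b' => shear lam γ α (stdVec b') b) ↔
      (g.1.transpose).mulVecLin = shear lam γ α := by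
    constructor
    · intro h
      refine LinearMap.ext fun v => ?_
      rw [eq_sum_stdVec v, map_sum, map_sum]
      refine Finset.sum_congr rfl fun b' _ => ?_
      rw [map_smul, map_smul]
      congr 1
      funext b
      rw [Matrix.mulVecLin_apply, mulVec_stdVec, Matrix.transpose_apply,
        ← mulVec_stdVec (g := g.1), h]
    · intro h b
      funext b'
      rw [← h, mulVec_stdVec, Matrix.mulVecLin_apply, mulVec_stdVec, Matrix.transpose_apply]
  have hout : ∀ b : Box lam, b.row = 0 → b ∉ Set.range c →
      (fun b' => shear lam γ α (stdVec b') b) = stdVec b := fun b hb hbc => by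
    funext b'
    have : b.col ∉ γ := fun h => hbc ((hc b).2 ⟨hb, h⟩)
    rw [shear_stdVec_apply, if_neg (c := _ ∧ _) (by tauto), add_zero, stdVec, Pi.single_apply]
  have hin : ∀ i, (fun b' => shear lam γ α (stdVec b') (c i)) = cellVec c a i := fun i =>
    funext fun b' => hc.shear_apply ha i b'
  rw [← hcol]
  constructor
  · rintro ⟨h1, h2, h3⟩ b
    obtain ⟨⟨r, j⟩, hb⟩ := b
    change g.1.mulVec (stdVec (bx (lam := lam) hb)) =
      fun b' => shear lam γ α (stdVec b') (bx (lam := lam) hb)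
    induction r with
    | zero =>
      by_cases hr : bx (lam := lam) hb ∈ Set.range c
      · obtain ⟨i, hi⟩ := hr
        rw [← hi, h1, hin]
      · rw [h2 _ rfl hr, hout _ rfl hr]
    | succ r ih =>
      have hr : (r, j) ∈ lam := lam.up_left_mem (Nat.le_succ r) le_rfl hb
      have hb' : ((bx hr).row + 1, (bx hr).col) ∈ lam := hb
      have h4 := h3 (bx hr) (nilp_stdVec_ne_zero.2 hb')
      rw [ih hr, ← shear_below γ α hb', nilp_stdVec, dif_pos hb'] at h4
      exact h4
  · intro h
    refine ⟨fun i => (h _).trans (hin i), fun b hb hbc => (h b).trans (hout b hb hbc),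
      fun b hb => ?_⟩
    rw [nilp_stdVec_ne_zero] at hb
    rw [nilp_stdVec, dif_pos hb, h, h, shear_below]

theorem IsColSeq.exists_isTransport (hc : IsColSeq γ c) (α : ℕ → ℕ → ℂ) :
    ∃ g, IsTransport c (fun i b => α (c i).col b.col) g ∧
      (g.1.transpose).mulVecLin = shear lam γ α := by
  have hmul : ∀ α' : ℕ → ℕ → ℂ, (LinearMap.toMatrix' (shear lam γ α')).transpose *
      (LinearMap.toMatrix' (shear lam γ (-α'))).transpose = 1 := fun α' => by
    rw [← Matrix.transpose_mul, ← LinearMap.toMatrix'_comp,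
      show (shear lam γ (-α')).comp (shear lam γ α') = LinearMap.id from
        LinearMap.ext (shear_neg_shear γ α'), LinearMap.toMatrix'_id, Matrix.transpose_one]
  let g : GL (Box lam) ℂ := ⟨(LinearMap.toMatrix' (shear lam γ α)).transpose,
    (LinearMap.toMatrix' (shear lam γ (-α))).transpose, hmul α, by
      have := hmul (-α)
      rwa [neg_neg] at this⟩
  have hg : (g.1.transpose).mulVecLin = shear lam γ α := by
    change ((LinearMap.toMatrix' (shear lam γ α)).transpose.transpose).mulVecLin = _
    rw [Matrix.transpose_transpose, ← Matrix.toLin'_apply', Matrix.toLin'_toMatrix']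
  exact ⟨g, (hc.isTransport_iff (fun _ _ _ => rfl) g).2 hg, hg⟩

/-- The orthogonal complement of a point of the Schubert cell is the preimage under a shear of the
orthogonal complement of the base point. -/
theorem IsColSeq.mem_perp_cellVec_iff (hc : IsColSeq γ c) (hγ : ∀ j ∈ γ, (0, j) ∈ lam)
    {a : Fin k → Box lam → ℂ} {α : ℕ → ℕ → ℂ}
    (ha : ∀ i b, b.row = 0 → a i b = α (c i).col b.col) {v : Box lam → ℂ} :
    v ∈ perp (Submodule.span ℂ (Set.range (cellVec c a))) ↔ shear lam γ α v ∈ topZero lam γ := by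
  rw [← hc.mem_perp_iff hγ, mem_perp_span, mem_perp_span, Set.forall_mem_range,
    Set.forall_mem_range]
  refine forall_congr' fun i => ?_
  have : shear lam γ α v (c i) = cellVec c a i ⬝ᵥ v := by
    conv_lhs => rw [eq_sum_stdVec v, map_sum, Finset.sum_apply]
    refine Finset.sum_congr rfl fun b _ => ?_
    rw [map_smul, Pi.smul_apply, smul_eq_mul, hc.shear_apply ha, mul_comm]
  rw [stdVec_dotProduct, this]

/-- The spanning vectors of a point of the Schubert cell involve the top row of boxes only, so their
coefficients can be indexed by pairs of columns, as those of a shear are. -/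
theorem exists_coef (hc : IsColSeq γ c) (a : Fin k → Box lam → ℂ) :
    ∃ α : ℕ → ℕ → ℂ, ∀ i b, b.row = 0 → a i b = α (c i).col b.col := by
  classical
  refine ⟨fun j l => if h : (∃ i, (c i).col = j) ∧ (0, l) ∈ lam then a h.1.choose (bx h.2) else 0,
    fun i b hb => ?_⟩
  have h : (∃ i', (c i').col = (c i).col) ∧ (0, b.col) ∈ lam := ⟨⟨i, rfl⟩, by
    have := b.mem
    rwa [hb] at this⟩
  dsimp only
  rw [dif_pos h]
  have h1 : h.1.choose = i := c.injective (Box.ext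
    (((hc _).1 ⟨_, rfl⟩).1.trans ((hc _).1 ⟨_, rfl⟩).1.symm) h.1.choose_spec)
  rw [h1]
  congr 1
  exact Box.ext hb rfl

end CellRel

/-- The embedding inverse to an intertwining isomorphism. -/
def embOf {lam tau : YoungDiagram} {E : Submodule ℂ (Box lam → ℂ)}
    (θ : E ≃ₗ[ℂ] (Box tau → ℂ)) : (Box tau → ℂ) →ₗ[ℂ] (Box lam → ℂ) :=
  E.subtype.comp θ.symm.toLinearMap

section EmbOf

variable {lam tau : YoungDiagram} {E : Submodule ℂ (Box lam → ℂ)} (θ : E ≃ₗ[ℂ] (Box tau → ℂ))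

theorem injective_embOf : Function.Injective (embOf θ) :=
  E.injective_subtype.comp θ.symm.injective

theorem range_embOf : LinearMap.range (embOf θ) = E := by
  rw [embOf, LinearMap.range_comp, LinearEquiv.range, Submodule.map_subtype_top]

theorem Intertwines.embOf_nilp {θ : E ≃ₗ[ℂ] (Box tau → ℂ)} (h : Intertwines θ)
    (u : Box tau → ℂ) : embOf θ (nilp tau u) = nilp lam (embOf θ u) := by
  obtain ⟨hE, hθ⟩ := h
  have h1 := hθ (θ.symm u)
  rw [LinearEquiv.apply_symm_apply, ← LinearEquiv.eq_symm_apply] at h1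
  exact (congrArg Subtype.val h1).symm

theorem map_submoduleOf_eq_iff {M : Submodule ℂ (Box lam → ℂ)} {M' : Submodule ℂ (Box tau → ℂ)}
    (hM : M ≤ E) : M' = (M.submoduleOf E).map θ.toLinearMap ↔ M'.map (embOf θ) = M := by
  have h1 : ((M.submoduleOf E).map θ.toLinearMap).map (embOf θ) = M := by
    rw [embOf, Submodule.map_comp, ← Submodule.map_comp θ.toLinearMap, LinearEquiv.symm_comp,
      Submodule.map_id, Submodule.submoduleOf, Submodule.map_comap_subtype, inf_eq_right.2 hM]
  refine ⟨fun h => h ▸ h1, fun h => ?_⟩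
  exact Submodule.map_injective_of_injective (injective_embOf θ) (h.trans h1.symm)

end EmbOf

theorem map_shear_eq_iff {lam : YoungDiagram} {γ : Finset ℕ} {α : ℕ → ℕ → ℂ}
    {M M' : Submodule ℂ (Box lam → ℂ)} :
    M.map (shear lam γ α) = M' ↔ M = M'.map (shear lam γ (-α)) := by
  have h1 : (shear lam γ (-α)).comp (shear lam γ α) = LinearMap.id :=
    LinearMap.ext (shear_neg_shear γ α)
  have h2 : (shear lam γ α).comp (shear lam γ (-α)) = LinearMap.id :=
    LinearMap.ext (shear_shear_neg γ α)
  constructor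
  · rintro rfl
    rw [← Submodule.map_comp, h1, Submodule.map_id]
  · rintro rfl
    rw [← Submodule.map_comp, h2, Submodule.map_id]

/-- The domain of `θ`, as the space of vectors vanishing at the tops of the columns of the strip. -/
theorem basePerp_eq {lam : YoungDiagram} {n : ℕ} {μ : Fin (n + 1) → ℕ}
    {S : SemistandardYoungTableau lam} (h : ShapeChain lam μ (sublevel S)) :
    basePerp S (n + 1) = topZero lam (stripCols (sublevel S n) lam) :=
  Submodule.ext fun _ =>
    (isColSeq_colSeq h).mem_perp_iff fun _ => top_mem_of_mem_stripCols

/-- The relation defining the cells says that the larger flag is an extension of the smaller one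
along an embedding composed with a shear. -/
theorem cellRel_iff {lam : YoungDiagram} {n : ℕ} {μ : Fin (n + 1) → ℕ}
    {S : SemistandardYoungTableau lam} (h : ShapeChain lam μ (sublevel S))
    (θ : basePerp S (n + 1) ≃ₗ[ℂ] (Box (sublevel S n) → ℂ)) (F : Spaltenstein lam μ)
    (F' : Spaltenstein (sublevel S n) (fun i : Fin n => μ i.castSucc)) :
    CellRel S θ F F' ↔ ∃ α, Extends
      ((shear lam (stripCols (sublevel S n) lam) α).comp (embOf θ)) F'.1 F.1 := by
  have hc := isColSeq_colSeq h
  have hγ : ∀ j ∈ stripCols (sublevel S n) lam, (0, j) ∈ lam := fun _ => top_mem_of_mem_stripCols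
  have hext : ∀ α, (F.1.V (Fin.last n).castSucc).map
      (shear lam (stripCols (sublevel S n) lam) α) ≤ basePerp S (n + 1) →
      ((∀ i : Fin (n + 1), F'.1.V i = (((F.1.V i.castSucc).map
        (shear lam (stripCols (sublevel S n) lam) α)).submoduleOf
        (basePerp S (n + 1))).map θ.toLinearMap) ↔
        Extends ((shear lam (stripCols (sublevel S n) lam) (-α)).comp (embOf θ)) F'.1 F.1) := by
    intro α hα
    refine forall_congr' fun i => ?_
    rw [map_submoduleOf_eq_iff, eq_comm, map_shear_eq_iff, Submodule.map_comp]
    exact (Submodule.map_mono (F.1.monotone_V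
      (Fin.castSucc_le_castSucc_iff.2 (Fin.le_last i)))).trans hα
  constructor
  · rintro ⟨-, a, g, hU, hg, hF⟩
    obtain ⟨α, hα⟩ := exists_coef hc a
    rw [(hc.isTransport_iff hα g).1 hg] at hF
    refine ⟨-α, (hext α ?_).1 hF⟩
    rw [basePerp_eq h, Submodule.map_le_iff_le_comap]
    intro v hv
    refine (hc.mem_perp_cellVec_iff hγ hα).1 ?_
    rwa [← hU, perp_perp]
  · rintro ⟨α, hα⟩
    obtain ⟨g, hg, hgα⟩ := hc.exists_isTransport (-α)
    have hV : F.1.V (Fin.last n).castSucc = perp (Submodule.span ℂ (Set.range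
        (cellVec (colSeq S (n + 1)) fun i b => (-α) (colSeq S (n + 1) i).col b.col))) := by
      ext v
      rw [hc.mem_perp_cellVec_iff hγ (α := -α) fun _ _ _ => rfl, hα.V_last, LinearMap.range_comp,
        range_embOf, basePerp_eq h, Submodule.mem_map]
      constructor
      · rintro ⟨u, hu, rfl⟩
        rwa [shear_neg_shear]
      · exact fun hv => ⟨_, hv, shear_shear_neg _ α v⟩
    have hU := congrArg perp hV
    rw [perp_perp] at hU
    refine ⟨?_, _, g, hU, hg, ?_⟩
    · rw [hU]
      exact span_cellVec_mem_schubertCell _ _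
    · rw [hgα, hext (-α), neg_neg]
      · exact hα
      · rw [Submodule.map_le_iff_le_comap, hV, basePerp_eq h]
        exact fun v hv => (hc.mem_perp_cellVec_iff hγ (α := -α) fun _ _ _ => rfl).1 hv

/-! ### Towers of irreducible sets inside the cells -/

section Tower

/-- `IsTower N W` says that `W` is the top of a chain of `N + 1` parametrized subsets of the flag
variety, each of which is separated from the preceding one by a closed condition on the dimension
of the intersection of a member of the flag with a fixed subspace. -/
inductive IsTower {ι : Type} {n : ℕ} {μ : Fin n → ℕ} : ℕ → Set (PartialFlag ι μ) → Prop
  | base {σ : Type} {W : Set (PartialFlag ι μ)} : IsParam σ W → IsTower 0 W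
  | step {σ : Type} {N : ℕ} {W W' : Set (PartialFlag ι μ)} (j : Fin (n + 1))
      (E : Submodule ℂ (ι → ℂ)) (m : ℕ) : IsTower N W → IsParam σ W' → W ⊆ W' →
      (∀ F ∈ W, m ≤ Module.finrank ℂ (F.V j ⊓ E : Submodule ℂ (ι → ℂ))) →
      (∃ F ∈ W', ¬ m ≤ Module.finrank ℂ (F.V j ⊓ E : Submodule ℂ (ι → ℂ))) → IsTower (N + 1) W'

theorem IsTower.exists_isParam {ι : Type} {n : ℕ} {μ : Fin n → ℕ} {N : ℕ}
    {W : Set (PartialFlag ι μ)} (h : IsTower N W) : ∃ σ, IsParam σ W := by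
  cases h with
  | base h => exact ⟨_, h⟩
  | step j E m _ h => exact ⟨_, h⟩

variable {lam tau : YoungDiagram} {n : ℕ}

theorem extends_shear_empty {μ : Fin (n + 1) → ℕ} {γ : Finset ℕ}
    {B : (Box tau → ℂ) →ₗ[ℂ] (Box lam → ℂ)}
    {W' : Set (PartialFlag (Box tau) fun i : Fin n => μ i.castSucc)} {F : PartialFlag (Box lam) μ} :
    F ∈ extendShear γ ∅ B W' ↔ ∃ F' ∈ W', Extends B F' F := by
  have h : ∀ t, (shear lam γ (cellCoef ∅ t)).comp B = B := fun t => by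
    refine LinearMap.ext fun u => ?_
    have h0 : cellCoef ∅ t = 0 := funext fun c => funext fun j => dif_neg (Finset.notMem_empty _)
    rw [LinearMap.comp_apply, h0, shear_zero]
  constructor
  · rintro ⟨t, hF⟩
    rwa [h] at hF
  · intro hF
    exact ⟨fun x => (Finset.notMem_empty _ x.2).elim, by rwa [h]⟩

/-- Extension along a fixed embedding preserves towers, as it preserves intersection dimensions. -/
theorem IsTower.extendShear_empty {μ : Fin (n + 1) → ℕ} (γ : Finset ℕ)
    {B : (Box tau → ℂ) →ₗ[ℂ] (Box lam → ℂ)} (hB : Function.Injective B)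
    (hcard : lam.card = tau.card + μ (Fin.last n)) {N : ℕ}
    {W' : Set (PartialFlag (Box tau) fun i : Fin n => μ i.castSucc)} (h : IsTower N W') :
    IsTower N (extendShear (μ := μ) γ ∅ B W') := by
  have hdim : ∀ {F' : PartialFlag (Box tau) fun i : Fin n => μ i.castSucc}
      {F : PartialFlag (Box lam) μ} (_ : Extends B F' F) (j : Fin (n + 1))
      (E : Submodule ℂ (Box tau → ℂ)),
      Module.finrank ℂ (F.V j.castSucc ⊓ E.map B : Submodule ℂ (Box lam → ℂ)) =
        Module.finrank ℂ (F'.V j ⊓ E : Submodule ℂ (Box tau → ℂ)) := by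
    intro F' F hF j E
    rw [hF, ← Submodule.map_inf _ hB]
    exact (Submodule.equivMapOfInjective B hB _).finrank_eq.symm
  induction h with
  | base h => exact .base (isParam_extendShear γ ∅ hB hcard h)
  | step j E m _ hp hsub hW hW' ih =>
    refine .step j.castSucc (E.map B) m ih (isParam_extendShear γ ∅ hB hcard hp) ?_ ?_ ?_
    · rintro F ⟨t, F', hF', hF⟩
      exact ⟨t, F', hsub hF', hF⟩
    · intro F hF
      obtain ⟨F', hF', hF⟩ := extends_shear_empty.1 hF
      rw [hdim hF]
      exact hW F' hF'
    · obtain ⟨F', hF', hm⟩ := hW'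
      obtain ⟨F, hF⟩ := exists_extends F' hB (by rwa [card_box, card_box])
      refine ⟨F, extends_shear_empty.2 ⟨F', hF', hF⟩, ?_⟩
      rwa [hdim hF]

/-- The span of the top basis vectors of the column `j` and of the columns in `γ` other than `c`. -/
def sepSpace (lam : YoungDiagram) (γ : Finset ℕ) (c j : ℕ) : Submodule ℂ (Box lam → ℂ) :=
  ⨅ b : {b : Box lam // ¬ (b.row = 0 ∧ (b.col = j ∨ b.col ∈ γ ∧ b.col ≠ c))},
    LinearMap.ker (LinearMap.proj b.1)

theorem mem_sepSpace {γ : Finset ℕ} {c j : ℕ} {v : Box lam → ℂ} : v ∈ sepSpace lam γ c j ↔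
    ∀ b : Box lam, ¬ (b.row = 0 ∧ (b.col = j ∨ b.col ∈ γ ∧ b.col ≠ c)) → v b = 0 := by
  simp only [sepSpace, Submodule.mem_iInf, LinearMap.mem_ker, LinearMap.proj_apply, Subtype.forall]

/-- The space `sepSpace` detects whether the coefficient of a shear at the position `(c, j)`
vanishes. -/
theorem one_le_finrank_inf_sepSpace_iff {γ : Finset ℕ} (hγ : ∀ c ∈ γ, (0, c) ∈ lam)
    (α : ℕ → ℕ → ℂ) {x : (_ : ℕ) × ℕ} (hx : x ∈ cellPos γ) :
    1 ≤ Module.finrank ℂ ((topZero lam γ).map (shear lam γ α) ⊓ sepSpace lam γ x.1 x.2 :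
      Submodule ℂ (Box lam → ℂ)) ↔ α x.1 x.2 = 0 := by
  obtain ⟨c, j⟩ := x
  obtain ⟨hc, hjc, hj⟩ := mem_cellPos.1 hx
  have h0c := hγ c hc
  have h0j : (0, j) ∈ lam := lam.up_left_mem le_rfl hjc.le h0c
  rw [Nat.one_le_iff_ne_zero, ← Nat.pos_iff_ne_zero, Module.finrank_pos_iff,
    Submodule.nontrivial_iff_ne_bot, Submodule.ne_bot_iff]
  dsimp only
  constructor
  · rintro ⟨_, ⟨⟨u, hu, rfl⟩, hv⟩, hne⟩
    rw [SetLike.mem_coe, mem_topZero] at hu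
    rw [SetLike.mem_coe, mem_sepSpace] at hv
    -- the vector `u` is supported at the top of the column `j`
    have hu' : ∀ b : Box lam, ¬ (b.row = 0 ∧ b.col = j) → b.col ∉ γ → u b = 0 := by
      intro b hb hbγ
      rw [← co_row_col b u, ← co_shear_of_notMem α _ hbγ, co_row_col]
      exact hv b (by tauto)
    have hγ0 : ∀ b : Box lam, b.col ∈ γ → shear lam γ α u b =
        u b + if b.row = 0 ∧ j < b.col then α b.col j * u (bx h0j) else 0 := by
      intro b hb
      rw [← co_row_col b (shear lam γ α u), co_shear γ α b.mem, if_pos hb, co_row_col]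
      congr 1
      have hz : ∀ l ∈ (Finset.range b.col).filter (· ∉ γ), ¬ (b.row = 0 ∧ l = j) →
          α b.col l * co lam b.row l u = 0 := by
        intro l hl hne'
        rw [Finset.mem_filter, Finset.mem_range] at hl
        have hbl : (b.row, l) ∈ lam := lam.up_left_mem le_rfl hl.1.le b.mem
        rw [co_of_mem hbl, hu' (bx hbl) hne' hl.2, mul_zero]
      split_ifs with hcase
      · rw [Finset.sum_eq_single j]
        · rw [hcase.1, co_of_mem h0j]
        · exact fun l hl hlj => hz l hl fun h => hlj h.2
        · exact fun h => (h (Finset.mem_filter.2 ⟨Finset.mem_range.2 hcase.2, hj⟩)).elim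
      · refine Finset.sum_eq_zero fun l hl => hz l hl fun h => hcase ⟨h.1, ?_⟩
        rw [Finset.mem_filter, Finset.mem_range] at hl
        exact h.2 ▸ hl.1
    have h1 := hv (bx h0c) (by
      rintro ⟨-, h | h⟩
      · exact hjc.ne' h
      · exact h.2 rfl)
    have h2 : u (bx h0c) = 0 := by
      rw [← co_of_mem h0c u]
      exact hu c hc
    rw [hγ0 (bx h0c) hc, h2, zero_add, if_pos ⟨rfl, hjc⟩, mul_eq_zero] at h1
    refine h1.resolve_right fun h3 => hne ?_
    have hu0 : u = 0 := by
      funext b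
      by_cases hb : b.col ∈ γ
      · by_cases hr : b.row = 0
        · have h4 := hu b.col hb
          rwa [← hr, co_row_col] at h4
        · have h4 := hv b (by tauto)
          rwa [hγ0 b hb, if_neg (by tauto), add_zero] at h4
      · by_cases hbj : b.row = 0 ∧ b.col = j
        · rw [show b = bx h0j from Box.ext hbj.1 hbj.2, h3]
          rfl
        · exact hu' b hbj hb
    rw [hu0, map_zero]
  · intro hα
    refine ⟨shear lam γ α (stdVec (bx h0j)), ⟨⟨_, ?_, rfl⟩, ?_⟩, fun h => ?_⟩
    · rw [SetLike.mem_coe, mem_topZero]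
      intro c' hc'
      rw [co_stdVec, if_neg]
      rintro ⟨-, h⟩
      have h' : c' = j := h
      exact hj (h' ▸ hc')
    · rw [SetLike.mem_coe, mem_sepSpace]
      intro b hb
      rw [shear_stdVec_apply, if_neg, zero_add]
      · split_ifs with h
        · obtain ⟨h1, h2, h3, h4⟩ := h
          have hbc : b.col = c := by
            by_contra hne
            exact hb ⟨h1.symm, Or.inr ⟨h3, hne⟩⟩
          rw [hbc]
          exact hα
        · rfl
      · rintro rfl
        exact hb ⟨rfl, Or.inl rfl⟩
    · have h1 := shear_neg_shear γ α (stdVec (bx h0j))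
      rw [h, map_zero] at h1
      have h2 := congrFun h1 (bx h0j)
      simp [stdVec] at h2

/-- Freeing the coefficients of the shear one after another makes a tower higher by the number of
coefficients. -/
theorem IsTower.extendShear {μ : Fin (n + 1) → ℕ} {γ : Finset ℕ} (hγ : ∀ c ∈ γ, (0, c) ∈ lam)
    {B : (Box tau → ℂ) →ₗ[ℂ] (Box lam → ℂ)} (hB : Function.Injective B)
    (hr : LinearMap.range B = topZero lam γ)
    (hcard : lam.card = tau.card + μ (Fin.last n)) {N : ℕ}
    {W' : Set (PartialFlag (Box tau) fun i : Fin n => μ i.castSucc)} (h : IsTower N W')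
    {A : Finset ((_ : ℕ) × ℕ)} (hA : A ⊆ cellPos γ) :
    IsTower (N + A.card) (SpaltensteinVariety.extendShear (μ := μ) γ A B W') := by
  classical
  obtain ⟨σ, hσ⟩ := h.exists_isParam
  induction A using Finset.induction_on with
  | empty => exact h.extendShear_empty γ hB hcard
  | insert x A hxA ih =>
    rw [Finset.insert_subset_iff] at hA
    rw [Finset.card_insert_of_notMem hxA, ← add_assoc]
    refine .step (Fin.last n).castSucc (sepSpace lam γ x.1 x.2) 1 (ih hA.2)
      (isParam_extendShear γ _ hB hcard hσ) ?_ ?_ ?_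
    · rintro F ⟨t, F', hF', hF⟩
      refine ⟨fun y => cellCoef A t y.1.1 y.1.2, F', hF', ?_⟩
      have : cellCoef (insert x A) (fun y => cellCoef A t y.1.1 y.1.2) = cellCoef A t := by
        funext c j
        by_cases hm : (⟨c, j⟩ : (_ : ℕ) × ℕ) ∈ insert x A
        · exact cellCoef_of_mem _ hm
        · rw [cellCoef_of_notMem _ hm,
            cellCoef_of_notMem (x := ⟨c, j⟩) t fun h' => hm (Finset.mem_insert_of_mem h')]
      rwa [this]
    · rintro F ⟨t, F', hF', hF⟩
      rw [hF.V_last, LinearMap.range_comp, hr, one_le_finrank_inf_sepSpace_iff hγ _ hA.1]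
      exact cellCoef_of_notMem t hxA
    · obtain ⟨F', hF'⟩ := hσ.isIrreducible.nonempty
      obtain ⟨F, hF⟩ := exists_extends (μ := μ) F'
        (B := (shear lam γ (cellCoef (insert x A) fun _ => 1)).comp B)
        ((injective_shear γ _).comp hB) (by rwa [card_box, card_box])
      refine ⟨F, ⟨_, F', hF', hF⟩, ?_⟩
      rw [hF.V_last, LinearMap.range_comp, hr, one_le_finrank_inf_sepSpace_iff hγ _ hA.1,
        cellCoef_of_mem _ (Finset.mem_insert_self x A)]
      exact one_ne_zero

end Tower

/-! ### The cells -/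

section Cells

variable {lam : YoungDiagram} {n : ℕ}

theorem ShapeChain.restrict {μ : Fin (n + 1) → ℕ} {S : SemistandardYoungTableau lam}
    (h : ShapeChain lam μ (sublevel S)) :
    ShapeChain (sublevel S n) (fun i : Fin n => μ i.castSucc)
      (sublevel (SpaltensteinVariety.restrict S n)) :=
  h.init.congr fun _ hj => sublevel_restrict S hj

/-- An isomorphism `θ` exists at each step, since the restriction of `x^λ` to `⟨f_c⟩^⊥`, for the
columns `c` of a horizontal strip, has the Jordan type of the remaining diagram. -/
theorem ShapeChain.exists_isCell {μ : Fin n → ℕ} {S : SemistandardYoungTableau lam}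
    (h : ShapeChain lam μ (sublevel S)) : ∃ Y, IsCell n μ S Y := by
  induction n generalizing lam with
  | zero => exact ⟨Set.univ, rfl⟩
  | succ n ih =>
    obtain ⟨Y', hY'⟩ := ih h.restrict
    have hJ := h.strip_last.hasJordanType
    rw [← basePerp_eq h] at hJ
    obtain ⟨θ, hθ⟩ := hJ
    exact ⟨_, θ, hθ, Y', hY', rfl⟩

theorem shear_comp_embOf_nilp {tau : YoungDiagram} {E : Submodule ℂ (Box lam → ℂ)}
    {θ : E ≃ₗ[ℂ] (Box tau → ℂ)} (hθ : Intertwines θ) (γ : Finset ℕ) (α : ℕ → ℕ → ℂ)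
    (u : Box tau → ℂ) : (shear lam γ α).comp (embOf θ) (nilp tau u) =
      nilp lam ((shear lam γ α).comp (embOf θ) u) := by
  rw [LinearMap.comp_apply, hθ.embOf_nilp, shear_nilp, LinearMap.comp_apply]

/-- The members of a flag in the cell are obtained by intertwining embeddings, which preserve Jordan
types, from those of a flag in the preceding cell. -/
theorem IsCell.subset_fibreJ {μ : Fin n → ℕ} {S : SemistandardYoungTableau lam}
    (h : ShapeChain lam μ (sublevel S)) {Y : Set (Spaltenstein lam μ)} (hY : IsCell n μ S Y) :
    Y ⊆ fibreJ μ S := by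
  induction n generalizing lam with
  | zero =>
    intro F _ j
    rw [Subsingleton.elim (α := Fin 1) j (Fin.last 0), F.1.last, Fin.val_last, h.last]
    exact hasJordanType_top
  | succ n ih =>
    obtain ⟨θ, hθ, Y', hY', rfl⟩ := hY
    rintro F ⟨F', hF', hrel⟩ j
    obtain ⟨α, hα⟩ := (cellRel_iff h θ F F').1 hrel
    induction j using Fin.lastCases with
    | last =>
      rw [F.1.last, Fin.val_last, h.last]
      exact hasJordanType_top
    | cast i =>
      rw [hα]
      have h1 := ih h.restrict hY' hF' i
      rw [sublevel_restrict S (Nat.lt_succ_iff.1 i.2)] at h1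
      exact h1.map ((injective_shear _ α).comp (injective_embOf θ)).injOn
        (shear_comp_embOf_nilp hθ _ α)

/-- A cell contains a tower of height `d_λ - d_μ`: each step adds the number of coordinates of a
Schubert cell. -/
theorem IsCell.exists_isTower {μ : Fin n → ℕ} {S : SemistandardYoungTableau lam}
    (h : ShapeChain lam μ (sublevel S)) {Y : Set (Spaltenstein lam μ)} (hY : IsCell n μ S Y) :
    ∃ N W, IsTower N W ∧ W ⊆ Subtype.val '' Y ∧ N + dNum μ = colSum lam := by
  induction n generalizing lam with
  | zero =>
    obtain rfl : Y = Set.univ := hY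
    obtain rfl : lam = ⊥ := h.last.symm.trans h.zero
    have := isEmpty_box (lam := ⊥) rfl
    refine ⟨0, {F | IsSpaltenstein F},
      .base (isParam_of_isEmpty (exists_partialFlag_zero μ rfl)),
      fun F hF => ⟨⟨F, hF⟩, trivial, rfl⟩, ?_⟩
    simp [dNum, colSum]
  | succ n ih =>
    obtain ⟨θ, hθ, Y', hY', rfl⟩ := hY
    obtain ⟨N, W', hN, hW', hcount⟩ := ih h.restrict hY'
    have hr : LinearMap.range (embOf θ) = topZero lam (stripCols (sublevel S n) lam) := by
      rw [range_embOf, basePerp_eq h]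
    refine ⟨_, _, hN.extendShear (fun _ => top_mem_of_mem_stripCols) (injective_embOf θ) hr
      h.card_last subset_rfl, ?_, ?_⟩
    · rintro F ⟨t, F', hF', hF⟩
      obtain ⟨F', hFY, rfl⟩ := hW' hF'
      have hsp : IsSpaltenstein F := by
        refine (hF.isSpaltenstein_iff ((injective_shear _ _).comp (injective_embOf θ))
          (shear_comp_embOf_nilp hθ _ _)
          (range_nilp_le_comp (injective_shear _ _) (shear_nilp _ _) ?_)).2 F'.2
        rw [hr, ← h.strip_last.range_stripEmb]
        exact h.strip_last.range_nilp_le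
      exact ⟨⟨F, hsp⟩, ⟨F', hFY, (cellRel_iff h θ _ _).2 ⟨_, hF⟩⟩, rfl⟩
    · have h1 := card_cellPos_add (stripCols (sublevel S n) lam)
      have h2 := colSum_eq h.strip_last
      have h3 := dNum_succ μ
      have h4 := h.strip_last.card_eq
      have h5 := h.card_last
      rw [show (stripCols (sublevel S n) lam).card = μ (Fin.last n) by omega] at h1
      omega

end Cells

/-! ### Dimension and irreducible components -/

section Components

theorem isIrreducible_preimage {Z P : Type*} [TopologicalSpace Z] [TopologicalSpace P] {e : Z → P}
    (he : Topology.IsInducing e) {W : Set P} (hW : IsIrreducible W) (hr : W ⊆ Set.range e) :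
    IsIrreducible (e ⁻¹' W) := by
  constructor
  · obtain ⟨x, hx⟩ := hW.nonempty
    obtain ⟨z, rfl⟩ := hr hx
    exact ⟨z, hx⟩
  · intro u v hu hv hWu hWv
    obtain ⟨u', hu', rfl⟩ := he.isOpen_iff.1 hu
    obtain ⟨v', hv', rfl⟩ := he.isOpen_iff.1 hv
    obtain ⟨x, hx, hxu⟩ := hWu
    obtain ⟨y, hy, hyv⟩ := hWv
    obtain ⟨p, hp, hpuv⟩ := hW.2 u' v' hu' hv' ⟨e x, hx, hxu⟩ ⟨e y, hy, hyv⟩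
    obtain ⟨z, rfl⟩ := hr hp
    exact ⟨z, hp, hpuv⟩

/-- Closures turn a tower into a strict chain of irreducible closed sets. -/
theorem IsTower.le_height {ι : Type} [Fintype ι] {n : ℕ} {μ : Fin n → ℕ} {N : ℕ}
    {W : Set (PartialFlag ι μ)} (h : IsTower N W) {Z : Type} [TopologicalSpace Z]
    {e : Z → PartialFlag ι μ} (he : Topology.IsInducing e) (hr : W ⊆ Set.range e) :
    ∃ C : TopologicalSpace.IrreducibleCloseds Z, (C : Set Z) = closure (e ⁻¹' W) ∧
      (N : ℕ∞) ≤ Order.height C := by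
  induction h with
  | base h => exact ⟨⟨_, (isIrreducible_preimage he h.isIrreducible hr).closure, isClosed_closure⟩,
      rfl, by simp⟩
  | @step σ N W W' j E m _ hp hsub hW hW' ih =>
    obtain ⟨C, hC, hle⟩ := ih (hsub.trans hr)
    refine ⟨⟨_, (isIrreducible_preimage he hp.isIrreducible hr).closure, isClosed_closure⟩, rfl, ?_⟩
    rw [Nat.cast_succ]
    refine (add_le_add_left hle 1).trans (Order.height_add_one_le ?_)
    rw [← SetLike.coe_ssubset_coe, hC]
    refine ⟨closure_mono (Set.preimage_mono hsub), fun hle' => ?_⟩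
    obtain ⟨F, hF, hm⟩ := hW'
    obtain ⟨z, rfl⟩ := hr hF
    have hcl : closure (e ⁻¹' W) ⊆ e ⁻¹' {F : PartialFlag ι μ | m ≤ Module.finrank ℂ
        (F.V j ⊓ E : Submodule ℂ (ι → ℂ))} :=
      closure_minimal (fun x hx => hW _ hx)
        ((isClosed_setOf_le_finrank_inf j E m).preimage he.continuous)
    exact hm (hcl (hle' (subset_closure hF)))

/-- A tower of the height given by the dimension of an irreducible space is dense in it. -/
theorem IsTower.dense {ι : Type} [Fintype ι] {n : ℕ} {μ : Fin n → ℕ} {N : ℕ}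
    {W : Set (PartialFlag ι μ)} (h : IsTower N W) {Z : Type} [TopologicalSpace Z]
    [IrreducibleSpace Z] {e : Z → PartialFlag ι μ} (he : Topology.IsInducing e)
    (hr : W ⊆ Set.range e) (hdim : topologicalKrullDim Z ≤ (N : ℕ)) :
    Dense (e ⁻¹' W) ∧ topologicalKrullDim Z = (N : ℕ) := by
  obtain ⟨C, hC, hle⟩ := h.le_height he hr
  have hle' : ((N : ℕ∞) : WithBot ℕ∞) ≤ topologicalKrullDim Z :=
    (WithBot.coe_le_coe.2 hle).trans (Order.height_le_krullDim C)
  refine ⟨?_, le_antisymm hdim hle'⟩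
  rw [dense_iff_closure_eq, ← hC]
  by_contra hne
  let U : TopologicalSpace.IrreducibleCloseds Z :=
    ⟨Set.univ, IrreducibleSpace.isIrreducible_univ Z, isClosed_univ⟩
  have hlt : C < U := by
    rw [← SetLike.coe_ssubset_coe]
    exact Set.ssubset_univ_iff.2 hne
  have h1 := Order.height_add_one_le hlt
  have h2 := (WithBot.coe_le_coe.2 ((add_le_add_left hle 1).trans h1)).trans
    ((Order.height_le_krullDim U).trans hdim)
  have h3 : ((N : ℕ∞) + 1) ≤ (N : ℕ∞) := WithBot.coe_le_coe.1 h2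
  have h4 : N + 1 ≤ N := by exact_mod_cast h3
  omega

variable {lam : YoungDiagram} {n : ℕ} {μ : Fin n → ℕ}

/-- Every irreducible subset of the Spaltenstein variety lies in the closure of one of finitely
many parametrized sets of dimension at most `d_λ - d_μ`. -/
theorem topologicalKrullDim_le (hc : lam.card = ∑ i, μ i) {Z : Set (Spaltenstein lam μ)}
    (hZ : IsIrreducible Z) :
    ∃ m : ℕ, m + dNum μ ≤ colSum lam ∧ topologicalKrullDim Z ≤ (m : ℕ) := by
  obtain ⟨𝒲, hfin, hcov, hpar⟩ := exists_cover hc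
  have hZ' : IsIrreducible (Subtype.val '' Z) := hZ.image _ continuous_subtype_val.continuousOn
  classical
  obtain ⟨C, hC, hsub⟩ := isIrreducible_iff_sUnion_isClosed.1 hZ' (hfin.toFinset.image closure)
    (by
      intro C hC
      obtain ⟨W, -, rfl⟩ := Finset.mem_image.1 hC
      exact isClosed_closure)
    (by
      rintro _ ⟨F, -, rfl⟩
      obtain ⟨W, hW, hFW⟩ := hcov F.2
      exact ⟨closure W, Finset.mem_coe.2 (Finset.mem_image_of_mem _ (hfin.mem_toFinset.2 hW)),
        subset_closure hFW⟩)
  obtain ⟨W, hW, rfl⟩ := Finset.mem_image.1 hC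
  obtain ⟨σ, _, hσ, hle⟩ := hpar W (hfin.mem_toFinset.1 hW)
  refine ⟨_, hle, le_trans ?_ hσ.topologicalKrullDim_closure_le⟩
  let e : Z → closure W := fun z => ⟨z.1.1, hsub ⟨z.1, z.2, rfl⟩⟩
  have hval : Topology.IsInducing (Subtype.val : closure W → PartialFlag (Box lam) μ) :=
    Topology.IsInducing.subtypeVal
  have he : Topology.IsInducing e := by
    have hcomp : Topology.IsInducing fun z : Z => z.1.1 :=
      Topology.IsInducing.subtypeVal.comp Topology.IsInducing.subtypeVal
    exact hval.of_comp_iff.1 hcomp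
  exact he.topologicalKrullDim_le

/-- A closed irreducible subset of the Spaltenstein variety containing a cell is the closure of
the cell. -/
theorem IsCell.eq_closure {S : SemistandardYoungTableau lam} (h : ShapeChain lam μ (sublevel S))
    {Y : Set (Spaltenstein lam μ)} (hY : IsCell n μ S Y) {Z : Set (Spaltenstein lam μ)}
    (hZ : IsIrreducible Z) (hZc : IsClosed Z) (hYZ : Y ⊆ Z) :
    Z = closure Y ∧ topologicalKrullDim Z = (colSum lam - dNum μ : ℕ) := by
  obtain ⟨N, W, hN, hW, hcount⟩ := hY.exists_isTower h
  obtain ⟨m, hm, hdim⟩ := topologicalKrullDim_le h.card_eq_psum hZ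
  have hN' : colSum lam - dNum μ = N := by omega
  have : IrreducibleSpace Z := Subtype.irreducibleSpace hZ
  have hr : W ⊆ Set.range (Subtype.val ∘ Subtype.val : Z → PartialFlag (Box lam) μ) := by
    intro F hF
    obtain ⟨G, hG, rfl⟩ := hW hF
    exact ⟨⟨G, hYZ hG⟩, rfl⟩
  obtain ⟨hd, hdim'⟩ := hN.dense (Z := Z)
    (Topology.IsInducing.subtypeVal.comp Topology.IsInducing.subtypeVal) hr
    (hdim.trans (by exact_mod_cast (show m ≤ N by omega)))
  rw [hN']
  refine ⟨(Subtype.dense_iff.1 hd).trans (closure_mono ?_) |>.antisymm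
    (closure_minimal hYZ hZc), hdim'⟩
  rintro _ ⟨z, hz, rfl⟩
  obtain ⟨F, hF, hFz⟩ := hW hz
  rwa [← Subtype.ext hFz]

/-- Irreducibility passes from the parametrized set of flags to the subspace `X^λ_μ`. -/
theorem isIrreducible_fibreJ {S : SemistandardYoungTableau lam}
    (h : ShapeChain lam μ (sublevel S)) : IsIrreducible (fibreJ μ S) := by
  obtain ⟨σ, hσ⟩ := h.exists_isParam
  have h1 := isIrreducible_preimage Topology.IsInducing.subtypeVal hσ.isIrreducible
    (show _ ⊆ Set.range (Subtype.val : Spaltenstein lam μ → _) from fun F hF => ⟨⟨F, hF.1⟩, rfl⟩)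
  have h2 : fibreJ μ S = (Subtype.val : Spaltenstein lam μ → PartialFlag (Box lam) μ) ⁻¹'
      fibreChain (sublevel S) := by
    ext F
    exact (and_iff_right F.2).symm
  rw [h2]
  exact h1

/-- The dimensions of the kernels of the powers of `x^λ` on the members of the flag do not
decrease under specialization. -/
theorem card_filter_le_of_mem_closure {S S' : SemistandardYoungTableau lam}
    {F : Spaltenstein lam μ} (hF : F ∈ fibreJ μ S) (hF' : F ∈ closure (fibreJ μ S'))
    (j : Fin (n + 1)) (i : ℕ) (hcard : (sublevel S j).card = (sublevel S' j).card) :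
    ((sublevel S j).cells.filter fun b => i ≤ b.1).card ≤
      ((sublevel S' j).cells.filter fun b => i ≤ b.1).card := by
  have h1 := (hF j).finrank_inf_ker i
  let m := (sublevel S' j).card - ((sublevel S' j).cells.filter fun b => i ≤ b.1).card
  have h2 : closure (fibreJ μ S') ⊆ Subtype.val ⁻¹' {F : PartialFlag (Box lam) μ |
      m ≤ Module.finrank ℂ
        (F.V j ⊓ LinearMap.ker (nilp lam ^ i) : Submodule ℂ (Box lam → ℂ))} := by
    refine closure_minimal (fun G hG => ?_)
      ((isClosed_setOf_le_finrank_inf j _ m).preimage continuous_subtype_val)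
    have h3 := (hG j).finrank_inf_ker i
    change m ≤ _
    omega
  have h4 : m ≤ _ := h2 hF'
  have h5 : ((sublevel S' j).cells.filter fun b => i ≤ b.1).card ≤ (sublevel S' j).card :=
    Finset.card_filter_le _ _
  omega

/-- If two closures agree, each of the sets `J⁻¹(S)` and `J⁻¹(S')` lies in the closure of the other,
so semicontinuity makes all kernel dimensions, hence the two tableaux, equal. -/
theorem closure_fibreJ_injective (hsum : ∑ i, μ i = lam.card) :
    Function.Injective fun S : Std lam μ => closure (fibreJ μ S.1) := by
  intro S S' (h : closure _ = closure _)
  obtain ⟨F, hF⟩ := (isIrreducible_fibreJ (S.shapeChain hsum)).nonempty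
  obtain ⟨F', hF'⟩ := (isIrreducible_fibreJ (S'.shapeChain hsum)).nonempty
  refine Std.ext_sublevel hsum fun j hj => ?_
  let j' : Fin (n + 1) := ⟨j, Nat.lt_succ_iff.2 hj⟩
  have hcard : (sublevel S.1 j'.val).card = (sublevel S'.1 j'.val).card := by
    rw [← (hF j').finrank_eq, ← (hF' j').finrank_eq, F.1.finrank_V, F'.1.finrank_V]
  exact eq_of_card_filter_eq fun i => le_antisymm
    (card_filter_le_of_mem_closure hF (h ▸ subset_closure hF) j' i hcard)
    (card_filter_le_of_mem_closure hF' (h.symm ▸ subset_closure hF') j' i hcard.symm)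

theorem finite_std (hsum : ∑ i, μ i = lam.card) : Finite (Std lam μ) := by
  let f : Std lam μ → Fin (n + 1) → lam.cells.powerset := fun S j =>
    ⟨(sublevel S.1 j).cells, Finset.mem_powerset.2 (Finset.filter_subset _ _)⟩
  refine Finite.of_injective f fun S S' h => Std.ext_sublevel hsum fun j hj => ?_
  exact YoungDiagram.ext (congrArg Subtype.val (congrFun h ⟨j, Nat.lt_succ_iff.2 hj⟩))

/-- Every irreducible component is the closure of one of the sets `J⁻¹(S)`. -/
theorem exists_eq_closure_fibreJ (hsum : ∑ i, μ i = lam.card) {Z : Set (Spaltenstein lam μ)}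
    (hZ : Z ∈ irreducibleComponents (Spaltenstein lam μ)) :
    ∃ S : Std lam μ, Z = closure (fibreJ μ S.1) := by
  classical
  have := finite_std (μ := μ) hsum
  have hfin := Set.finite_range fun S : Std lam μ => closure (fibreJ μ S.1)
  obtain ⟨C, hC, hsub⟩ := isIrreducible_iff_sUnion_isClosed.1 hZ.1 hfin.toFinset
    (by
      intro C hC
      obtain ⟨S, rfl⟩ := hfin.mem_toFinset.1 hC
      exact isClosed_closure)
    (by
      intro F _
      obtain ⟨tau, htau, hj⟩ := IsSpaltenstein.exists_shapeChain F.2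
      obtain ⟨S, hS⟩ := htau.exists_std
      refine ⟨closure (fibreJ μ S.1), by simp, subset_closure fun j => ?_⟩
      rw [hS _ (Nat.lt_succ_iff.1 j.2)]
      exact hj j)
  obtain ⟨S, rfl⟩ := hfin.mem_toFinset.1 hC
  exact ⟨S, hsub.antisymm (hZ.2 (isIrreducible_fibreJ (S.shapeChain hsum)).closure hsub)⟩

end Components

end SpaltensteinVariety

end

open SpaltensteinVariety

theorem mainTheorem9 (n : ℕ) (lam : YoungDiagram) (μ : Fin n → ℕ)
    (hrows : lam.colLen 0 ≤ n) (hsum : ∑ i, μ i = lam.card)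
    (hdom : Dominates lam (sortDesc μ)) :
    (dNum μ ≤ dNum (fun i : Fin n => lam.rowLen i) ∧
      IsEquidimensional (Spaltenstein lam μ)
        (dNum (fun i : Fin n => lam.rowLen i) - dNum μ)) ∧
    (∀ S : Std lam μ, ∃ Y : Set (Spaltenstein lam μ), IsCell n μ S.1 Y) ∧
    ∀ Y : Std lam μ → Set (Spaltenstein lam μ), (∀ S, IsCell n μ S.1 (Y S)) →
      (∀ S, closure (Y S) = closure (fibreJ μ S.1)) ∧
      Function.Injective (fun S => closure (Y S)) ∧
      irreducibleComponents (Spaltenstein lam μ) = Set.range (fun S => closure (Y S)) := by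
  rw [dNum_rowLen_eq_colSum hrows]
  have hne : Nonempty (Spaltenstein lam μ) := by
    obtain ⟨F, hF⟩ := exists_isSpaltenstein hdom.subsetDominates hsum.symm
    exact ⟨⟨F, hF⟩⟩
  have hcl : ∀ (S : Std lam μ) (Y : Set (Spaltenstein lam μ)), IsCell n μ S.1 Y →
      closure (fibreJ μ S.1) = closure Y ∧
      topologicalKrullDim (closure (fibreJ μ S.1)) = (colSum lam - dNum μ : ℕ) := fun S Y hY =>
    hY.eq_closure (S.shapeChain hsum) (isIrreducible_fibreJ (S.shapeChain hsum)).closure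
      isClosed_closure ((hY.subset_fibreJ (S.shapeChain hsum)).trans subset_closure)
  refine ⟨⟨?_, hne, fun Z hZ => ?_⟩, fun S => (S.shapeChain hsum).exists_isCell, fun Y hY => ?_⟩
  -- `d_μ ≤ d_λ` since the dimension bound `d_λ - d_μ` applies to a point
  · obtain ⟨F⟩ := hne
    obtain ⟨m, hm, -⟩ := topologicalKrullDim_le hsum.symm (isIrreducible_singleton (x := F))
    omega
  · obtain ⟨S, rfl⟩ := exists_eq_closure_fibreJ hsum hZ
    obtain ⟨Y, hY⟩ := (S.shapeChain hsum).exists_isCell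
    exact (hcl S Y hY).2
  · have hYJ : ∀ S, closure (Y S) = closure (fibreJ μ S.1) := fun S => (hcl S _ (hY S)).1.symm
    refine ⟨hYJ, fun S S' h => closure_fibreJ_injective hsum ?_, Set.Subset.antisymm ?_ ?_⟩
    · exact (hYJ S).symm.trans (h.trans (hYJ S'))
    · intro Z hZ
      obtain ⟨S, rfl⟩ := exists_eq_closure_fibreJ hsum hZ
      exact ⟨S, hYJ S⟩
    · rintro _ ⟨S, rfl⟩
      -- a component containing the closure of the cell equals it
      obtain ⟨Z, hZ, hsub⟩ := exists_mem_irreducibleComponents_subset_of_isIrreducible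
        (closure (Y S)) (hYJ S ▸ (isIrreducible_fibreJ (S.shapeChain hsum)).closure)
      have := ((hY S).eq_closure (S.shapeChain hsum) hZ.1
        (isClosed_of_mem_irreducibleComponents Z hZ) (subset_closure.trans hsub)).1
      change closure (Y S) ∈ _
      rwa [← this]
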